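/- Consider the following randomized algorithm (ChordalGen using the PrunedTree method). Its input is an integer $n\ge 1$, a rational edge deletion fraction $f\in[0,1]$ and a real selection barrier $s\in[0,1]$. 1. Generate a random tree $T$ with node set $\{1,\dots,n\}$: either (a) uniformly at random among all trees on this node set, or (b) by starting with a single node and repeating $n-1$ times: pick a uniformly random node of the current tree and add a new node adjacent to it. 2. (PrunedTree.) Independently for $i=1,\dots,n$: choose uniformly at random a set of $\lfloor (n-1)f\rfloor$ edges of $T$ and delete them from a copy of $T$; let $d$ be the number of distinct sizes (numbers of nodes) of the resulting connected components; choose uniformly at random a size $k_i$ among the $\max(1,\lceil (1-s)d\rceil)$ largest of these distinct sizes; let $T_i$ be a uniformly random one among the components with $k_i$ nodes. 3. Output the intersection graph $G$ of $V(T_1),\dots,V(T_n)$: its vertices are $v_1,\dots,v_n$, and $v_i,v_j$ with $i\ne j$ are adjacent if and only if $V(T_i)\cap V(T_j)\neq\emptyset$. Then this algorithm runs in time $O\big(n^2+\sum_{i=1}^n |V(T_i)|\big)$ on a randomized unit-cost random access machine (addition, truncated subtraction, comparison, indirect addressing, uniformly random choice below a given bound; $f$ is given by numerator and denominator, $s$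 is accessed through comparisons $s\cdot a<b$ with integers $a,b$). More precisely, for each of the two choices (a), (b) in step 1 there are a program $P$ for this machine and a constant $C$ such that for all $n\ge 1$, $f$ and $s$: $P$ always terminates, leaving in memory a tree $T$ (as an edge list), subtrees $T_1,\dots,T_n$ of $T$ (as node lists) and a graph $G$ (in adjacency list representation); the joint law of $(T,(V(T_1),\dots,V(T_n)),G)$ is that of the algorithm above; and in every run the running time is at most $C\,\big(n^2+\sum_{i=1}^n |V(T_i)|\big)$ for the subtrees $T_i$ of this run. -/

import Mathlib

/-! ### A randomized unit-cost random access machine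

Programs are structured programs over finitely many of the registers `reg 0, reg 1, …` and arrays
`arr 0, arr 1, …`, all of them holding natural numbers. The only arithmetic is addition and
truncated subtraction. Arrays are accessed by index in one step. There is one instruction that
draws a uniformly random number below a given bound. A real input parameter `s` cannot be stored in
a register; the machine can only compare it with quotients of registers. -/

/-- The memory of the machine. -/
structure Mem where
  reg : ℕ → ℕ
  arr : ℕ → ℕ → ℕ

/-- Deterministic elementary instructions. -/
inductive Instr
  /-- `reg x := c` -/
  | const (x c : ℕ)
  /-- `reg x := reg y` -/
  | copy (x y : ℕ)
  /-- `reg x := reg y + reg z` -/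
  | add (x y z : ℕ)
  /-- `reg x := reg y - reg z` (and `0` if the difference is negative) -/
  | sub (x y z : ℕ)
  /-- `reg x := arr a [reg y]` -/
  | load (x a y : ℕ)
  /-- `arr a [reg y] := reg x` -/
  | store (a y x : ℕ)

namespace Mem

/-- Overwrite register `x`. -/
def setReg (m : Mem) (x v : ℕ) : Mem :=
  { m with reg := Function.update m.reg x v }

/-- Overwrite entry `i` of array `a`. -/
def setArr (m : Mem) (a i v : ℕ) : Mem :=
  { m with arr := Function.update m.arr a (Function.update (m.arr a) i v) }

end Mem

/-- The effect of an elementary instruction. -/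
def Instr.apply : Instr → Mem → Mem
  | .const x c, m => m.setReg x c
  | .copy x y, m => m.setReg x (m.reg y)
  | .add x y z, m => m.setReg x (m.reg y + m.reg z)
  | .sub x y z, m => m.setReg x (m.reg y - m.reg z)
  | .load x a y, m => m.setReg x (m.arr a (m.reg y))
  | .store a y x, m => m.setArr a (m.reg y) (m.reg x)

/-- Elementary tests. -/
inductive Test
  /-- `reg x < reg y` -/
  | lt (x y : ℕ)
  /-- `reg x ≤ reg y` -/
  | le (x y : ℕ)
  /-- `reg x = reg y` -/
  | eq (x y : ℕ)
  /-- `reg x ≠ reg y` -/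
  | ne (x y : ℕ)
  /-- `s * reg x < reg y`, where `s` is the real input parameter -/
  | paramLt (x y : ℕ)
  /-- `reg y ≤ s * reg x`, where `s` is the real input parameter -/
  | paramGe (x y : ℕ)

/-- The truth value of a test in memory `m`, for the real input parameter `s`. -/
def Test.Holds (s : ℝ) : Test → Mem → Prop
  | .lt x y, m => m.reg x < m.reg y
  | .le x y, m => m.reg x ≤ m.reg y
  | .eq x y, m => m.reg x = m.reg y
  | .ne x y, m => m.reg x ≠ m.reg y
  | .paramLt x y, m => s * (m.reg x : ℝ) < (m.reg y : ℝ)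
  | .paramGe x y, m => (m.reg y : ℝ) ≤ s * (m.reg x : ℝ)

/-- Programs. -/
inductive Prog
  | skip
  | instr (i : Instr)
  /-- `reg x :=` a uniformly random element of `{0, …, reg y - 1}` -/
  | rand (x y : ℕ)
  | seq (p q : Prog)
  | ite (t : Test) (p q : Prog)
  | while (t : Test) (p : Prog)

/-- `Exec s p m μ`: with real parameter `s`, the program `p` started in memory `m` terminates
whatever random numbers are drawn, and `μ` is the joint law of its final memory and of its running
time. Every elementary instruction, every random draw, every `skip` and every evaluation of a test
takes one time unit. Random draws are independent. A draw from an empty range aborts, i.e. has no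
execution. -/
inductive Exec (s : ℝ) : Prog → Mem → PMF (Mem × ℕ) → Prop
  | skip (m : Mem) : Exec s .skip m (PMF.pure (m, 1))
  | instr (i : Instr) (m : Mem) : Exec s (.instr i) m (PMF.pure (i.apply m, 1))
  | rand (x y : ℕ) (m : Mem) (h : (Finset.range (m.reg y)).Nonempty) :
      Exec s (.rand x y) m
        ((PMF.uniformOfFinset (Finset.range (m.reg y)) h).map fun v => (m.setReg x v, 1))
  | seq (p q : Prog) (m : Mem) (μ : PMF (Mem × ℕ)) (κ : Mem → PMF (Mem × ℕ))
      (hp : Exec s p m μ) (hq : ∀ a ∈ μ.support, Exec s q a.1 (κ a.1)) :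
      Exec s (.seq p q) m (μ.bind fun a => (κ a.1).map fun b => (b.1, a.2 + b.2))
  | iteTrue (t : Test) (p q : Prog) (m : Mem) (μ : PMF (Mem × ℕ))
      (ht : t.Holds s m) (hp : Exec s p m μ) :
      Exec s (.ite t p q) m (μ.map fun a => (a.1, a.2 + 1))
  | iteFalse (t : Test) (p q : Prog) (m : Mem) (μ : PMF (Mem × ℕ))
      (ht : ¬ t.Holds s m) (hq : Exec s q m μ) :
      Exec s (.ite t p q) m (μ.map fun a => (a.1, a.2 + 1))
  | whileTrue (t : Test) (p : Prog) (m : Mem) (μ : PMF (Mem × ℕ))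
      (ht : t.Holds s m) (hp : Exec s (.seq p (.while t p)) m μ) :
      Exec s (.while t p) m (μ.map fun a => (a.1, a.2 + 1))
  | whileFalse (t : Test) (p : Prog) (m : Mem) (ht : ¬ t.Holds s m) :
      Exec s (.while t p) m (PMF.pure (m, 1))

/-! ### Random host trees -/

noncomputable section

/-- Trees with node set `Fin n`. -/
abbrev LabelledTree (n : ℕ) : Type := {T : SimpleGraph (Fin n) // T.IsTree}

instance LabelledTree.instFintype (n : ℕ) : Fintype (LabelledTree n) := Fintype.ofFinite _

instance LabelledTree.instNonempty (n : ℕ) [NeZero n] : Nonempty (LabelledTree n) :=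
  ⟨⟨_, SimpleGraph.isTree_starGraph (0 : Fin n)⟩⟩

/-- The graph obtained from `T` by adding the new node `n` and joining it to `x`. -/
def attachGraph {n : ℕ} (T : SimpleGraph (Fin n)) (x : Fin n) : SimpleGraph (Fin (n + 1)) :=
  T.map Fin.castSuccEmb ⊔ SimpleGraph.edge x.castSucc (Fin.last n)

theorem attachGraph_isTree {n : ℕ} {T : SimpleGraph (Fin n)} (hT : T.IsTree) (x : Fin n) :
    (attachGraph T x).IsTree := by
  classical
  have hle : T.map Fin.castSuccEmb ≤ attachGraph T x := le_sup_left
  have hreach : ∀ u v : Fin n, (attachGraph T x).Reachable u.castSucc v.castSucc := fun u v =>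
    ((hT.1.preconnected u v).map (SimpleGraph.Embedding.map Fin.castSuccEmb T).toHom).mono hle
  have hlast : (attachGraph T x).Reachable x.castSucc (Fin.last n) := by
    refine SimpleGraph.Adj.reachable (Or.inr ?_)
    rw [SimpleGraph.edge_adj]
    exact ⟨Or.inl ⟨rfl, rfl⟩, (Fin.castSucc_lt_last x).ne⟩
  have hx : ∀ u : Fin (n + 1), (attachGraph T x).Reachable x.castSucc u := fun u => by
    induction u using Fin.lastCases with
    | last => exact hlast
    | cast u => exact hreach x u
  have h1 : T.edgeFinset.card + 1 = n := by simpa using hT.card_edgeFinset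
  have hne : x.castSucc ≠ Fin.last n := (Fin.castSucc_lt_last x).ne
  have hnot : ¬ (T.map Fin.castSuccEmb).Adj x.castSucc (Fin.last n) := by
    intro h
    obtain ⟨a, b, -, -, hb⟩ := (SimpleGraph.map_adj _ _ _ _).1 h
    exact (Fin.castSucc_lt_last b).ne hb
  rw [SimpleGraph.isTree_iff_connected_and_card]
  refine ⟨(SimpleGraph.connected_iff _).2 ⟨fun u v => (hx u).symm.trans (hx v), ⟨Fin.last n⟩⟩, ?_⟩
  have h2 : (attachGraph T x).edgeFinset.card = T.edgeFinset.card + 1 := by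
    have h3 := SimpleGraph.card_edgeFinset_map Fin.castSuccEmb T
    have h4 : (attachGraph T x).edgeFinset.card = (T.map Fin.castSuccEmb).edgeFinset.card + 1 := by
      convert SimpleGraph.card_edgeFinset_sup_edge _ hnot hne
      rfl
    rw [h4, ← h3]
    congr!
  rw [Nat.card_eq_fintype_card, Nat.card_eq_fintype_card, Fintype.card_fin,
    ← SimpleGraph.edgeFinset_card, h2, h1]

/-- Attach a new node to the node `x` of the tree `T`. -/
def LabelledTree.attach {n : ℕ} (T : LabelledTree n) (x : Fin n) : LabelledTree (n + 1) :=
  ⟨attachGraph T.1 x, attachGraph_isTree T.2 x⟩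

/-- Growing a random tree: start with a single node, and repeatedly pick a uniformly random node of
the current tree and add a new node adjacent to it. -/
def attachmentTree : (n : ℕ) → [NeZero n] → PMF (LabelledTree n)
  | 0, h => absurd rfl h.out
  | 1, _ => PMF.pure ⟨⊥, SimpleGraph.IsTree.of_subsingleton⟩
  | n + 2, _ => (attachmentTree (n + 1)).bind fun T =>
      (PMF.uniformOfFintype (Fin (n + 1))).map fun x => T.attach x

/-- The two ways of generating the host tree: uniformly at random among all trees with node set
`Fin n`, or by random attachment. -/
inductive HostTreeMethod
  | uniform
  | attachment

/-- The law of the host tree. -/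
def hostTree (M : HostTreeMethod) (n : ℕ) [NeZero n] : PMF (LabelledTree n) :=
  match M with
  | .uniform => PMF.uniformOfFintype (LabelledTree n)
  | .attachment => attachmentTree n

/-! ### The method PrunedTree -/

section Pruned

open scoped Classical in
/-- The node sets of the connected components of a graph. -/
def componentSets {n : ℕ} (H : SimpleGraph (Fin n)) : Finset (Finset (Fin n)) :=
  Finset.univ.image fun x => Finset.univ.filter fun y => H.Reachable x y

/-- The set of the distinct sizes of the connected components of a graph. -/
def componentSizes {n : ℕ} (H : SimpleGraph (Fin n)) : Finset ℕ :=
  (componentSets H).image Finset.card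

open scoped Classical in
/-- The highest `100 (1 - s) %` of the numbers in `K`: the `⌈(1 - s) |K|⌉` largest ones, but at
least the largest one. -/
def highest (K : Finset ℕ) (s : ℝ) : Finset ℕ :=
  K.filter fun k => (∀ l ∈ K, l ≤ k) ∨
    (((K.filter fun l => k < l).card : ℕ) : ℝ) < (1 - s) * (K.card : ℝ)

/-- The node sets of the components with `k` nodes. -/
def componentsOfSize {n : ℕ} (H : SimpleGraph (Fin n)) (k : ℕ) : Finset (Finset (Fin n)) :=
  (componentSets H).filter fun A => A.card = k

open scoped Classical in
/-- The possible sets of edges to delete. -/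
def deletionSets {n : ℕ} (T : LabelledTree n) (f : Set.Icc (0 : ℚ) 1) :
    Finset (Finset (Sym2 (Fin n))) :=
  T.1.edgeFinset.powersetCard ⌊((n : ℚ) - 1) * f.1⌋₊

theorem deletionSets_nonempty {n : ℕ} (T : LabelledTree n) (f : Set.Icc (0 : ℚ) 1) :
    (deletionSets T f).Nonempty := by
  classical
  obtain ⟨f, h0, h1⟩ := f
  refine Finset.powersetCard_nonempty.2 ?_
  have hc : T.1.edgeFinset.card + 1 = n := by
    simpa using T.2.card_edgeFinset
  have hn : ((n : ℚ) - 1) = (T.1.edgeFinset.card : ℚ) := by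
    have hq : ((T.1.edgeFinset.card : ℚ) + 1) = n := by exact_mod_cast hc
    linarith
  refine Nat.floor_le_of_le ?_
  simp only
  rw [hn]
  exact mul_le_of_le_one_right (Nat.cast_nonneg _) h1

theorem componentSizes_nonempty {n : ℕ} [NeZero n] (H : SimpleGraph (Fin n)) :
    (componentSizes H).Nonempty := by
  classical
  exact (Finset.univ_nonempty.image _).image _

theorem highest_nonempty {K : Finset ℕ} (hK : K.Nonempty) (s : ℝ) : (highest K s).Nonempty := by
  classical
  exact ⟨K.max' hK, Finset.mem_filter.2 ⟨K.max'_mem hK, Or.inl fun l hl => K.le_max' l hl⟩⟩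

theorem componentsOfSize_nonempty {n : ℕ} {H : SimpleGraph (Fin n)} {s : ℝ} {k : ℕ}
    (hk : k ∈ highest (componentSizes H) s) : (componentsOfSize H k).Nonempty := by
  classical
  obtain ⟨A, hA, rfl⟩ := Finset.mem_image.1 (Finset.mem_filter.1 hk).1
  exact ⟨A, Finset.mem_filter.2 ⟨hA, rfl⟩⟩

/-- One subtree, given by its node set: delete `⌊(n - 1) f⌋` random edges, pick a random size among
the highest `100 (1 - s) %` of the distinct component sizes, and pick a random component of that
size. -/
def prunedSubtree {n : ℕ} [NeZero n] (T : LabelledTree n) (f : Set.Icc (0 : ℚ) 1) (s : ℝ) :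
    PMF (Finset (Fin n)) :=
  (PMF.uniformOfFinset (deletionSets T f) (deletionSets_nonempty T f)).bind fun D =>
    (PMF.uniformOfFinset (highest (componentSizes (T.1.deleteEdges (D : Set (Sym2 (Fin n))))) s)
        (highest_nonempty (componentSizes_nonempty _) s)).bindOnSupport fun k hk =>
      PMF.uniformOfFinset (componentsOfSize (T.1.deleteEdges (D : Set (Sym2 (Fin n)))) k)
        (componentsOfSize_nonempty
          ((PMF.mem_support_uniformOfFinset_iff
            (highest_nonempty (componentSizes_nonempty _) s) k).1 hk))

/-- `k` independent samples from `μ`. -/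
def iidSamples {α : Type} (μ : PMF α) : (k : ℕ) → PMF (Fin k → α)
  | 0 => PMF.pure Fin.elim0
  | k + 1 => (iidSamples μ k).bind fun v => μ.map fun a => Fin.snoc v a

/-- The method PrunedTree: `n` independent subtrees of `T`. -/
def prunedTree {n : ℕ} [NeZero n] (T : LabelledTree n) (f : Set.Icc (0 : ℚ) 1) (s : ℝ) :
    PMF (Fin n → Finset (Fin n)) :=
  iidSamples (prunedSubtree T f s) n

end Pruned

/-! ### The algorithm ChordalGen -/

/-- The intersection graph of a family of sets. -/
def intersectionGraph {n : ℕ} (F : Fin n → Finset (Fin n)) : SimpleGraph (Fin n) where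
  Adj i j := i ≠ j ∧ (F i ∩ F j).Nonempty
  symm := ⟨fun i j h => ⟨h.1.symm, by rw [Finset.inter_comm]; exact h.2⟩⟩
  loopless := ⟨fun _ h => h.1 rfl⟩

/-- What is generated in one run of ChordalGen. -/
@[ext] structure GenResult (n : ℕ) where
  /-- the host tree `T` -/
  host : SimpleGraph (Fin n)
  /-- the node sets of the subtrees `T_1, …, T_n` -/
  sub : Fin n → Finset (Fin n)
  /-- the output graph `G` -/
  graph : SimpleGraph (Fin n)

/-- The sum of the numbers of nodes of the subtrees. -/
def GenResult.totalSize {n : ℕ} (r : GenResult n) : ℕ := ∑ i, (r.sub i).card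

/-- The law of the result of ChordalGen with the method PrunedTree: generate the host tree, generate
`n` subtrees by PrunedTree, output their intersection graph. -/
def chordalGenPruned (M : HostTreeMethod) (n : ℕ) [NeZero n] (f : Set.Icc (0 : ℚ) 1) (s : ℝ) :
    PMF (GenResult n) :=
  (hostTree M n).bind fun T => (prunedTree T f s).map fun F => ⟨T.1, F, intersectionGraph F⟩

end

/-! ### Input and output conventions -/

/-- The initial memory on input `n` and `f = p / q` in lowest terms: the numbers `n`, `p`, `q` in
the first three registers, and zero everywhere else. -/
def inputMem (n : ℕ) (f : ℚ) : Mem where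
  reg x := if x = 0 then n else if x = 1 then f.num.toNat else if x = 2 then f.den else 0
  arr _ _ := 0

/-- Arrays `a` and `b` store the edges of `T`, as a list of `n - 1` pairs of end nodes. -/
def StoresTree {n : ℕ} (m : Mem) (a b : ℕ) (T : SimpleGraph (Fin n)) : Prop :=
  ∀ u v : Fin n, T.Adj u v ↔ ∃ k < n - 1,
    (m.arr a k = u.val ∧ m.arr b k = v.val) ∨ (m.arr a k = v.val ∧ m.arr b k = u.val)

/-- Arrays `a` and `b` store the family `F` of finite sets as consecutive lists without
repetitions: the elements of `F i` are the entries of array `b` from position `arr a [i]` up to, but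
not including, position `arr a [i + 1]`. -/
def StoresLists {n : ℕ} (m : Mem) (a b : ℕ) (F : Fin n → Set (Fin n)) : Prop :=
  ∀ i : Fin n, m.arr a i.val ≤ m.arr a (i.val + 1) ∧
    Set.InjOn (m.arr b) (Set.Ico (m.arr a i.val) (m.arr a (i.val + 1))) ∧
    (m.arr b) '' (Set.Ico (m.arr a i.val) (m.arr a (i.val + 1))) = Fin.val '' F i

/-- The memory holds the host tree (as an edge list), the subtrees (as lists of nodes) and the output
graph (in adjacency list representation). -/
def StoresResult {n : ℕ} (m : Mem) (r : GenResult n) : Prop :=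
  StoresTree m 0 1 r.host ∧
  StoresLists m 2 3 (fun i => (r.sub i : Set (Fin n))) ∧
  StoresLists m 4 5 (fun v => r.graph.neighborSet v)

/-! ### Determinism of the machine, and the part of the memory a program does not write -/

/-- Sequential composition. -/
infixr:60 " ;; " => Prog.seq

theorem PMF.bind_congr_on_support {α β : Type*} {μ : PMF α} {f g : α → PMF β}
    (h : ∀ a ∈ μ.support, f a = g a) : μ.bind f = μ.bind g := by
  rw [← PMF.bindOnSupport_eq_bind, ← PMF.bindOnSupport_eq_bind]
  congr 1
  funext a ha
  exact h a ha

theorem Exec.unique {s : ℝ} {p : Prog} {m : Mem} {μ : PMF (Mem × ℕ)} (h : Exec s p m μ) :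
    ∀ μ', Exec s p m μ' → μ = μ' := by
  induction h with
  | skip m => intro μ' h'; cases h'; rfl
  | instr i m => intro μ' h'; cases h'; rfl
  | rand x y m h => intro μ' h'; cases h'; rfl
  | seq p q m μ κ hp hq ihp ihq =>
    intro μ' h'
    cases h' with
    | seq _ _ _ μ₂ κ₂ hp₂ hq₂ =>
      obtain rfl := ihp _ hp₂
      exact PMF.bind_congr_on_support fun a ha => by rw [ihq a ha _ (hq₂ a ha)]
  | iteTrue t p q m μ ht hp ih =>
    intro μ' h'
    cases h' with
    | iteTrue _ _ _ _ μ₂ _ hp₂ => rw [ih _ hp₂]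
    | iteFalse _ _ _ _ μ₂ ht₂ => exact absurd ht ht₂
  | iteFalse t p q m μ ht hp ih =>
    intro μ' h'
    cases h' with
    | iteTrue _ _ _ _ μ₂ ht₂ => exact absurd ht₂ ht
    | iteFalse _ _ _ _ μ₂ _ hp₂ => rw [ih _ hp₂]
  | whileTrue t p m μ ht hp ih =>
    intro μ' h'
    cases h' with
    | whileTrue _ _ _ μ₂ _ hp₂ => rw [ih _ hp₂]
    | whileFalse _ _ _ ht₂ => exact absurd ht ht₂
  | whileFalse t p m ht =>
    intro μ' h'
    cases h' with
    | whileTrue _ _ _ μ₂ ht₂ => exact absurd ht₂ ht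
    | whileFalse _ _ _ => rfl

/-- Whether an instruction writes register `r`. -/
def Instr.writesReg : Instr → ℕ → Bool
  | .const x _, r => x == r
  | .copy x _, r => x == r
  | .add x _ _, r => x == r
  | .sub x _ _, r => x == r
  | .load x _ _, r => x == r
  | .store _ _ _, _ => false

/-- Whether an instruction writes array `b`. -/
def Instr.writesArr : Instr → ℕ → Bool
  | .store a _ _, b => a == b
  | _, _ => false

/-- Whether a program contains an instruction that writes register `r`. -/
def Prog.writesReg : Prog → ℕ → Bool
  | .skip, _ => false
  | .instr i, r => i.writesReg r
  | .rand x _, r => x == r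
  | .seq p q, r => p.writesReg r || q.writesReg r
  | .ite _ p q, r => p.writesReg r || q.writesReg r
  | .while _ p, r => p.writesReg r

/-- Whether a program contains an instruction that writes array `b`. -/
def Prog.writesArr : Prog → ℕ → Bool
  | .skip, _ => false
  | .instr i, b => i.writesArr b
  | .rand _ _, _ => false
  | .seq p q, b => p.writesArr b || q.writesArr b
  | .ite _ p q, b => p.writesArr b || q.writesArr b
  | .while _ p, b => p.writesArr b

/-- The memories `m` and `m'` agree on everything that `p` does not write. -/
structure Unch (p : Prog) (m m' : Mem) : Prop where
  reg : ∀ x, p.writesReg x = false → m'.reg x = m.reg x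
  arr : ∀ a, p.writesArr a = false → m'.arr a = m.arr a

theorem Unch.refl (p : Prog) (m : Mem) : Unch p m m := ⟨fun _ _ => rfl, fun _ _ => rfl⟩

theorem Unch.trans {p : Prog} {m₁ m₂ m₃ : Mem} (h : Unch p m₁ m₂) (h' : Unch p m₂ m₃) :
    Unch p m₁ m₃ :=
  ⟨fun x hx => (h'.reg x hx).trans (h.reg x hx), fun a ha => (h'.arr a ha).trans (h.arr a ha)⟩

theorem Unch.mono {p q : Prog} {m m' : Mem} (h : Unch p m m')
    (hr : ∀ x, q.writesReg x = false → p.writesReg x = false)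
    (ha : ∀ a, q.writesArr a = false → p.writesArr a = false) : Unch q m m' :=
  ⟨fun x hx => h.reg x (hr x hx), fun a h' => h.arr a (ha a h')⟩

namespace Mem

@[simp] theorem reg_setReg (m : Mem) (x v y : ℕ) :
    (m.setReg x v).reg y = if y = x then v else m.reg y := by
  simp [setReg, Function.update_apply]

@[simp] theorem arr_setReg (m : Mem) (x v : ℕ) : (m.setReg x v).arr = m.arr := rfl

@[simp] theorem reg_setArr (m : Mem) (a i v : ℕ) : (m.setArr a i v).reg = m.reg := rfl

theorem arr_setArr (m : Mem) (a i v b j : ℕ) :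
    (m.setArr a i v).arr b j = if b = a then if j = i then v else m.arr b j else m.arr b j := by
  by_cases h : b = a
  · subst h; simp [setArr, Function.update_apply]
  · simp [setArr, h]

@[simp] theorem arr_setArr_self (m : Mem) (a i v j : ℕ) :
    (m.setArr a i v).arr a j = if j = i then v else m.arr a j := by
  simp [arr_setArr]

theorem arr_setArr_of_ne (m : Mem) {a b : ℕ} (i v : ℕ) (h : b ≠ a) :
    (m.setArr a i v).arr b = m.arr b := by
  funext j; simp [arr_setArr, h]

end Mem

theorem Instr.unch (i : Instr) (m : Mem) : Unch (.instr i) m (i.apply m) := by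
  constructor
  · intro x hx
    cases i <;> simp_all [Prog.writesReg, Instr.writesReg, Instr.apply] <;>
      intro h <;> exact absurd h.symm hx
  · intro a ha
    cases i <;> simp_all [Prog.writesArr, Instr.writesArr, Instr.apply]
    exact Mem.arr_setArr_of_ne _ _ _ (Ne.symm ha)

theorem Exec.unch {s : ℝ} {p : Prog} {m : Mem} {μ : PMF (Mem × ℕ)} (h : Exec s p m μ) :
    ∀ a ∈ μ.support, Unch p m a.1 := by
  induction h with
  | skip m => intro a ha; simp at ha; subst ha; exact .refl _ _
  | instr i m => intro a ha; simp at ha; subst ha; exact i.unch m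
  | rand x y m h =>
    intro a ha
    simp only [PMF.support_map, Set.mem_image] at ha
    obtain ⟨v, -, rfl⟩ := ha
    refine ⟨fun r hr => ?_, fun _ _ => rfl⟩
    have : r ≠ x := by rintro rfl; simp [Prog.writesReg] at hr
    simp [this]
  | seq p q m μ κ hp hq ihp ihq =>
    intro a ha
    simp only [PMF.mem_support_bind_iff, PMF.support_map, Set.mem_image] at ha
    obtain ⟨b, hb, c, hc, rfl⟩ := ha
    refine Unch.trans (m₂ := b.1) ((ihp b hb).mono ?_ ?_) ((ihq b hb c hc).mono ?_ ?_) <;>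
      intro x hx <;> simp_all [Prog.writesReg, Prog.writesArr]
  | iteTrue t p q m μ ht hp ih =>
    intro a ha
    simp only [PMF.support_map, Set.mem_image] at ha
    obtain ⟨b, hb, rfl⟩ := ha
    refine (ih b hb).mono ?_ ?_ <;> intro x hx <;> simp_all [Prog.writesReg, Prog.writesArr]
  | iteFalse t p q m μ ht hp ih =>
    intro a ha
    simp only [PMF.support_map, Set.mem_image] at ha
    obtain ⟨b, hb, rfl⟩ := ha
    refine (ih b hb).mono ?_ ?_ <;> intro x hx <;> simp_all [Prog.writesReg, Prog.writesArr]
  | whileTrue t p m μ ht hp ih =>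
    intro a ha
    simp only [PMF.support_map, Set.mem_image] at ha
    obtain ⟨b, hb, rfl⟩ := ha
    refine (ih b hb).mono ?_ ?_ <;> intro x hx <;> simp_all [Prog.writesReg, Prog.writesArr]
  | whileFalse t p m ht => intro a ha; simp at ha; subst ha; exact .refl _ _

/-! ### Simulation of an abstract law by a program -/

/-- Started in memory `m`, the program `p` samples from `ν` in the following sense: the final memory
and running time can be coupled to a sample `a` from `ν` so that always the final memory is related
to `a` by `Q` and the running time is at most `B`. -/
def Sim {α : Type} (s : ℝ) (p : Prog) (m : Mem) (ν : PMF α) (Q : α → Mem → Prop) (B : ℕ) : Prop :=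
  ∃ γ : PMF (α × Mem × ℕ), γ.map Prod.fst = ν ∧ Exec s p m (γ.map Prod.snd) ∧
    ∀ x ∈ γ.support, Q x.1 x.2.1 ∧ x.2.2 ≤ B

/-- Started in memory `m`, the program `p` ends in time at most `B` in a memory satisfying `Q`. -/
abbrev Det (s : ℝ) (p : Prog) (m : Mem) (Q : Mem → Prop) (B : ℕ) : Prop :=
  Sim s p m (PMF.pure ()) (fun _ => Q) B

section Rules

variable {s : ℝ} {α β : Type}

theorem Sim.imp {p : Prog} {m : Mem} {ν : PMF α} {Q R : α → Mem → Prop} {B B' : ℕ}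
    (h : Sim s p m ν Q B) (hB : B ≤ B')
    (hQ : ∀ a ∈ ν.support, ∀ m', Q a m' → Unch p m m' → R a m') : Sim s p m ν R B' := by
  obtain ⟨γ, h1, h2, h3⟩ := h
  refine ⟨γ, h1, h2, fun x hx => ⟨hQ _ ?_ _ (h3 x hx).1 ?_, (h3 x hx).2.trans hB⟩⟩
  · rw [← h1, PMF.support_map]; exact ⟨x, hx, rfl⟩
  · exact h2.unch x.2 (by rw [PMF.support_map]; exact ⟨x, hx, rfl⟩)

theorem Sim.mono_time {p : Prog} {m : Mem} {ν : PMF α} {Q : α → Mem → Prop} {B B' : ℕ}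
    (h : Sim s p m ν Q B) (hB : B ≤ B') : Sim s p m ν Q B' :=
  h.imp hB fun _ _ _ h _ => h

theorem Sim.map {p : Prog} {m : Mem} {ν : PMF α} {Q : α → Mem → Prop} {R : β → Mem → Prop} {B : ℕ}
    (h : Sim s p m ν Q B) (g : α → β)
    (hQ : ∀ a ∈ ν.support, ∀ m', Q a m' → Unch p m m' → R (g a) m') : Sim s p m (ν.map g) R B := by
  obtain ⟨γ, h1, h2, h3⟩ := h.imp le_rfl hQ
  refine ⟨γ.map fun x => (g x.1, x.2), ?_, ?_, ?_⟩
  · rw [PMF.map_comp, ← h1, PMF.map_comp]; rfl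
  · rw [PMF.map_comp]; exact h2
  · intro x hx
    rw [PMF.support_map] at hx
    obtain ⟨y, hy, rfl⟩ := hx
    exact h3 y hy

theorem Sim.seq {p q : Prog} {m : Mem} {ν : PMF α} {κ : α → PMF β} {Q : α → Mem → Prop}
    {R : β → Mem → Prop} {B B' : ℕ} (hp : Sim s p m ν Q B)
    (hq : ∀ a ∈ ν.support, ∀ m', Q a m' → Unch p m m' → Sim s q m' (κ a) R B') :
    Sim s (p ;; q) m (ν.bind κ) R (B + B') := by
  obtain ⟨γ, h1, h2, h3⟩ := hp.imp le_rfl hq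
  have : Nonempty (PMF (β × Mem × ℕ)) := by
    obtain ⟨x, hx⟩ := γ.support_nonempty
    exact ⟨(h3 x hx).1.choose⟩
  choose! γ' h4 h5 h6 using fun x hx => (h3 x hx).1
  have hex : ∀ m', ∃ μ : PMF (Mem × ℕ), ∀ μ', Exec s q m' μ' → Exec s q m' μ ∧ μ = μ' := by
    intro m'
    by_cases h : ∃ μ', Exec s q m' μ'
    · obtain ⟨μ, hμ⟩ := h
      exact ⟨μ, fun μ' h' => ⟨hμ, hμ.unique _ h'⟩⟩
    · exact ⟨PMF.pure (m, 0), fun μ' h' => absurd ⟨μ', h'⟩ h⟩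
  choose K hK using hex
  refine ⟨γ.bind fun x => (γ' x).map fun y => (y.1, y.2.1, x.2.2 + y.2.2), ?_, ?_, ?_⟩
  · rw [PMF.map_bind, ← h1, PMF.bind_map]
    refine PMF.bind_congr_on_support fun x hx => ?_
    rw [PMF.map_comp]
    exact h4 x hx
  · have : (γ.bind fun x => (γ' x).map fun y => (y.1, y.2.1, x.2.2 + y.2.2)).map Prod.snd =
        (γ.map Prod.snd).bind fun a => (K a.1).map fun b => (b.1, a.2 + b.2) := by
      rw [PMF.map_bind, PMF.bind_map]
      refine PMF.bind_congr_on_support fun x hx => ?_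
      rw [PMF.map_comp]
      simp only [Function.comp]
      rw [(hK _ _ (h5 x hx)).2, PMF.map_comp]
      rfl
    rw [this]
    refine Exec.seq _ _ _ _ K h2 fun a ha => ?_
    rw [PMF.support_map] at ha
    obtain ⟨x, hx, rfl⟩ := ha
    exact (hK _ _ (h5 x hx)).1
  · intro y hy
    simp only [PMF.mem_support_bind_iff, PMF.support_map, Set.mem_image] at hy
    obtain ⟨x, hx, z, hz, rfl⟩ := hy
    exact ⟨(h6 x hx z hz).1, Nat.add_le_add (h3 x hx).2 (h6 x hx z hz).2⟩

/-- A deterministic program followed by a random one. -/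
theorem Det.seq {p q : Prog} {m : Mem} {ν : PMF β} {Q : Mem → Prop}
    {R : β → Mem → Prop} {B B' : ℕ} (hp : Det s p m Q B)
    (hq : ∀ m', Q m' → Unch p m m' → Sim s q m' ν R B') : Sim s (p ;; q) m ν R (B + B') := by
  have := Sim.seq (κ := fun _ => ν) hp (fun _ _ m' h h' => hq m' h h')
  rwa [PMF.pure_bind] at this

/-- A random program followed by a deterministic one. -/
theorem Sim.seq_det {p q : Prog} {m : Mem} {ν : PMF α} {Q R : α → Mem → Prop} {B B' : ℕ}
    (hp : Sim s p m ν Q B)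
    (hq : ∀ a ∈ ν.support, ∀ m', Q a m' → Unch p m m' → Det s q m' (R a) B') :
    Sim s (p ;; q) m ν R (B + B') := by
  have := Sim.seq (κ := PMF.pure) (R := R) hp fun a ha m' h h' => by
    have := (hq a ha m' h h').map (fun _ => a) (R := R) fun _ _ _ h _ => h
    rwa [PMF.pure_map] at this
  rwa [PMF.bind_pure] at this

theorem Sim.skip {m : Mem} {a : α} {Q : α → Mem → Prop} (h : Q a m) :
    Sim s .skip m (PMF.pure a) Q 1 := by
  refine ⟨PMF.pure (a, m, 1), PMF.pure_map _ _, ?_, ?_⟩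
  · rw [PMF.pure_map]; exact Exec.skip m
  · intro x hx
    rw [PMF.support_pure, Set.mem_singleton_iff] at hx
    subst hx
    exact ⟨h, le_rfl⟩

theorem Det.instr (i : Instr) (m : Mem) : Det s (.instr i) m (fun m' => m' = i.apply m) 1 := by
  refine ⟨PMF.pure ((), i.apply m, 1), PMF.pure_map _ _, ?_, ?_⟩
  · rw [PMF.pure_map]; exact Exec.instr i m
  · intro x hx
    rw [PMF.support_pure, Set.mem_singleton_iff] at hx
    subst hx
    exact ⟨rfl, le_rfl⟩

theorem Sim.rand {m : Mem} {x y : ℕ} (h : (Finset.range (m.reg y)).Nonempty) :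
    Sim s (.rand x y) m (PMF.uniformOfFinset (Finset.range (m.reg y)) h)
      (fun v m' => m' = m.setReg x v) 1 := by
  refine ⟨(PMF.uniformOfFinset _ h).map fun v => (v, m.setReg x v, 1), ?_, ?_, ?_⟩
  · rw [PMF.map_comp]; exact PMF.map_id _
  · rw [PMF.map_comp]; exact Exec.rand x y m h
  · intro z hz
    rw [PMF.support_map] at hz
    obtain ⟨v, -, rfl⟩ := hz
    exact ⟨rfl, le_rfl⟩

theorem Sim.add_time {p p' : Prog} {m : Mem} {ν : PMF α} {Q : α → Mem → Prop} {B : ℕ}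
    (h : Sim s p m ν Q B)
    (hp : ∀ μ, Exec s p m μ → Exec s p' m (μ.map fun a => (a.1, a.2 + 1))) :
    Sim s p' m ν Q (B + 1) := by
  obtain ⟨γ, h1, h2, h3⟩ := h
  refine ⟨γ.map fun x => (x.1, x.2.1, x.2.2 + 1), ?_, ?_, ?_⟩
  · rw [PMF.map_comp]; exact h1
  · have := hp _ h2
    rw [PMF.map_comp] at this ⊢
    exact this
  · intro x hx
    rw [PMF.support_map] at hx
    obtain ⟨y, hy, rfl⟩ := hx
    exact ⟨(h3 y hy).1, Nat.succ_le_succ (h3 y hy).2⟩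

theorem Sim.ite {t : Test} {p q : Prog} {m : Mem} {ν : PMF α} {Q : α → Mem → Prop} {B : ℕ}
    (hp : t.Holds s m → Sim s p m ν Q B) (hq : ¬ t.Holds s m → Sim s q m ν Q B) :
    Sim s (.ite t p q) m ν Q (B + 1) := by
  by_cases h : t.Holds s m
  · exact (hp h).add_time fun μ hμ => Exec.iteTrue _ _ _ _ _ h hμ
  · exact (hq h).add_time fun μ hμ => Exec.iteFalse _ _ _ _ _ h hμ

theorem Sim.while_of_not {t : Test} {p : Prog} {m : Mem} {a : α} {Q : α → Mem → Prop}
    (ht : ¬ t.Holds s m) (h : Q a m) : Sim s (.while t p) m (PMF.pure a) Q 1 := by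
  refine ⟨PMF.pure (a, m, 1), PMF.pure_map _ _, ?_, ?_⟩
  · rw [PMF.pure_map]; exact Exec.whileFalse t p m ht
  · intro x hx
    rw [PMF.support_pure, Set.mem_singleton_iff] at hx
    subst hx
    exact ⟨h, le_rfl⟩

/-- A loop with `L` rounds. Here `W k a` is the law of the final result, given that the state before
round `k` is `a`. -/
theorem Sim.while_loop {A : ℕ → Type} {t : Test} {p : Prog} {b L : ℕ}
    (W : ∀ k, A k → PMF β) (I : ∀ k, A k → Mem → Prop) (Q : β → Mem → Prop)
    (hstep : ∀ k < L, ∀ a m, I k a m → t.Holds s m ∧ ∃ κ : PMF (A (k + 1)),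
      W k a = κ.bind (W (k + 1)) ∧ Sim s p m κ (I (k + 1)) b)
    (hend : ∀ a m, I L a m → ¬ t.Holds s m ∧ ∃ c, W L a = PMF.pure c ∧ Q c m) :
    ∀ r k, k + r = L → ∀ a m, I k a m → Sim s (.while t p) m (W k a) Q (r * (b + 1) + 1) := by
  intro r
  induction r with
  | zero =>
    intro k hk a m hI
    obtain rfl : k = L := by omega
    obtain ⟨h1, c, h2, h3⟩ := hend a m hI
    rw [h2, Nat.zero_mul, Nat.zero_add]
    exact Sim.while_of_not h1 h3
  | succ r ih =>
    intro k hk a m hI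
    obtain ⟨h1, κ, h2, h3⟩ := hstep k (by omega) a m hI
    rw [h2]
    have := Sim.seq h3 fun a' _ m' hI' _ => ih (k + 1) (by omega) a' m' hI'
    refine (this.add_time fun μ hμ => Exec.whileTrue _ _ _ _ h1 hμ).mono_time ?_
    rw [Nat.succ_mul]
    omega

end Rules

/-! ### Blocks and counting loops -/

/-- Straight-line code. -/
def Prog.block : List Instr → Prog
  | [] => .skip
  | i :: l => .instr i ;; Prog.block l

/-- The effect of straight-line code. -/
def Mem.run (m : Mem) : List Instr → Mem
  | [] => m
  | i :: l => (i.apply m).run l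

theorem Det.block {s : ℝ} (l : List Instr) (m : Mem) :
    Det s (.block l) m (fun m' => m' = m.run l) (l.length + 1) := by
  induction l generalizing m with
  | nil => exact Sim.skip rfl
  | cons i l ih =>
    refine (Det.seq (Det.instr i m) (R := fun _ m' => m' = m.run (i :: l)) (B' := l.length + 1)
      fun m' h _ => ?_).mono_time (by simp; omega)
    subst h
    exact ih _

/-- `for reg i := 0 to reg N - 1 do body`; register `4` has to hold the number `1`. -/
def Prog.for (i N : ℕ) (body : Prog) : Prog :=
  .instr (.const i 0) ;; .while (.lt i N) (body ;; .instr (.add i i 4))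

theorem Sim.for {s : ℝ} {β : Type} {A : ℕ → Type} {i N : ℕ} {body : Prog} {m : Mem} {b L : ℕ}
    (W : ∀ k, A k → PMF β) (I : ∀ k, A k → Mem → Prop) (Q : β → Mem → Prop)
    (hL : m.reg N = L) (h1 : m.reg 4 = 1) (hiN : i ≠ N) (hi4 : i ≠ 4)
    (hwi : body.writesReg i = false) (hwN : body.writesReg N = false)
    (hw4 : body.writesReg 4 = false) (a₀ : A 0) (h0 : I 0 a₀ (m.setReg i 0))
    (hstep : ∀ k < L, ∀ a m', Unch (.for i N body) m m' → m'.reg i = k → I k a m' →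
      ∃ κ : PMF (A (k + 1)), W k a = κ.bind (W (k + 1)) ∧
        Sim s body m' κ (fun a' m'' => I (k + 1) a' (m''.setReg i (k + 1))) b)
    (hend : ∀ a m', Unch (.for i N body) m m' → I L a m' → ∃ c, W L a = PMF.pure c ∧ Q c m') :
    Sim s (.for i N body) m (W 0 a₀) Q (L * (b + 2) + 2) := by
  have hN : (Prog.for i N body).writesReg N = false := by
    simp [Prog.for, Prog.writesReg, Instr.writesReg, hwN, hiN]
  have h4 : (Prog.for i N body).writesReg 4 = false := by
    simp [Prog.for, Prog.writesReg, Instr.writesReg, hw4, hi4]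
  have hsub : ∀ {m₁ m₂}, Unch body m₁ m₂ → Unch (Prog.for i N body) m₁ m₂ := fun h => by
    refine h.mono ?_ ?_ <;> intro x hx <;>
      simp_all [Prog.for, Prog.writesReg, Prog.writesArr]
  have hset : ∀ m₁ v, Unch (Prog.for i N body) m₁ (m₁.setReg i v) := fun m₁ v => by
    refine ⟨fun x hx => ?_, fun _ _ => rfl⟩
    have : x ≠ i := by
      rintro rfl
      simp [Prog.for, Prog.writesReg, Instr.writesReg] at hx
    simp [this]
  have hloop := Sim.while_loop (s := s) (t := .lt i N) (p := body ;; .instr (.add i i 4))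
    (b := b + 1) (L := L) W
    (fun k a m' => I k a m' ∧ m'.reg i = k ∧ Unch (.for i N body) m m') Q ?_ ?_ L 0 (by omega) a₀
    (m.setReg i 0) ⟨h0, by simp, hset _ _⟩
  · refine (Det.seq (Det.instr _ m) (R := Q) (ν := W 0 a₀) (B' := L * (b + 1 + 1) + 1)
      fun m' h _ => ?_).mono_time (by rw [show b + 2 = b + 1 + 1 from rfl]; omega)
    subst h
    exact hloop
  · rintro k hk a m' ⟨hI, hi, hU⟩
    refine ⟨?_, ?_⟩
    · simp only [Test.Holds]
      rw [hi, hU.reg _ hN, hL]; exact hk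
    · obtain ⟨κ, hκ, hS⟩ := hstep k hk a m' hU hi hI
      refine ⟨κ, hκ, Sim.seq_det hS fun a' _ m'' hI' hU' => ?_⟩
      refine (Det.instr _ m'').imp le_rfl fun _ _ m₃ h3 _ => ?_
      subst h3
      have e : (Instr.add i i 4).apply m'' = m''.setReg i (k + 1) := by
        simp only [Instr.apply]
        rw [hU'.reg i hwi, hi, hU'.reg 4 hw4, hU.reg 4 h4, h1]
      rw [e]
      exact ⟨hI', by simp, (hU.trans (hsub hU')).trans (hset _ _)⟩
  · rintro a m' ⟨hI, hi, hU⟩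
    refine ⟨?_, hend a m' hU hI⟩
    simp only [Test.Holds]
    rw [hi, hU.reg _ hN, hL]; exact lt_irrefl _

theorem Det.for {s : ℝ} {i N : ℕ} {body : Prog} {m : Mem} {b L : ℕ} (I : ℕ → Mem → Prop)
    (hL : m.reg N = L) (h1 : m.reg 4 = 1) (h0 : I 0 (m.setReg i 0))
    (hstep : ∀ k < L, ∀ m', Unch (.for i N body) m m' → m'.reg i = k → I k m' →
        Det s body m' (fun m'' => I (k + 1) (m''.setReg i (k + 1))) b)
    (hiN : i ≠ N := by decide) (hi4 : i ≠ 4 := by decide)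
    (hwi : body.writesReg i = false := by rfl) (hwN : body.writesReg N = false := by rfl)
    (hw4 : body.writesReg 4 = false := by rfl) :
    Det s (.for i N body) m (I L) (L * (b + 2) + 2) :=
  Sim.for (A := fun _ => Unit) (fun _ => PMF.pure) (fun k _ => I k) _ hL h1 hiN hi4 hwi hwN hw4 ()
    h0 (fun k hk _ m' hU hi hI => ⟨PMF.pure (), by simp, hstep k hk m' hU hi hI⟩)
    fun _ _ _ hI => ⟨_, rfl, hI⟩

/-- The entries of `f` from position `c` on are those of the list `l`. -/
def Seg (f : ℕ → ℕ) (c : ℕ) (l : List ℕ) : Prop :=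
  ∀ i (h : i < l.length), f (c + i) = l[i]

/-- `for reg v := 0 to reg N - 1 do` run `test`, and if this leaves a nonzero number in register
`φ`, append the contents of register `x` to the list in array `Q` whose end is in register `c`.
Registers `3` and `4` have to hold the numbers `0` and `1`. -/
def Prog.collect (v N c φ x Q : ℕ) (test : Prog) : Prog :=
  .for v N (test ;; .ite (.ne φ 3) (.block [.store Q c x, .add c c 4]) .skip)

theorem Det.collect {s : ℝ} {v N c φ x Q : ℕ} {test : Prog} {m : Mem} {b L : ℕ}
    (P : ℕ → Prop) [DecidablePred P] (g : ℕ → ℕ) (hL : m.reg N = L) (h1 : m.reg 4 = 1) (h3 : m.reg 3 = 0)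
    (htest : ∀ k < L, ∀ m', Unch (.collect v N c φ x Q test) m m' → m'.reg v = k →
      Det s test m' (fun m'' => (m''.reg φ ≠ 0 ↔ P k) ∧ (P k → m''.reg x = g k)) b)
    (hreg : v ≠ N ∧ v ≠ 4 ∧ v ≠ 3 ∧ c ≠ v ∧ c ≠ N ∧ c ≠ 4 ∧ c ≠ 3 := by decide)
    (hw : test.writesReg v = false ∧ test.writesReg N = false ∧ test.writesReg 4 = false ∧
      test.writesReg 3 = false ∧ test.writesReg c = false ∧ test.writesArr Q = false := by decide) :
    Det s (.collect v N c φ x Q test) m (fun m' =>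
      m'.reg c = m.reg c + (((List.range L).filter P).map g).length ∧
      (∀ i < m.reg c, m'.arr Q i = m.arr Q i) ∧
      Seg (m'.arr Q) (m.reg c) (((List.range L).filter P).map g)) (L * (b + 6) + 2) := by
  obtain ⟨hvN, hv4, hv3, hcv, hcN, hc4, hc3⟩ := hreg
  obtain ⟨wv, wN, w4, w3, wc, wQ⟩ := hw
  have w3' : (Prog.collect v N c φ x Q test).writesReg 3 = false := by
    simp [Prog.collect, Prog.for, Prog.writesReg, Instr.writesReg, Prog.block, *]
  have w4' : (Prog.collect v N c φ x Q test).writesReg 4 = false := by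
    simp [Prog.collect, Prog.for, Prog.writesReg, Instr.writesReg, Prog.block, *]
  refine Det.for (fun k m' => m'.reg c = m.reg c + (((List.range k).filter P).map g).length ∧
      (∀ i < m.reg c, m'.arr Q i = m.arr Q i) ∧
      Seg (m'.arr Q) (m.reg c) (((List.range k).filter P).map g)) hL h1 ?_ ?_ hvN hv4 ?_ ?_ ?_
  · simp [hcv, Seg]
  · rintro k hk m' hU hv ⟨hc, hpre, hseg⟩
    refine (Det.seq (htest k hk m' hU hv) (B' := 4) fun m₁ hm₁ hU₁ => ?_)
    have r3 : m₁.reg 3 = 0 := by rw [hU₁.reg _ w3, hU.reg _ w3', h3]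
    have r4 : m₁.reg 4 = 1 := by rw [hU₁.reg _ w4, hU.reg _ w4', h1]
    have rc : m₁.reg c = m'.reg c := hU₁.reg _ wc
    have rQ : m₁.arr Q = m'.arr Q := hU₁.arr _ wQ
    refine Sim.ite (B := 3) (fun ht => ?_) (fun ht => ?_)
    · simp only [Test.Holds, r3] at ht
      have hP := hm₁.1.1 ht
      refine (Det.block _ m₁).imp le_rfl fun _ _ m₂ hm₂ _ => ?_
      subst hm₂
      have hl : ((List.range (k + 1)).filter P).map g = ((List.range k).filter P).map g ++ [g k] := by
        simp [List.range_succ, List.filter_append, hP]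
      rw [hl]
      refine ⟨?_, ?_, ?_⟩
      · simp [Mem.run, Instr.apply, hcv, r4, rc, hc]
        omega
      · intro i hi
        have : i ≠ m₁.reg c := by omega
        simp [Mem.run, Instr.apply, this, rQ, hpre i hi]
      · intro i hi
        simp only [Mem.run, Instr.apply, Mem.arr_setReg, Mem.arr_setArr_self, rQ]
        rw [rc, hc]
        simp only [List.length_append, List.length_singleton] at hi
        rcases Nat.lt_succ_iff_lt_or_eq.1 hi with h | h
        · rw [if_neg (by omega), hseg i h, List.getElem_append_left h]
        · rw [if_pos (by omega)]
          simp [h, hm₁.2 hP]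
    · simp only [Test.Holds, r3] at ht
      have hP : ¬ P k := fun h => ht (hm₁.1.2 h)
      refine (Sim.skip (a := ()) (Q := fun _ m' => m' = m₁) rfl).imp (by omega)
        fun _ _ m₂ hm₂ _ => ?_
      subst hm₂
      have hl : ((List.range (k + 1)).filter P).map g = ((List.range k).filter P).map g := by
        simp [List.range_succ, List.filter_append, hP]
      rw [hl]
      simp only [Mem.reg_setReg, hcv, if_false, Mem.arr_setReg, rc, rQ]
      exact ⟨hc, hpre, hseg⟩
  all_goals simp [Prog.writesReg, Instr.writesReg, Prog.block, *]

/-! ### Uniform laws -/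

section Uniform

variable {α β : Type*}

theorem PMF.eq_uniformOfFinset {p : PMF α} {S : Finset α} (c : ENNReal) (hS : S.Nonempty)
    (h1 : ∀ a ∈ S, p a = c) (h0 : ∀ a ∉ S, p a = 0) : p = PMF.uniformOfFinset S hS := by
  have hsum : (S.card : ENNReal) * c = 1 := by
    rw [← p.tsum_coe, tsum_eq_sum (s := S) fun a ha => h0 a ha, Finset.sum_congr rfl h1]
    simp
  have hc : c = (S.card : ENNReal)⁻¹ := ENNReal.eq_inv_of_mul_eq_one_left (by rwa [mul_comm])
  ext a
  rw [PMF.uniformOfFinset_apply]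
  split_ifs with h
  · rw [h1 a h, hc]
  · exact h0 a h

theorem PMF.map_uniformOfFinset {S : Finset α} {T : Finset β} (hS : S.Nonempty) (hT : T.Nonempty)
    (g : α → β) (hmaps : ∀ a ∈ S, g a ∈ T) (hinj : Set.InjOn g S) (hsurj : ∀ b ∈ T, ∃ a ∈ S, g a = b) :
    (PMF.uniformOfFinset S hS).map g = PMF.uniformOfFinset T hT := by
  classical
  refine PMF.eq_uniformOfFinset (S.card : ENNReal)⁻¹ hT (fun b hb => ?_) (fun b hb => ?_)
  · obtain ⟨a, ha, rfl⟩ := hsurj b hb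
    rw [PMF.map_apply, tsum_eq_single a]
    · simp [PMF.uniformOfFinset_apply, ha]
    · intro a' ha'
      by_cases h : a' ∈ S
      · rw [if_neg]
        exact fun h' => ha' (hinj h ha h'.symm)
      · simp [PMF.uniformOfFinset_apply, h]
  · rw [PMF.map_apply]
    refine ENNReal.tsum_eq_zero.2 fun a => ?_
    by_cases h : a ∈ S
    · rw [if_neg]
      rintro rfl
      exact hb (hmaps a h)
    · simp [PMF.uniformOfFinset_apply, h]

theorem PMF.bindOnSupport_eq_bind_of_forall {μ : PMF α} {f : ∀ a ∈ μ.support, PMF β} (g : α → PMF β)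
    (h : ∀ a ha, f a ha = g a) : μ.bindOnSupport f = μ.bind g := by
  rw [← PMF.bindOnSupport_eq_bind]
  congr 1
  funext a ha
  exact h a ha

theorem PMF.bind_uniformOfFinset_apply {S : Finset α} (hS : S.Nonempty) (f : α → PMF β) (b : β) :
    ((PMF.uniformOfFinset S hS).bind f) b = ∑ a ∈ S, (S.card : ENNReal)⁻¹ * f a b := by
  rw [PMF.bind_apply, tsum_eq_sum (s := S)]
  · exact Finset.sum_congr rfl fun a ha => by simp [PMF.uniformOfFinset_apply, ha]
  · intro a ha
    simp [PMF.uniformOfFinset_apply, ha]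

/-- A uniformly random subset of `S` with `k` elements (or with `|S|` elements if `k` is larger). -/
noncomputable def uniformSubset (S : Finset α) (k : ℕ) : PMF (Finset α) :=
  PMF.uniformOfFinset (S.powersetCard (min k S.card))
    (Finset.powersetCard_nonempty.2 (min_le_right _ _))

theorem uniformSubset_of_le {S : Finset α} {k : ℕ} (h : k ≤ S.card) :
    uniformSubset S k = PMF.uniformOfFinset (S.powersetCard k) (Finset.powersetCard_nonempty.2 h) := by
  simp [uniformSubset, h]

theorem ENNReal.mul_inv_mul_inv {m N X Y : ℕ} (hm : m ≠ 0) (h : N * X = Y * m) :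
    (m : ENNReal) * ((N : ENNReal)⁻¹ * (X : ENNReal)⁻¹) = (Y : ENNReal)⁻¹ := by
  have hm' : (m : ENNReal) ≠ 0 := by exact_mod_cast hm
  have h' : (N : ENNReal) * X = Y * m := by exact_mod_cast h
  rw [← ENNReal.mul_inv (Or.inr (by simp)) (Or.inl (by simp)), h',
    ENNReal.mul_inv (Or.inr (by simp)) (Or.inl (by simp)), mul_comm, mul_assoc,
    ENNReal.inv_mul_cancel hm' (by simp), mul_one]

/-- Selection sampling: the first element `e` is selected with probability `k / (|S| + 1)`. -/
theorem uniformSubset_insert [DecidableEq α] {S : Finset α} {e : α} (he : e ∉ S) {k N : ℕ}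
    (hN : S.card + 1 = N) (hk : k ≤ N) (hne : (Finset.range N).Nonempty) :
    uniformSubset (insert e S) k = (PMF.uniformOfFinset (Finset.range N) hne).bind fun u =>
      if u < k then (uniformSubset S (k - 1)).map (insert e) else uniformSubset S k := by
  subst hN
  have hcard : (insert e S).card = S.card + 1 := Finset.card_insert_of_notMem he
  rw [show uniformSubset (insert e S) k = _ from uniformSubset_of_le (by omega)]
  symm
  have hmap : ∀ k', k' ≤ S.card → ∀ D : Finset α, e ∈ D →
      ((uniformSubset S k').map (insert e)) D = if D ⊆ insert e S ∧ D.card = k' + 1 then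
        ((S.card.choose k' : ℕ) : ENNReal)⁻¹ else 0 := by
    intro k' hk' D hD
    rw [PMF.map_apply, tsum_eq_single (D.erase e)]
    · rw [if_pos (Finset.insert_erase hD).symm, uniformSubset_of_le hk',
        PMF.uniformOfFinset_apply, Finset.card_powersetCard]
      have : (D.erase e ∈ S.powersetCard k') ↔ (D ⊆ insert e S ∧ D.card = k' + 1) := by
        rw [Finset.mem_powersetCard, Finset.card_erase_of_mem hD, Finset.subset_insert_iff]
        have := Finset.card_pos.2 ⟨e, hD⟩
        refine and_congr_right fun _ => ?_
        omega
      simp only [this]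
    · intro D' hD'
      split_ifs with h
      · by_cases h1 : D' ∈ S.powersetCard k'
        · exfalso
          apply hD'
          rw [h, Finset.erase_insert]
          exact fun h2 => he ((Finset.mem_powersetCard.1 h1).1 h2)
        · rw [uniformSubset_of_le hk', PMF.uniformOfFinset_apply, if_neg h1]
      · rfl
  have hmap' : ∀ k', ∀ D : Finset α, e ∉ D → ((uniformSubset S k').map (insert e)) D = 0 := by
    intro k' D hD
    rw [PMF.map_apply]
    refine ENNReal.tsum_eq_zero.2 fun D' => ?_
    rw [if_neg]
    rintro rfl
    exact hD (Finset.mem_insert_self _ _)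
  have hsub : ∀ k', k' ≤ S.card → ∀ D : Finset α, e ∉ D → (uniformSubset S k') D =
      if D ⊆ insert e S ∧ D.card = k' then ((S.card.choose k' : ℕ) : ENNReal)⁻¹ else 0 := by
    intro k' hk' D hD
    rw [uniformSubset_of_le hk', PMF.uniformOfFinset_apply, Finset.card_powersetCard]
    simp only [Finset.mem_powersetCard, Finset.subset_insert_iff_of_notMem hD]
  have hsub' : ∀ k', k' ≤ S.card → ∀ D : Finset α, e ∈ D → (uniformSubset S k') D = 0 := by
    intro k' hk' D hD
    rw [uniformSubset_of_le hk', PMF.uniformOfFinset_apply, if_neg]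
    exact fun h => he ((Finset.mem_powersetCard.1 h).1 hD)
  have key : ∀ D : Finset α, ((PMF.uniformOfFinset (Finset.range (S.card + 1)) hne).bind fun u =>
      if u < k then (uniformSubset S (k - 1)).map (insert e) else uniformSubset S k) D =
      if D ∈ (insert e S).powersetCard k then (((S.card + 1).choose k : ℕ) : ENNReal)⁻¹ else 0 := by
    intro D
    rw [PMF.bind_uniformOfFinset_apply, Finset.card_range]
    simp only [Finset.mem_powersetCard]
    by_cases hD : e ∈ D
    · have hterm : ∀ u ∈ Finset.range (S.card + 1), ((S.card + 1 : ℕ) : ENNReal)⁻¹ *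
          (if u < k then (uniformSubset S (k - 1)).map (insert e) else uniformSubset S k) D =
          if u < k then ((S.card + 1 : ℕ) : ENNReal)⁻¹ * (if D ⊆ insert e S ∧ D.card = k then
            ((S.card.choose (k - 1) : ℕ) : ENNReal)⁻¹ else 0) else 0 := by
        intro u hu
        rw [Finset.mem_range] at hu
        by_cases h1 : u < k
        · have : D.card = k - 1 + 1 ↔ D.card = k := by omega
          simp only [if_pos h1, hmap (k - 1) (by omega) D hD, this]
        · rw [if_neg h1, if_neg h1, hsub' k (by omega) D hD, mul_zero]
      rw [Finset.sum_congr rfl hterm, ← Finset.sum_filter, Finset.sum_const]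
      have hf : ((Finset.range (S.card + 1)).filter fun u => u < k) = Finset.range k := by
        ext u; simp only [Finset.mem_filter, Finset.mem_range]; omega
      rw [hf, Finset.card_range, nsmul_eq_mul]
      split_ifs with h
      · have hk0 : k ≠ 0 := by
          rintro rfl
          simp [Finset.card_eq_zero.1 h.2] at hD
        refine ENNReal.mul_inv_mul_inv hk0 ?_
        obtain ⟨j, rfl⟩ := Nat.exists_eq_succ_of_ne_zero hk0
        exact Nat.add_one_mul_choose_eq _ _
      · simp
    · have hterm : ∀ u ∈ Finset.range (S.card + 1), ((S.card + 1 : ℕ) : ENNReal)⁻¹ *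
          (if u < k then (uniformSubset S (k - 1)).map (insert e) else uniformSubset S k) D =
          if k ≤ u then ((S.card + 1 : ℕ) : ENNReal)⁻¹ * (if D ⊆ insert e S ∧ D.card = k then
            ((S.card.choose k : ℕ) : ENNReal)⁻¹ else 0) else 0 := by
        intro u hu
        rw [Finset.mem_range] at hu
        by_cases h1 : u < k
        · rw [if_pos h1, if_neg (by omega), hmap' _ D hD, mul_zero]
        · rw [if_neg h1, if_pos (by omega), hsub k (by omega) D hD]
      rw [Finset.sum_congr rfl hterm, ← Finset.sum_filter, Finset.sum_const]
      have hf : ((Finset.range (S.card + 1)).filter fun u => k ≤ u) =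
          Finset.Ico k (S.card + 1) := by
        ext u; simp only [Finset.mem_filter, Finset.mem_range, Finset.mem_Ico]; omega
      rw [hf, Nat.card_Ico, nsmul_eq_mul]
      split_ifs with h
      · have hlt : k ≤ S.card := by
          rw [← h.2]
          refine Finset.card_le_card ?_
          rw [Finset.subset_insert_iff_of_notMem hD] at h
          exact h.1
        refine ENNReal.mul_inv_mul_inv (by omega) ?_
        rw [mul_comm]
        exact Nat.choose_mul_succ_eq _ _
      · simp
  refine PMF.eq_uniformOfFinset (((S.card + 1).choose k : ℕ) : ENNReal)⁻¹ _
    (fun D hD => ?_) fun D hD => ?_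
  · rw [key, if_pos hD]
  · rw [key, if_neg hD]

end Uniform

/-- The law of the final state of a Markov chain, as a function of the state at time `k`. -/
theorem exists_tail_kernel {A : ℕ → Type} (ν : ∀ k, PMF (A k)) (κ : ∀ k, A k → PMF (A (k + 1)))
    (hν : ∀ k, ν (k + 1) = (ν k).bind (κ k)) (L : ℕ) :
    ∃ W : ∀ k, A k → PMF (A L), (∀ a, W L a = PMF.pure a) ∧
      (∀ k < L, ∀ a, W k a = (κ k a).bind (W (k + 1))) ∧ (ν 0).bind (W 0) = ν L := by
  induction L with
  | zero =>
    refine ⟨fun k => match k with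
      | 0 => PMF.pure
      | _ + 1 => fun _ => ν 0, fun _ => rfl, by simp, PMF.bind_pure _⟩
  | succ L ih =>
    obtain ⟨W, h1, h2, h3⟩ := ih
    refine ⟨fun k a => if h : k = L + 1 then PMF.pure (h ▸ a) else (W k a).bind (κ L),
      fun a => by simp, fun k hk a => ?_, ?_⟩
    · simp only [hk.ne, dite_false]
      rcases Nat.lt_succ_iff_lt_or_eq.1 hk with h | rfl
      · simp only [h2 k h, PMF.bind_bind, show k + 1 ≠ L + 1 by omega, dite_false]
      · simp [h1]
    · have : 0 ≠ L + 1 := by omega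
      simp only [this, dite_false, hν]
      rw [← h3, PMF.bind_bind]

/-- Draw a uniformly random entry of the list in the first `reg c` entries of array `Q`. -/
def Prog.draw (u c x Q : ℕ) : Prog := .rand u c ;; .instr (.load x Q u)

theorem Sim.draw {s : ℝ} {u c x Q : ℕ} {m : Mem} {l : List ℕ} {S : Finset ℕ}
    (hc : m.reg c = l.length) (hl : Seg (m.arr Q) 0 l) (hnd : l.Nodup) (hS : ∀ v, v ∈ S ↔ v ∈ l)
    (hne : S.Nonempty) :
    Sim s (.draw u c x Q) m (PMF.uniformOfFinset S hne) (fun v m' => m'.reg x = v) 2 := by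
  obtain ⟨v₀, hv₀⟩ := hne
  have hpos : 0 < l.length := List.length_pos_of_mem ((hS v₀).1 hv₀)
  have hr : (Finset.range (m.reg c)).Nonempty := by simpa [hc] using hpos.ne'
  have h := (Sim.rand (s := s) (x := u) hr).seq_det (q := .instr (.load x Q u))
    (R := fun v m' => m'.reg x = m.arr Q v) (B' := 1) fun v hv m' hm' _ => by
      refine (Det.instr _ m').imp le_rfl fun _ _ m₂ hm₂ _ => ?_
      subst hm₂ hm'
      simp [Instr.apply]
  have h' := h.map (m.arr Q) (R := fun v m' => m'.reg x = v) fun _ _ _ h _ => h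
  have hseg : ∀ i (hi : i < l.length), m.arr Q i = l[i] := fun i hi => by
    have := hl i hi
    rwa [Nat.zero_add] at this
  rw [PMF.map_uniformOfFinset hr ⟨v₀, hv₀⟩] at h'
  · exact h'
  · intro i hi
    rw [Finset.mem_range, hc] at hi
    rw [hseg i hi, hS]
    exact List.getElem_mem hi
  · intro i hi j hj hij
    simp only [Finset.coe_range, Set.mem_Iio, hc] at hi hj
    rw [hseg i hi, hseg j hj] at hij
    exact (hnd.getElem_inj_iff).1 hij
  · intro v hv
    obtain ⟨i, hi, rfl⟩ := List.getElem_of_mem ((hS v).1 hv)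
    exact ⟨i, by simpa [hc] using hi, hseg i hi⟩

/-! ### Trees given by topologically sorted edge lists, and components after deleting edges -/

/-- The numbers below `n` are the nodes of a tree with root `ρ`, whose edges join the nodes `b k` to
their parents `a k`, parents coming before their children. -/
structure TreeOrder (n : ℕ) (a b : ℕ → ℕ) (ρ : ℕ) : Prop where
  root_lt : ρ < n
  parent_lt : ∀ k < n - 1, a k < n
  child_lt : ∀ k < n - 1, b k < n
  cover : ∀ x < n, x = ρ ∨ ∃ k < n - 1, b k = x
  inj : ∀ j < n - 1, ∀ k < n - 1, b j = b k → j = k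
  child_ne : ∀ k < n - 1, b k ≠ ρ
  parent_mem : ∀ k < n - 1, a k = ρ ∨ ∃ j < k, b j = a k

/-- `c` maps each node to the top node of its component, for some set of deleted edges. -/
structure CutMap (n : ℕ) (a b : ℕ → ℕ) (ρ : ℕ) (c : ℕ → ℕ) : Prop where
  root : c ρ = ρ
  child : ∀ k < n - 1, c (b k) = b k ∨ c (b k) = c (a k)

section

variable {n : ℕ} {a b c c' : ℕ → ℕ} {ρ : ℕ}

theorem TreeOrder.induction (h : TreeOrder n a b ρ) {P : ℕ → Prop} (h0 : P ρ)
    (hs : ∀ k < n - 1, P (a k) → P (b k)) : ∀ x < n, P x := by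
  have : ∀ k, k < n - 1 → P (b k) := by
    intro k
    induction k using Nat.strong_induction_on with
    | _ k ih =>
      intro hk
      refine hs k hk ?_
      rcases h.parent_mem k hk with h1 | ⟨j, hj, h1⟩
      · rw [h1]; exact h0
      · rw [← h1]; exact ih j hj (by omega)
  intro x hx
  rcases h.cover x hx with rfl | ⟨k, hk, rfl⟩
  · exact h0
  · exact this k hk

theorem CutMap.lt (hc : CutMap n a b ρ c) (h : TreeOrder n a b ρ) : ∀ x < n, c x < n := by
  refine h.induction ?_ fun k hk hP => ?_
  · rw [hc.root]; exact h.root_lt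
  · rcases hc.child k hk with h1 | h1 <;> rw [h1]
    · exact h.child_lt k hk
    · exact hP

theorem CutMap.idem (hc : CutMap n a b ρ c) (h : TreeOrder n a b ρ) : ∀ x < n, c (c x) = c x := by
  refine h.induction ?_ fun k hk hP => ?_
  · rw [hc.root, hc.root]
  · rcases hc.child k hk with h1 | h1
    · rw [h1, h1]
    · rw [h1]; exact hP

/-- If two components meet, then one of them contains the top node of the other. -/
theorem CutMap.top_mem (hc : CutMap n a b ρ c) (hc' : CutMap n a b ρ c') (h : TreeOrder n a b ρ) :
    ∀ x < n, c (c' x) = c x ∨ c' (c x) = c' x := by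
  refine h.induction ?_ fun k hk hP => ?_
  · left; rw [hc'.root]
  · rcases hc.child k hk with h1 | h1
    · right; rw [h1]
    · rcases hc'.child k hk with h2 | h2
      · left; rw [h2]
      · rwa [h1, h2]

theorem CutMap.exists_common_iff (hc : CutMap n a b ρ c) (hc' : CutMap n a b ρ c')
    (h : TreeOrder n a b ρ) {t t' : ℕ} (ht : t < n) (ht' : t' < n) (h1 : c t = t)
    (h2 : c' t' = t') : (∃ x < n, c x = t ∧ c' x = t') ↔ c t' = t ∨ c' t = t' := by
  constructor
  · rintro ⟨x, hx, rfl, rfl⟩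
    exact hc.top_mem hc' h x hx
  · rintro (h3 | h3)
    · exact ⟨t', ht', h3, h2⟩
    · exact ⟨t, ht, h1, h3⟩

/-- `T` is the tree with edges `{a k, b k}`. -/
def IsEdgeList (n : ℕ) (a b : ℕ → ℕ) (T : SimpleGraph (Fin n)) : Prop :=
  ∀ u v : Fin n, T.Adj u v ↔ ∃ k < n - 1, (a k = u ∧ b k = v) ∨ (a k = v ∧ b k = u)

/-- The `k`-th edge. -/
def edgeAt (n : ℕ) [NeZero n] (a b : ℕ → ℕ) (k : ℕ) : Sym2 (Fin n) :=
  s(Fin.ofNat n (a k), Fin.ofNat n (b k))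

theorem Fin.val_ofNat_of_lt {n : ℕ} [NeZero n] {x : ℕ} (h : x < n) : (Fin.ofNat n x).val = x := by
  simp [Fin.ofNat, Nat.mod_eq_of_lt h]

variable [NeZero n] {T : SimpleGraph (Fin n)}

theorem TreeOrder.edgeAt_inj (h : TreeOrder n a b ρ) {j k : ℕ} (hj : j < n - 1) (hk : k < n - 1)
    (he : edgeAt n a b j = edgeAt n a b k) : j = k := by
  have hv : ∀ {x y : ℕ}, x < n → y < n → Fin.ofNat n x = Fin.ofNat n y → x = y := by
    intro x y hx hy hxy
    rw [← Fin.val_ofNat_of_lt hx, hxy, Fin.val_ofNat_of_lt hy]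
  have key : ∀ {j k : ℕ}, j < n - 1 → k < n - 1 → a j = b k → a k = b j → j ≤ k := by
    intro j k hj hk h1 h2
    rcases h.parent_mem k hk with h3 | ⟨i, hi, h3⟩
    · exact absurd (h2.symm.trans h3) (h.child_ne j hj)
    · have := h.inj i (by omega) j hj (h3.trans h2)
      omega
  rw [edgeAt, edgeAt, Sym2.eq_iff] at he
  rcases he with ⟨-, h2⟩ | ⟨h1, h2⟩
  · exact h.inj j hj k hk (hv (h.child_lt j hj) (h.child_lt k hk) h2)
  · have e1 := hv (h.parent_lt j hj) (h.child_lt k hk) h1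
    have e2 := hv (h.child_lt j hj) (h.parent_lt k hk) h2
    exact le_antisymm (key hj hk e1 e2.symm) (key hk hj e2.symm e1)

theorem IsEdgeList.mem_edgeSet (hT : IsEdgeList n a b T) (h : TreeOrder n a b ρ)
    (e : Sym2 (Fin n)) : e ∈ T.edgeSet ↔ ∃ k < n - 1, edgeAt n a b k = e := by
  induction e using Sym2.ind with
  | _ u v =>
    rw [SimpleGraph.mem_edgeSet, hT]
    refine exists_congr fun k => and_congr_right fun hk => ?_
    rw [edgeAt, Sym2.eq_iff, Fin.ext_iff, Fin.ext_iff, Fin.ext_iff, Fin.ext_iff,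
      Fin.val_ofNat_of_lt (h.parent_lt k hk), Fin.val_ofNat_of_lt (h.child_lt k hk)]

variable {D : Finset (Sym2 (Fin n))}

open scoped Classical in
/-- `c` maps each node to the top node of its component after deletion of the edges in `D`. -/
structure CompMap (n : ℕ) [NeZero n] (a b : ℕ → ℕ) (ρ : ℕ) (D : Finset (Sym2 (Fin n)))
    (c : ℕ → ℕ) : Prop where
  root : c ρ = ρ
  child : ∀ k < n - 1, c (b k) = if edgeAt n a b k ∈ D then b k else c (a k)

theorem CompMap.cutMap (hc : CompMap n a b ρ D c) : CutMap n a b ρ c :=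
  ⟨hc.root, fun k hk => by
    rw [hc.child k hk]
    split_ifs
    · exact Or.inl rfl
    · exact Or.inr rfl⟩

theorem CompMap.reachable_iff (hc : CompMap n a b ρ D c) (h : TreeOrder n a b ρ)
    (hT : IsEdgeList n a b T) (x y : Fin n) :
    (T.deleteEdges (D : Set (Sym2 (Fin n)))).Reachable x y ↔ c x = c y := by
  set H := T.deleteEdges (D : Set (Sym2 (Fin n))) with hH
  have hadj : ∀ k < n - 1, edgeAt n a b k ∉ D →
      H.Adj (Fin.ofNat n (a k)) (Fin.ofNat n (b k)) := by
    intro k hk hD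
    rw [hH, SimpleGraph.deleteEdges_adj]
    refine ⟨?_, hD⟩
    rw [← SimpleGraph.mem_edgeSet]
    exact (hT.mem_edgeSet h _).2 ⟨k, hk, rfl⟩
  have hself : ∀ x < n, H.Reachable (Fin.ofNat n x) (Fin.ofNat n (c x)) := by
    refine h.induction ?_ fun k hk hP => ?_
    · rw [hc.root]
    · rw [hc.child k hk]
      split_ifs with hD
      · exact SimpleGraph.Reachable.refl _
      · exact (hadj k hk hD).symm.reachable.trans hP
  have hval : ∀ x : Fin n, Fin.ofNat n x.val = x := fun x =>
    Fin.ext (Fin.val_ofNat_of_lt x.isLt)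
  constructor
  · rintro ⟨p⟩
    induction p with
    | nil => rfl
    | cons huv _ ih =>
      refine Eq.trans ?_ ih
      rw [hH, SimpleGraph.deleteEdges_adj, ← SimpleGraph.mem_edgeSet, hT.mem_edgeSet h] at huv
      obtain ⟨⟨k, hk, he⟩, hD⟩ := huv
      have hD' : edgeAt n a b k ∉ D := by rw [he]; exact hD
      have hck := hc.child k hk
      rw [if_neg hD'] at hck
      rw [edgeAt, Sym2.eq_iff] at he
      rcases he with ⟨rfl, rfl⟩ | ⟨rfl, rfl⟩
      · rw [Fin.val_ofNat_of_lt (h.parent_lt k hk), Fin.val_ofNat_of_lt (h.child_lt k hk), hck]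
      · rw [Fin.val_ofNat_of_lt (h.parent_lt k hk), Fin.val_ofNat_of_lt (h.child_lt k hk), hck]
  · intro hxy
    have h1 := hself x x.isLt
    have h2 := hself y y.isLt
    rw [hval] at h1 h2
    rw [hxy] at h1
    exact h1.trans h2.symm

/-- The set of nodes that `c` maps to `t`. -/
def fibre (n : ℕ) (c : ℕ → ℕ) (t : ℕ) : Finset (Fin n) := Finset.univ.filter fun y => c y = t

omit [NeZero n] in
theorem mem_fibre {t : ℕ} {y : Fin n} : y ∈ fibre n c t ↔ c y = t := by
  simp [fibre]

omit [NeZero n] in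
theorem fibre_inj {t t' : ℕ} (hne : (fibre n c t).Nonempty) (he : fibre n c t = fibre n c t') :
    t = t' := by
  obtain ⟨y, hy⟩ := hne
  have hy' := hy
  rw [he] at hy'
  rw [mem_fibre] at hy hy'
  rw [← hy, hy']

theorem CompMap.mem_componentSets (hc : CompMap n a b ρ D c) (h : TreeOrder n a b ρ)
    (hT : IsEdgeList n a b T) (A : Finset (Fin n)) :
    A ∈ componentSets (T.deleteEdges (D : Set (Sym2 (Fin n)))) ↔
      ∃ t < n, fibre n c t = A ∧ A.Nonempty := by
  classical
  simp only [componentSets, Finset.mem_image, Finset.mem_univ, true_and]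
  have : ∀ x : Fin n, (Finset.univ.filter fun y =>
      (T.deleteEdges (D : Set (Sym2 (Fin n)))).Reachable x y) = fibre n c (c x) := by
    intro x
    ext y
    simp only [Finset.mem_filter, Finset.mem_univ, true_and, mem_fibre, hc.reachable_iff h hT]
    exact eq_comm
  constructor
  · rintro ⟨x, rfl⟩
    refine ⟨c x, hc.cutMap.lt h x x.isLt, ?_, x, ?_⟩
    · rw [← this]
      congr
    · simp
  · rintro ⟨t, ht, rfl, ⟨x, hx⟩⟩
    refine ⟨x, ?_⟩
    rw [← mem_fibre.1 hx, ← this]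
    congr

theorem CompMap.mem_componentSizes (hc : CompMap n a b ρ D c) (h : TreeOrder n a b ρ)
    (hT : IsEdgeList n a b T) (z : ℕ) :
    z ∈ componentSizes (T.deleteEdges (D : Set (Sym2 (Fin n)))) ↔
      z ≠ 0 ∧ ∃ t < n, (fibre n c t).card = z := by
  simp only [componentSizes, Finset.mem_image, hc.mem_componentSets h hT]
  constructor
  · rintro ⟨A, ⟨t, ht, rfl, hA⟩, rfl⟩
    exact ⟨(Finset.card_pos.2 hA).ne', t, ht, rfl⟩
  · rintro ⟨hz, t, ht, rfl⟩
    exact ⟨_, ⟨t, ht, rfl, Finset.card_pos.1 (Nat.pos_of_ne_zero hz)⟩, rfl⟩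

theorem CompMap.mem_componentsOfSize (hc : CompMap n a b ρ D c) (h : TreeOrder n a b ρ)
    (hT : IsEdgeList n a b T) {z : ℕ} (hz : z ≠ 0) (A : Finset (Fin n)) :
    A ∈ componentsOfSize (T.deleteEdges (D : Set (Sym2 (Fin n)))) z ↔
      ∃ t < n, (fibre n c t).card = z ∧ fibre n c t = A := by
  simp only [componentsOfSize, Finset.mem_filter, hc.mem_componentSets h hT]
  constructor
  · rintro ⟨⟨t, ht, rfl, hA⟩, rfl⟩
    exact ⟨t, ht, rfl, rfl⟩
  · rintro ⟨t, ht, rfl, rfl⟩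
    exact ⟨⟨t, ht, rfl, Finset.card_pos.1 (Nat.pos_of_ne_zero hz)⟩, rfl⟩

end

/-- The highest numbers of an increasing list, in terms of their positions. -/
theorem mem_highest_iff {K : Finset ℕ} {l : List ℕ} (hl : l.Pairwise (· < ·))
    (hK : ∀ k, k ∈ K ↔ k ∈ l) {s : ℝ} (k : ℕ) :
    k ∈ highest K s ↔ ∃ j, ∃ h : j < l.length, l[j] = k ∧
      (s * (l.length : ℝ) < ((j + 1 : ℕ) : ℝ) ∨ j + 1 = l.length) := by
  classical
  have hmono : StrictMono l.get := List.sortedLT_iff_strictMono_get.1 hl.sortedLT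
  have hKl : K = Finset.univ.image l.get := by
    ext x
    rw [hK, List.mem_iff_get]
    simp only [Finset.mem_image, Finset.mem_univ, true_and]
  have hcard : K.card = l.length := by
    rw [hKl, Finset.card_image_of_injective _ hmono.injective]; simp
  have habove : ∀ j : Fin l.length, (K.filter fun x => l.get j < x).card = l.length - 1 - j := by
    intro j
    have : (K.filter fun x => l.get j < x) = (Finset.Ioi j).image l.get := by
      ext x
      simp only [hKl, Finset.mem_filter, Finset.mem_image, Finset.mem_univ, true_and,
        Finset.mem_Ioi]
      constructor
      · rintro ⟨⟨i, rfl⟩, h⟩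
        exact ⟨i, hmono.lt_iff_lt.1 h, rfl⟩
      · rintro ⟨i, h, rfl⟩
        exact ⟨⟨i, rfl⟩, hmono h⟩
    rw [this, Finset.card_image_of_injective _ hmono.injective, Fin.card_Ioi]
  have hiff : ∀ j : Fin l.length, l.get j ∈ highest K s ↔
      (s * (l.length : ℝ) < ((j.val + 1 : ℕ) : ℝ) ∨ j.val + 1 = l.length) := by
    intro j
    have hmem : l.get j ∈ K := by rw [hKl]; exact Finset.mem_image_of_mem _ (Finset.mem_univ _)
    rw [highest, Finset.mem_filter, habove, hcard]
    have h1 : (∀ x ∈ K, x ≤ l.get j) ↔ j.val + 1 = l.length := by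
      constructor
      · intro hx
        by_contra hne
        have hlt : j.val + 1 < l.length := by omega
        have h2 := hx (l.get ⟨j.val + 1, hlt⟩)
          (by rw [hKl]; exact Finset.mem_image_of_mem _ (Finset.mem_univ _))
        have h3 : j < (⟨j.val + 1, hlt⟩ : Fin l.length) := Fin.lt_def.2 (Nat.lt_succ_self _)
        exact absurd (hmono h3) (not_lt.2 h2)
      · intro hj x hx
        rw [hKl] at hx
        obtain ⟨i, -, rfl⟩ := Finset.mem_image.1 hx
        exact hmono.monotone (Fin.le_def.2 (by omega))
    have h2 : (((l.length - 1 - j.val : ℕ) : ℝ) < (1 - s) * (l.length : ℝ)) ↔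
        s * (l.length : ℝ) < ((j.val + 1 : ℕ) : ℝ) := by
      have : ((l.length - 1 - j.val : ℕ) : ℝ) = (l.length : ℝ) - ((j.val + 1 : ℕ) : ℝ) := by
        rw [show l.length - 1 - j.val = l.length - (j.val + 1) by omega, Nat.cast_sub j.isLt]
      rw [this]
      constructor <;> intro h <;> linarith
    rw [h1, h2]
    exact ⟨fun h => h.2.symm, fun h => ⟨hmem, h.symm⟩⟩
  constructor
  · intro hk
    have : k ∈ K := by
      rw [highest, Finset.mem_filter] at hk
      exact hk.1
    rw [hK] at this
    obtain ⟨j, rfl⟩ := List.mem_iff_get.1 this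
    exact ⟨j, j.isLt, rfl, (hiff j).1 hk⟩
  · rintro ⟨j, hj, rfl, h⟩
    exact (hiff ⟨j, hj⟩).2 h

/-! ### Random rooted forests

A rooted forest on `V` is given by the map that sends every non-root to its parent. -/

section Forest

variable {V : Type} [Fintype V] [DecidableEq V]

/-- The parent map `F` has no cycles. -/
def IsForest (F : V → Option V) : Prop := ∃ h : V → ℕ, ∀ x y, F x = some y → h y < h x

/-- `r` is an ancestor of `x`, or `x` itself. -/
def Anc (F : V → Option V) (x r : V) : Prop := Relation.ReflTransGen (fun a b => F a = some b) x r

omit [Fintype V] [DecidableEq V] in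
theorem IsForest.exists_root {F : V → Option V} (hF : IsForest F) (x : V) :
    ∃ r, Anc F x r ∧ F r = none := by
  obtain ⟨h, hh⟩ := hF
  induction hx : h x using Nat.strong_induction_on generalizing x with
  | _ k ih =>
    cases hFx : F x with
    | none => exact ⟨x, .refl, hFx⟩
    | some y =>
      obtain ⟨r, hr, hr'⟩ := ih (h y) (hx ▸ hh x y hFx) y rfl
      exact ⟨r, .head hFx hr, hr'⟩

omit [Fintype V] [DecidableEq V] in
theorem Anc.root_unique {F : V → Option V} {x r r' : V} (h : Anc F x r) (h' : Anc F x r')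
    (hr : F r = none) (hr' : F r' = none) : r = r' := by
  induction h using Relation.ReflTransGen.head_induction_on with
  | refl =>
    rcases Relation.ReflTransGen.cases_head h' with h1 | ⟨y, h1, -⟩
    · exact h1
    · rw [hr] at h1; cases h1
  | head hxy _ ih =>
    rcases Relation.ReflTransGen.cases_head h' with h1 | ⟨y, h1, h2⟩
    · rw [h1, hr'] at hxy; cases hxy
    · obtain rfl : _ = y := Option.some.inj (hxy.symm.trans h1)
      exact ih h2

open scoped Classical in
/-- The roots of the trees of `F` that do not contain `v`. -/
noncomputable def otherRoots (F : V → Option V) (v : V) : Finset V :=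
  Finset.univ.filter fun r => F r = none ∧ ¬ Anc F v r

omit [DecidableEq V] in
theorem mem_otherRoots {F : V → Option V} {v r : V} :
    r ∈ otherRoots F v ↔ F r = none ∧ ¬ Anc F v r := by
  simp [otherRoots]

/-- The non-roots. -/
def nonroots (F : V → Option V) : Finset V := Finset.univ.filter fun x => F x ≠ none

theorem card_otherRoots {F : V → Option V} (hF : IsForest F) (v : V) :
    (otherRoots F v).card = Fintype.card V - (nonroots F).card - 1 := by
  obtain ⟨r, hr, hr'⟩ := hF.exists_root v
  have h1 : otherRoots F v = (Finset.univ.filter fun x => F x = none).erase r := by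
    ext x
    simp only [mem_otherRoots, Finset.mem_erase, Finset.mem_filter, Finset.mem_univ, true_and]
    constructor
    · rintro ⟨h1, h2⟩
      exact ⟨fun h => h2 (h ▸ hr), h1⟩
    · rintro ⟨h1, h2⟩
      exact ⟨h2, fun h => h1 (h.root_unique hr h2 hr')⟩
  have h2 := Finset.card_filter_add_card_filter_not (s := (Finset.univ : Finset V))
    (fun x => F x = none)
  have h3 : (Finset.univ.filter fun x => ¬ F x = none).card = (nonroots F).card := rfl
  rw [h1, Finset.card_erase_of_mem (by simpa using hr')]
  rw [Finset.card_univ, h3] at h2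
  omega

omit [Fintype V] in
/-- Joining `r` to a parent `v` outside its tree gives a forest. -/
theorem IsForest.update {F : V → Option V} (hF : IsForest F) {v r : V} (hr : F r = none)
    (hv : ¬ Anc F v r) : IsForest (Function.update F r (some v)) := by
  classical
  obtain ⟨h, hh⟩ := hF
  refine ⟨fun x => if Anc F x r then h x + h v + 1 else h x, fun x y hxy => ?_⟩
  by_cases hx : x = r
  · subst hx
    rw [Function.update_self, Option.some_inj] at hxy
    subst hxy
    have : Anc F x x := .refl
    simp only [hv, this, if_true, if_false]
    omega
  · rw [Function.update_of_ne hx] at hxy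
    have h1 : Anc F x r ↔ Anc F y r := by
      constructor
      · intro h1
        rcases Relation.ReflTransGen.cases_head h1 with h2 | ⟨z, h2, h3⟩
        · exact absurd h2 hx
        · rwa [Option.some.inj (hxy.symm.trans h2)]
      · exact fun h1 => .head hxy h1
    have := hh x y hxy
    simp only [h1]
    split_ifs <;> omega

theorem card_nonroots_update {F : V → Option V} {v r : V} (hr : F r = none) :
    (nonroots (Function.update F r (some v))).card = (nonroots F).card + 1 := by
  have : nonroots (Function.update F r (some v)) = insert r (nonroots F) := by
    ext x
    by_cases hx : x = r
    · subst hx; simp [nonroots]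
    · simp [nonroots, hx]
  rw [this, Finset.card_insert_of_notMem]
  simp [nonroots, hr]

omit [Fintype V] in
/-- Deleting the edge from `r` to its parent. -/
theorem IsForest.update_none {F : V → Option V} (hF : IsForest F) (r : V) :
    IsForest (Function.update F r none) := by
  obtain ⟨h, hh⟩ := hF
  refine ⟨h, fun x y hxy => ?_⟩
  by_cases hx : x = r
  · subst hx; simp at hxy
  · rw [Function.update_of_ne hx] at hxy
    exact hh x y hxy

omit [Fintype V] in
theorem IsForest.not_anc_parent {F : V → Option V} (hF : IsForest F) {v r : V}
    (hr : F r = some v) : ¬ Anc (Function.update F r none) v r := by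
  obtain ⟨h, hh⟩ := hF
  intro ha
  have : ∀ x, Anc (Function.update F r none) x r → h r ≤ h x := by
    intro x hx
    induction hx using Relation.ReflTransGen.head_induction_on with
    | refl => exact le_rfl
    | @head x y hxy _ ih =>
      refine ih.trans (hh x y ?_).le
      by_cases hx : x = r
      · subst hx; simp at hxy
      · rwa [Function.update_of_ne hx] at hxy
  have h1 := this v ha
  have h2 := hh r v hr
  omega

/-- One step of growing a random forest: join a random other root to a random node. -/
noncomputable def forestStep [Nonempty V] (F : V → Option V) : PMF (V → Option V) :=
  (PMF.uniformOfFinset (Finset.univ : Finset V) Finset.univ_nonempty).bind fun v =>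
    if h : (otherRoots F v).Nonempty then
      (PMF.uniformOfFinset (otherRoots F v) h).map fun r => Function.update F r (some v)
    else PMF.pure F

/-- A random forest with `k` edges. -/
noncomputable def randomForest (V : Type) [Fintype V] [DecidableEq V] [Nonempty V] :
    ℕ → PMF (V → Option V)
  | 0 => PMF.pure fun _ => none
  | k + 1 => (randomForest V k).bind forestStep

open scoped Classical in
theorem forestStep_apply [Nonempty V] {F : V → Option V} {k : ℕ} (hF : IsForest F)
    (hk : (nonroots F).card = k) (hkn : k + 1 < Fintype.card V) (F' : V → Option V) :
    forestStep F F' = ∑ v : V, ∑ r : V, if r ∈ otherRoots F v ∧ Function.update F r (some v) = F' then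
      (Fintype.card V : ENNReal)⁻¹ * ((Fintype.card V - k - 1 : ℕ) : ENNReal)⁻¹ else 0 := by
  rw [forestStep, PMF.bind_uniformOfFinset_apply, Finset.card_univ]
  refine Finset.sum_congr rfl fun v _ => ?_
  have hc : (otherRoots F v).card = Fintype.card V - k - 1 := by rw [card_otherRoots hF, hk]
  have hne : (otherRoots F v).Nonempty := Finset.card_pos.1 (by omega)
  rw [dif_pos hne, PMF.map, PMF.bind_uniformOfFinset_apply, hc, Finset.mul_sum]
  rw [← Finset.sum_filter_add_sum_filter_not Finset.univ (fun r => r ∈ otherRoots F v)]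
  rw [Finset.filter_univ_mem, Finset.sum_eq_zero (s := Finset.univ.filter _), add_zero]
  · refine Finset.sum_congr rfl fun r hr => ?_
    simp only [Function.comp, PMF.pure_apply, hr, true_and, eq_comm (a := F')]
    split_ifs <;> simp
  · intro r hr
    rw [if_neg]
    exact fun h => (Finset.mem_filter.1 hr).2 h.1

open scoped Classical in
/-- All forests with the same number of edges have the same probability. -/
theorem exists_randomForest_apply [Nonempty V] (k : ℕ) (hk : k < Fintype.card V) :
    ∃ c : ENNReal, ∀ F : V → Option V, randomForest V k F =
      if IsForest F ∧ (nonroots F).card = k then c else 0 := by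
  induction k with
  | zero =>
    refine ⟨1, fun F => ?_⟩
    rw [randomForest, PMF.pure_apply]
    congr 1
    simp only [eq_iff_iff]
    constructor
    · rintro rfl
      exact ⟨⟨fun _ => 0, by simp⟩, by simp [nonroots]⟩
    · rintro ⟨-, h⟩
      funext x
      by_contra hx
      have : x ∈ nonroots F := by simpa [nonroots] using hx
      rw [Finset.card_eq_zero.1 h] at this
      simp at this
  | succ k ih =>
    obtain ⟨c, hc⟩ := ih (by omega)
    set d : ENNReal := (Fintype.card V : ENNReal)⁻¹ * ((Fintype.card V - k - 1 : ℕ) : ENNReal)⁻¹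
    refine ⟨((k + 1 : ℕ) : ENNReal) * (c * d), fun F' => ?_⟩
    have h1 : randomForest V (k + 1) F' = ∑ F : V → Option V, ∑ v : V, ∑ r : V,
        if (IsForest F ∧ (nonroots F).card = k) ∧ r ∈ otherRoots F v ∧
          Function.update F r (some v) = F' then c * d else 0 := by
      rw [randomForest, PMF.bind_apply, tsum_fintype]
      refine Finset.sum_congr rfl fun F _ => ?_
      rw [hc]
      by_cases hF : IsForest F ∧ (nonroots F).card = k
      · rw [if_pos hF, forestStep_apply hF.1 hF.2 hk, Finset.mul_sum]
        refine Finset.sum_congr rfl fun v _ => ?_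
        rw [Finset.mul_sum]
        refine Finset.sum_congr rfl fun r _ => ?_
        simp only [hF, true_and, mul_ite, mul_zero, and_self]
        rfl
      · simp [hF]
    have h2 : ∀ F v r, (((IsForest F ∧ (nonroots F).card = k) ∧ r ∈ otherRoots F v ∧
        Function.update F r (some v) = F') ↔ ((IsForest F' ∧ (nonroots F').card = k + 1) ∧
          F' r = some v) ∧ F = Function.update F' r none) := by
      intro F v r
      rw [mem_otherRoots]
      constructor
      · rintro ⟨⟨h3, h4⟩, ⟨h5, h6⟩, rfl⟩
        refine ⟨⟨⟨h3.update h5 h6, by rw [card_nonroots_update h5, h4]⟩, by simp⟩, ?_⟩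
        rw [Function.update_idem, ← h5, Function.update_eq_self]
      · rintro ⟨⟨⟨h3, h4⟩, h5⟩, rfl⟩
        have h6 : Function.update (Function.update F' r none) r (some v) = F' := by
          rw [Function.update_idem, ← h5, Function.update_eq_self]
        have h7 : Function.update F' r none r = none := by simp
        refine ⟨⟨h3.update_none r, ?_⟩, ⟨h7, h3.not_anc_parent h5⟩, h6⟩
        have := card_nonroots_update (v := v) h7
        rw [h6] at this
        omega
    rw [h1]
    simp only [h2]
    rw [Finset.sum_comm]
    have h3 : ∀ v : V, (∑ F : V → Option V, ∑ r : V,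
        if ((IsForest F' ∧ (nonroots F').card = k + 1) ∧ F' r = some v) ∧
          F = Function.update F' r none then c * d else 0) = ∑ r : V,
        if (IsForest F' ∧ (nonroots F').card = k + 1) ∧ F' r = some v then c * d else 0 := by
      intro v
      rw [Finset.sum_comm]
      refine Finset.sum_congr rfl fun r _ => ?_
      by_cases h : (IsForest F' ∧ (nonroots F').card = k + 1) ∧ F' r = some v
      · simp only [h, true_and, and_self, if_true]
        rw [Finset.sum_ite_eq' Finset.univ]
        simp
      · simp [h]
    rw [Finset.sum_congr rfl fun v _ => h3 v, Finset.sum_comm]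
    by_cases h : IsForest F' ∧ (nonroots F').card = k + 1
    · simp only [h, true_and, and_self, if_true]
      have h4 : ∀ r : V, (∑ v : V, if F' r = some v then c * d else 0) =
          if F' r ≠ none then c * d else 0 := by
        intro r
        cases hr : F' r with
        | none => simp
        | some w => simp
      rw [Finset.sum_congr rfl fun r _ => h4 r, ← Finset.sum_filter, Finset.sum_const, nsmul_eq_mul]
      have : (Finset.univ.filter fun r => F' r ≠ none).card = k + 1 := h.2
      rw [this]
    · simp [h]

/-! ### The tree of a forest with one root -/

/-- The graph that joins every non-root to its parent. -/
def parentGraph (F : V → Option V) : SimpleGraph V :=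
  SimpleGraph.fromRel fun x y => F x = some y

omit [Fintype V] [DecidableEq V] in
theorem IsForest.parentGraph_adj {F : V → Option V} (hF : IsForest F) {x y : V} :
    (parentGraph F).Adj x y ↔ F x = some y ∨ F y = some x := by
  obtain ⟨h, hh⟩ := hF
  rw [parentGraph, SimpleGraph.fromRel_adj]
  refine ⟨fun h => h.2, fun h' => ⟨?_, h'⟩⟩
  rintro rfl
  rcases h' with h' | h' <;> exact lt_irrefl _ (hh _ _ h')

omit [DecidableEq V] in
theorem exists_unique_root {F : V → Option V}
    (hc : (nonroots F).card + 1 = Fintype.card V) : ∃! r, F r = none := by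
  have h2 := Finset.card_filter_add_card_filter_not (s := (Finset.univ : Finset V))
    (fun x => F x = none)
  have h3 : (Finset.univ.filter fun x => F x = none).card = 1 := by
    rw [Finset.card_univ] at h2
    have : (Finset.univ.filter fun x => ¬ F x = none).card = (nonroots F).card := rfl
    omega
  obtain ⟨r, hr⟩ := Finset.card_eq_one.1 h3
  have h4 : ∀ x, F x = none ↔ x = r := fun x => by
    have := Finset.ext_iff.1 hr x
    simpa using this
  exact ⟨r, (h4 r).2 rfl, fun x hx => (h4 x).1 hx⟩

theorem IsForest.isTree {F : V → Option V} (hF : IsForest F)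
    (hc : (nonroots F).card + 1 = Fintype.card V) : (parentGraph F).IsTree := by
  classical
  obtain ⟨r, hr, hr'⟩ := exists_unique_root hc
  have hreach : ∀ x, (parentGraph F).Reachable x r := by
    intro x
    obtain ⟨r₁, h1, h2⟩ := hF.exists_root x
    obtain rfl := hr' r₁ h2
    clear h2 hr hr'
    induction h1 using Relation.ReflTransGen.head_induction_on with
    | refl => exact .refl _
    | head hxy _ ih =>
      exact (SimpleGraph.Adj.reachable (hF.parentGraph_adj.2 (Or.inl hxy))).trans ih
  have hconn : (parentGraph F).Connected :=
    (SimpleGraph.connected_iff _).2 ⟨fun x y => (hreach x).trans (hreach y).symm, ⟨r⟩⟩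
  rw [SimpleGraph.isTree_iff_connected_and_card]
  refine ⟨hconn, le_antisymm ?_ ?_⟩
  · rw [Nat.card_eq_fintype_card, Nat.card_eq_fintype_card, ← hc, ← SimpleGraph.edgeFinset_card]
    refine Nat.succ_le_succ ?_
    have : (parentGraph F).edgeFinset ⊆ (nonroots F).image fun x => s(x, (F x).getD x) := by
      intro e he
      induction e using Sym2.ind with
      | _ x y =>
        rw [SimpleGraph.mem_edgeFinset, SimpleGraph.mem_edgeSet, hF.parentGraph_adj] at he
        rw [Finset.mem_image]
        rcases he with h | h
        · exact ⟨x, by simp [nonroots, h], by simp [h]⟩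
        · exact ⟨y, by simp [nonroots, h], by simp [h, Sym2.eq_swap]⟩
    exact (Finset.card_le_card this).trans Finset.card_image_le
  · exact hconn.card_vert_le_card_edgeSet_add_one

omit [Fintype V] [DecidableEq V] in
/-- A forest with one root is determined by its tree and its root. -/
theorem parentGraph_injective {F F' : V → Option V} (hF : IsForest F) (hF' : IsForest F')
    (hg : parentGraph F = parentGraph F') (hr : ∀ x, F x = none ↔ F' x = none) : F = F' := by
  obtain ⟨h, hh⟩ := id hF
  funext x
  induction hx : h x using Nat.strong_induction_on generalizing x with
  | _ k ih =>
    cases hFx : F x with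
    | none => rw [(hr x).1 hFx]
    | some y =>
      have hlt := hh x y hFx
      have hy := ih (h y) (hx ▸ hlt) y rfl
      have hadj : (parentGraph F').Adj x y := by
        rw [← hg, hF.parentGraph_adj]; exact Or.inl hFx
      rcases hF'.parentGraph_adj.1 hadj with h1 | h1
      · exact h1.symm
      · rw [← hy] at h1
        exact absurd (hh y x h1) (by omega)

/-- Every tree can be rooted at every node. -/
theorem SimpleGraph.IsTree.exists_parentGraph_eq {T : SimpleGraph V} (hT : T.IsTree) (r : V) :
    ∃ F : V → Option V, IsForest F ∧ (∀ x, F x = none ↔ x = r) ∧ parentGraph F = T := by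
  classical
  have hnext : ∀ x, x ≠ r → ∃ y, T.Adj x y ∧ T.dist y r < T.dist x r := by
    intro x hx
    obtain ⟨p, hp⟩ := hT.1.exists_walk_length_eq_dist x r
    cases p with
    | nil => exact absurd rfl hx
    | cons hadj q =>
      refine ⟨_, hadj, ?_⟩
      have := T.dist_le q
      rw [SimpleGraph.Walk.length_cons] at hp
      omega
  choose! next hadj hdist using hnext
  let F : V → Option V := fun x => if x = r then none else some (next x)
  have hroot : ∀ x, F x = none ↔ x = r := fun x => by simp [F]
  have hsome : ∀ x y, F x = some y → x ≠ r ∧ next x = y := fun x y h => by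
    by_cases hx : x = r
    · simp [F, hx] at h
    · exact ⟨hx, by simpa [F, hx] using h⟩
  have hF : IsForest F := ⟨fun x => T.dist x r, fun x y h => by
    obtain ⟨h1, rfl⟩ := hsome x y h
    exact hdist x h1⟩
  refine ⟨F, hF, hroot, ?_⟩
  have hle : parentGraph F ≤ T := by
    intro x y hxy
    rcases hF.parentGraph_adj.1 hxy with h | h
    · obtain ⟨h1, rfl⟩ := hsome x y h
      exact hadj x h1
    · obtain ⟨h1, rfl⟩ := hsome y x h
      exact (hadj y h1).symm
  have hcard : (nonroots F).card + 1 = Fintype.card V := by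
    have : nonroots F = Finset.univ.erase r := by
      ext x; simp [nonroots, hroot]
    rw [this, Finset.card_erase_of_mem (Finset.mem_univ _), Finset.card_univ]
    have := Fintype.card_pos_iff.2 ⟨r⟩
    omega
  have hF' := hF.isTree hcard
  refine SimpleGraph.edgeFinset_inj.1 (Finset.eq_of_subset_of_card_le
    (SimpleGraph.edgeFinset_subset_edgeFinset.2 hle) ?_)
  have h1 := hF'.card_edgeFinset
  have h2 := hT.card_edgeFinset
  omega

open scoped Classical in
/-- The tree of a forest with one root. -/
noncomputable def forestTree (n : ℕ) [NeZero n] (F : Fin n → Option (Fin n)) : LabelledTree n :=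
  if h : (parentGraph F).IsTree then ⟨_, h⟩ else Classical.arbitrary _

/-- The tree of a random forest with `n - 1` edges is a uniformly random tree. -/
theorem map_forestTree_randomForest (n : ℕ) [NeZero n] :
    (randomForest (Fin n) (n - 1)).map (forestTree n) = PMF.uniformOfFintype (LabelledTree n) := by
  classical
  have hn : 0 < n := Nat.pos_of_ne_zero (NeZero.ne n)
  obtain ⟨c, hc⟩ := exists_randomForest_apply (V := Fin n) (n - 1) (by simp; omega)
  refine PMF.eq_uniformOfFinset ((n : ENNReal) * c) _ (fun T _ => ?_) (by simp)
  rw [PMF.map_apply, tsum_fintype]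
  have h1 : ∀ F : Fin n → Option (Fin n), (if T = forestTree n F then
      randomForest (Fin n) (n - 1) F else 0) =
      if (IsForest F ∧ (nonroots F).card = n - 1) ∧ parentGraph F = T.1 then c else 0 := by
    intro F
    rw [hc]
    by_cases hF : IsForest F ∧ (nonroots F).card = n - 1
    · have ht : (parentGraph F).IsTree := hF.1.isTree (by simp; omega)
      have : T = forestTree n F ↔ parentGraph F = T.1 := by
        rw [forestTree, dif_pos ht, Subtype.ext_iff, eq_comm]
      simp [hF, this]
    · simp [hF]
  refine (Finset.sum_congr rfl fun F _ => by convert h1 F).trans ?_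
  rw [← Finset.sum_filter, Finset.sum_const, nsmul_eq_mul]
  congr 2
  have hnone : ∀ F : Fin n → Option (Fin n), (nonroots F).card = n - 1 → ∃! r, F r = none :=
    fun F hF => exists_unique_root (by simp; omega)
  choose! root hroot hroot' using hnone
  have hiff : ∀ F : Fin n → Option (Fin n), (nonroots F).card = n - 1 →
      ∀ x, F x = none ↔ x = root F :=
    fun F hF x => ⟨hroot' F hF x, fun h => h ▸ hroot F hF⟩
  rw [Finset.card_bij' (t := Finset.univ) (fun F _ => root F)
    (fun r _ => (T.2.exists_parentGraph_eq r).choose)]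
  · simp
  · simp
  · intro r _
    obtain ⟨h2, h3, h4⟩ := (T.2.exists_parentGraph_eq r).choose_spec
    simp only [Finset.mem_filter, Finset.mem_univ, true_and]
    refine ⟨⟨h2, ?_⟩, h4⟩
    have : nonroots (T.2.exists_parentGraph_eq r).choose = Finset.univ.erase r := by
      ext x; simp [nonroots, h3]
    rw [this, Finset.card_erase_of_mem (Finset.mem_univ _)]
    simp
  · intro F hF
    simp only [Finset.mem_filter, Finset.mem_univ, true_and] at hF
    obtain ⟨h2, h3, h4⟩ := (T.2.exists_parentGraph_eq (root F)).choose_spec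
    refine parentGraph_injective h2 hF.1.1 (h4.trans hF.2.symm) fun x => ?_
    rw [h3, hiff F hF.1.2]
  · intro r _
    obtain ⟨h2, h3, h4⟩ := (T.2.exists_parentGraph_eq r).choose_spec
    refine (hroot' _ ?_ r ((h3 r).2 rfl)).symm
    have : nonroots (T.2.exists_parentGraph_eq r).choose = Finset.univ.erase r := by
      ext x; simp [nonroots, h3]
    rw [this, Finset.card_erase_of_mem (Finset.mem_univ _)]
    simp

end Forest

/-! ### Deleting random edges

Register conventions: `0` holds `n`, `3` holds `0`, `4` holds `1`, `5` holds `n - 1`, `6` holds the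
number of edges to delete, `7` holds the root of the host tree, and `28` holds `n + 1`. Arrays `0`
and `1` hold the parents and the children of the topologically sorted edges of the host tree. -/

theorem uniformSubset_empty {α : Type*} (k : ℕ) :
    uniformSubset (∅ : Finset α) k = PMF.pure ∅ := by
  refine (PMF.eq_uniformOfFinset 1 _ (fun D hD => ?_) fun D hD => ?_).symm
  · rw [Finset.mem_powersetCard, Finset.subset_empty] at hD
    simp [hD.1]
  · rw [Finset.mem_powersetCard, Finset.subset_empty] at hD
    have : D ≠ ∅ := by
      rintro rfl
      simp at hD
    simp [this]

open scoped Classical in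
theorem uniformSubset_image_Ico {n : ℕ} [NeZero n] {a b : ℕ → ℕ} {ρ : ℕ}
    (hT : TreeOrder n a b ρ) {k d : ℕ} (hk : k < n - 1) (D : Finset (Sym2 (Fin n)))
    (hD : D ⊆ (Finset.range k).image (edgeAt n a b)) (hd : D.card ≤ d) (hd' : d - D.card ≤ n - 1 - k)
    (hne : (Finset.range (n - 1 - k)).Nonempty) :
    (uniformSubset ((Finset.Ico k (n - 1)).image (edgeAt n a b)) (d - D.card)).map (D ∪ ·) =
    ((PMF.uniformOfFinset (Finset.range (n - 1 - k)) hne).map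
      fun u => if u < d - D.card then insert (edgeAt n a b k) D else D).bind fun D' =>
      (uniformSubset ((Finset.Ico (k + 1) (n - 1)).image (edgeAt n a b)) (d - D'.card)).map
        (D' ∪ ·) := by
  have hinj : ∀ {i j}, i < n - 1 → j < n - 1 → edgeAt n a b i = edgeAt n a b j → i = j :=
    fun hi hj => hT.edgeAt_inj hi hj
  have hIco : Finset.Ico k (n - 1) = insert k (Finset.Ico (k + 1) (n - 1)) := by
    ext i; simp only [Finset.mem_Ico, Finset.mem_insert]; omega
  have hnot : edgeAt n a b k ∉ (Finset.Ico (k + 1) (n - 1)).image (edgeAt n a b) := by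
    intro h
    obtain ⟨j, hj, he⟩ := Finset.mem_image.1 h
    rw [Finset.mem_Ico] at hj
    have := hinj hj.2 hk he
    omega
  have hcard : ((Finset.Ico (k + 1) (n - 1)).image (edgeAt n a b)).card + 1 = n - 1 - k := by
    rw [Finset.card_image_of_injOn, Nat.card_Ico]
    · omega
    · intro i hi j hj
      rw [Finset.coe_Ico, Set.mem_Ico] at hi hj
      exact hinj hi.2 hj.2
  have hnotD : edgeAt n a b k ∉ D := by
    intro h
    obtain ⟨j, hj, he⟩ := Finset.mem_image.1 (hD h)
    rw [Finset.mem_range] at hj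
    have := hinj (hj.trans hk) hk he
    omega
  rw [hIco, Finset.image_insert, uniformSubset_insert hnot hcard hd' hne, PMF.map_bind,
    PMF.bind_map]
  congr 1
  funext u
  simp only [Function.comp]
  split_ifs with h
  · rw [Finset.card_insert_of_notMem hnotD, PMF.map_comp, Nat.sub_sub]
    congr 1
    funext D'
    simp [Finset.insert_union]
  · rfl

/-- Delete random edges, and write the top node of the component of node `x` to entry `reg 12 + x`
of array `10`. -/
def cutProg : Prog :=
  .block [.copy 14 6, .copy 15 5, .add 20 12 7, .store 10 20 7] ;;
  .for 21 5 (
    .rand 16 15 ;;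
    .block [.load 17 1 21, .load 18 0 21, .sub 15 15 4, .add 20 12 17, .add 19 12 18,
      .load 19 10 19] ;;
    .ite (.lt 16 14) (.block [.sub 14 14 4, .store 10 20 17]) (.block [.store 10 20 19]))

open scoped Classical in
theorem Sim.cutProg {s : ℝ} {n : ℕ} [NeZero n] {m : Mem} {a b : ℕ → ℕ} {ρ : ℕ} (ha : m.arr 0 = a)
    (hb : m.arr 1 = b) (hρ : m.reg 7 = ρ) (hT : TreeOrder n a b ρ) (h5 : m.reg 5 = n - 1)
    (h4 : m.reg 4 = 1) (h6 : m.reg 6 ≤ n - 1) :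
    Sim s cutProg m (uniformSubset ((Finset.range (n - 1)).image (edgeAt n a b)) (m.reg 6))
      (fun D m' => CompMap n a b ρ D (fun x => m'.arr 10 (m.reg 12 + x)) ∧
        ∀ j < m.reg 12, m'.arr 10 j = m.arr 10 j) ((n - 1) * 16 + 7) := by
  set d := m.reg 6 with hd
  refine (Det.seq (Det.block _ m) (B' := (n - 1) * (14 + 2) + 2) fun m₁ hm₁ hU₁ => ?_).mono_time
    (by simp; omega)
  set I : ℕ → Finset (Sym2 (Fin n)) → Mem → Prop := fun k D m' =>
    D ⊆ (Finset.range k).image (edgeAt n a b) ∧ D.card + m'.reg 14 = d ∧ m'.reg 14 ≤ n - 1 - k ∧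
    m'.reg 15 = n - 1 - k ∧ m'.arr 10 (m.reg 12 + ρ) = ρ ∧
    (∀ j < k, m'.arr 10 (m.reg 12 + b j) = if edgeAt n a b j ∈ D then b j else
      m'.arr 10 (m.reg 12 + a j)) ∧ ∀ j < m.reg 12, m'.arr 10 j = m.arr 10 j with hI
  have hmain := Sim.for (s := s) (A := fun _ => Finset (Sym2 (Fin n))) (i := 21) (N := 5)
    (body := .rand 16 15 ;;
    .block [.load 17 1 21, .load 18 0 21, .sub 15 15 4, .add 20 12 17, .add 19 12 18,
      .load 19 10 19] ;;
    .ite (.lt 16 14) (.block [.sub 14 14 4, .store 10 20 17]) (.block [.store 10 20 19]))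
    (m := m₁) (b := 14) (L := n - 1)
    (fun k D => (uniformSubset ((Finset.Ico k (n - 1)).image (edgeAt n a b)) (d - D.card)).map
      (D ∪ ·)) I
    (fun D m' => CompMap n a b ρ D (fun x => m'.arr 10 (m.reg 12 + x)) ∧
        ∀ j < m.reg 12, m'.arr 10 j = m.arr 10 j)
    (by rw [hU₁.reg 5 rfl, h5]) (by rw [hU₁.reg 4 rfl, h4]) (by decide) (by decide) rfl rfl rfl ∅
    ?_ ?_ ?_
  · have e : (uniformSubset ((Finset.Ico 0 (n - 1)).image (edgeAt n a b))
        (d - (∅ : Finset (Sym2 (Fin n))).card)).map ((∅ : Finset (Sym2 (Fin n))) ∪ ·) =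
        uniformSubset ((Finset.range (n - 1)).image (edgeAt n a b)) d := by
      simp only [Finset.empty_union, Finset.card_empty, Nat.sub_zero, Nat.Ico_zero_eq_range]
      exact PMF.map_id _
    rwa [e] at hmain
  · subst hm₁
    simp only [hI]
    refine ⟨by simp, ?_, ?_, ?_, ?_, by simp, ?_⟩
    · simp [Mem.run, Instr.apply, hd]
    · simpa [Mem.run, Instr.apply, ← hd] using h6
    · simp [Mem.run, Instr.apply, h5]
    · simp [Mem.run, Instr.apply, hρ]
    · intro j hj
      have : j ≠ m.reg 12 + m.reg 7 := by omega
      simp [Mem.run, Instr.apply, this]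
  · rintro k hk D m' hU h21 ⟨i1, i2, i3, i4, i5, i6, i7⟩
    have hne : (Finset.range (m'.reg 15)).Nonempty := by
      rw [i4, Finset.nonempty_range_iff]; omega
    have ea : m'.arr 0 = a := by rw [hU.arr 0 rfl, hU₁.arr 0 rfl, ha]
    have eb : m'.arr 1 = b := by rw [hU.arr 1 rfl, hU₁.arr 1 rfl, hb]
    have e4 : m'.reg 4 = 1 := by rw [hU.reg 4 rfl, hU₁.reg 4 rfl, h4]
    have e12 : m'.reg 12 = m.reg 12 := by rw [hU.reg 12 rfl, hU₁.reg 12 rfl]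
    have hnb : ∀ j < k, b j ≠ b k := fun j hj h =>
      hj.ne (hT.inj j (hj.trans hk) k hk h)
    have hρb : ρ ≠ b k := fun h => hT.child_ne k hk h.symm
    have hna : ∀ j ≤ k, a j ≠ b k := by
      intro j hj h
      rcases hT.parent_mem j (by omega) with h1 | ⟨i, hi, h1⟩
      · exact hρb (h1.symm.trans h)
      · exact hnb i (by omega) (h1.trans h)
    refine ⟨(PMF.uniformOfFinset _ hne).map
      fun u => if u < d - D.card then insert (edgeAt n a b k) D else D, ?_, ?_⟩
    · have := uniformSubset_image_Ico hT (d := d) hk D i1 (by omega) (by omega)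
        (by rwa [i4] at hne)
      rw [this]
      congr 2
      simp only [i4]
    · refine Sim.map (Q := fun u m'' => I (k + 1) (if u < d - D.card then
        insert (edgeAt n a b k) D else D) (m''.setReg 21 (k + 1))) ?_ _ fun _ _ _ h _ => h
      have hnotD : edgeAt n a b k ∉ D := by
        intro h
        obtain ⟨j, hj, he⟩ := Finset.mem_image.1 (i1 h)
        rw [Finset.mem_range] at hj
        have := hT.edgeAt_inj (hj.trans hk) hk he
        omega
      have hsub : (Finset.range k).image (edgeAt n a b) ⊆
          (Finset.range (k + 1)).image (edgeAt n a b) :=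
        Finset.image_subset_image (Finset.range_subset_range.2 (Nat.le_succ k))
      refine ((Sim.rand hne).seq_det (B' := 13) fun u hu m₂ hm₂ _ => ?_)
      rw [PMF.mem_support_uniformOfFinset_iff, Finset.mem_range] at hu
      refine Det.seq (Det.block _ m₂) (B' := 6) fun m₃ hm₃ _ => ?_
      have r16 : m₃.reg 16 = u := by subst hm₃ hm₂; simp [Mem.run, Instr.apply]
      have r14 : m₃.reg 14 = m'.reg 14 := by subst hm₃ hm₂; simp [Mem.run, Instr.apply]
      have r15 : m₃.reg 15 = n - 1 - (k + 1) := by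
        subst hm₃ hm₂; simp [Mem.run, Instr.apply, i4, e4]; omega
      have r17 : m₃.reg 17 = b k := by
        subst hm₃ hm₂; simp [Mem.run, Instr.apply, h21, eb]
      have r20 : m₃.reg 20 = m.reg 12 + b k := by
        subst hm₃ hm₂; simp [Mem.run, Instr.apply, h21, eb, e12]
      have r19 : m₃.reg 19 = m'.arr 10 (m.reg 12 + a k) := by
        subst hm₃ hm₂; simp [Mem.run, Instr.apply, h21, ea, e12]
      have r4 : m₃.reg 4 = 1 := by subst hm₃ hm₂; simpa [Mem.run, Instr.apply] using e4
      have rA : m₃.arr 10 = m'.arr 10 := by subst hm₃ hm₂; simp [Mem.run, Instr.apply]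
      refine Sim.ite (B := 5) (fun ht => ?_) fun ht => ?_
      · simp only [Test.Holds, r16, r14] at ht
        have hud : u < d - D.card := by omega
        refine (Det.block _ m₃).imp (by simp) fun _ _ m₄ hm₄ _ => ?_
        subst hm₄
        simp only [hI, if_pos hud]
        refine ⟨?_, ?_, ?_, ?_, ?_, ?_, ?_⟩
        · refine Finset.insert_subset (Finset.mem_image_of_mem _ (by simp)) (i1.trans hsub)
        · rw [Finset.card_insert_of_notMem hnotD]
          simp [Mem.run, Instr.apply, r14, r4]; omega
        · simp [Mem.run, Instr.apply, r14, r4]; omega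
        · simp [Mem.run, Instr.apply, r15]
        · simp [Mem.run, Instr.apply, rA, r20, hρb, i5]
        · intro j hj
          have hm : ∀ j, j < k → (edgeAt n a b j ∈ insert (edgeAt n a b k) D ↔
              edgeAt n a b j ∈ D) := fun j hj => by
            rw [Finset.mem_insert, or_iff_right]
            exact fun h => hj.ne (hT.edgeAt_inj (hj.trans hk) hk h)
          rcases Nat.lt_succ_iff_lt_or_eq.1 hj with h | rfl
          · simp [Mem.run, Instr.apply, rA, r20, hnb j h, hna j h.le, hm j h, i6 j h]
          · simp [Mem.run, Instr.apply, r20, r17]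
        · intro j hj
          have : j ≠ m.reg 12 + b k := by omega
          simp [Mem.run, Instr.apply, rA, r20, this, i7 j hj]
      · simp only [Test.Holds, r16, r14] at ht
        have hud : ¬ u < d - D.card := by omega
        refine (Det.block _ m₃).imp (by simp) fun _ _ m₄ hm₄ _ => ?_
        subst hm₄
        simp only [hI, if_neg hud]
        rw [i4] at hu
        refine ⟨i1.trans hsub, ?_, ?_, ?_, ?_, ?_, ?_⟩
        · simp [Mem.run, Instr.apply, r14, i2]
        · simp [Mem.run, Instr.apply, r14]; omega
        · simp [Mem.run, Instr.apply, r15]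
        · simp [Mem.run, Instr.apply, rA, r20, hρb, i5]
        · intro j hj
          rcases Nat.lt_succ_iff_lt_or_eq.1 hj with h | rfl
          · simp [Mem.run, Instr.apply, rA, r20, hnb j h, hna j h.le, i6 j h]
          · simp [Mem.run, Instr.apply, rA, r20, r19, hnotD, hna j le_rfl]
        · intro j hj
          have : j ≠ m.reg 12 + b k := by omega
          simp [Mem.run, Instr.apply, rA, r20, this, i7 j hj]
  · rintro D m' hU ⟨i1, i2, i3, i4, i5, i6, i7⟩
    refine ⟨D, ?_, ⟨i5, i6⟩, i7⟩
    simp [uniformSubset_empty, PMF.pure_map]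

/-! ### Choosing a component -/

/-- Write the sizes of the components to array `11`, and mark the sizes that occur in array `12`. -/
def sizesProg : Prog :=
  .for 21 28 (.block [.store 11 21 3, .store 12 21 3]) ;;
  .for 21 0 (.block [.add 20 12 21, .load 19 10 20, .load 20 11 19, .add 20 20 4, .store 11 19 20]) ;;
  .for 21 0 (.block [.load 20 11 21, .store 12 20 4]) ;;
  .instr (.store 12 3 3)

theorem card_fibre_eq {n : ℕ} (c : ℕ → ℕ) (t : ℕ) :
    (fibre n c t).card = ((Finset.range n).filter fun x => c x = t).card := by
  rw [← Finset.card_map Fin.valEmbedding]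
  congr 1
  ext x
  simp only [Finset.mem_map, mem_fibre, Fin.valEmbedding_apply, Finset.mem_filter,
    Finset.mem_range]
  constructor
  · rintro ⟨y, hy, rfl⟩
    exact ⟨y.isLt, hy⟩
  · rintro ⟨hx, h⟩
    exact ⟨⟨x, hx⟩, h, rfl⟩

theorem Det.sizesProg {s : ℝ} {n : ℕ} {m : Mem} {c : ℕ → ℕ} (h0 : m.reg 0 = n) (h3 : m.reg 3 = 0)
    (h4 : m.reg 4 = 1) (h28 : m.reg 28 = n + 1) (hc : ∀ x < n, m.arr 10 (m.reg 12 + x) = c x) :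
    Det s sizesProg m (fun m' => (∀ t < n, m'.arr 11 t = (fibre n c t).card) ∧
      ∀ z < n + 1, m'.arr 12 z ≠ 0 ↔ z ≠ 0 ∧ ∃ t < n, (fibre n c t).card = z) (n * 18 + 12) := by
  refine (Det.seq (Q := fun m' => ∀ j < n + 1, m'.arr 11 j = 0 ∧ m'.arr 12 j = 0)
    (B := (n + 1) * (3 + 2) + 2) (B' := n * 13 + 5) ?_ ?_).mono_time (by omega)
  · refine Det.for (fun k m' => ∀ j < k, m'.arr 11 j = 0 ∧ m'.arr 12 j = 0) h28 h4 (by simp) ?_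
    intro k hk m' hU hi hI
    have e3 : m'.reg 3 = 0 := by rw [hU.reg 3 rfl, h3]
    refine (Det.block _ m').imp (by simp) fun _ _ m₂ hm₂ _ => ?_
    subst hm₂
    intro j hj
    rcases Nat.lt_succ_iff_lt_or_eq.1 hj with h | rfl
    · have hjk : j ≠ k := h.ne
      simp [Mem.run, Instr.apply, Mem.arr_setArr, hi, hjk, hI j h]
    · simp [Mem.run, Instr.apply, Mem.arr_setArr, hi, e3]
  intro m₁ hm₁ hU₁
  refine (Det.seq (Q := fun m' => (∀ t < n, m'.arr 11 t = (fibre n c t).card) ∧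
      ∀ j < n + 1, m'.arr 12 j = 0)
    (B := n * (6 + 2) + 2) (B' := n * 5 + 3) ?_ ?_).mono_time (by omega)
  · refine (Det.for (fun k m' => ∀ t < n, m'.arr 11 t =
      ((Finset.range k).filter fun x => c x = t).card) (L := n) (b := 6) (by rw [hU₁.reg 0 rfl, h0])
      (by rw [hU₁.reg 4 rfl, h4]) ?_ ?_).imp le_rfl fun _ _ m' hm' hU => ?_
    · intro t ht
      simpa using (hm₁ t (by omega)).1
    · intro k hk m' hU hi hI
      have e10 : m'.arr 10 = m.arr 10 := by rw [hU.arr 10 rfl, hU₁.arr 10 rfl]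
      have e12 : m'.reg 12 = m.reg 12 := by rw [hU.reg 12 rfl, hU₁.reg 12 rfl]
      have e4 : m'.reg 4 = 1 := by rw [hU.reg 4 rfl, hU₁.reg 4 rfl, h4]
      refine (Det.block _ m').imp (by simp) fun _ _ m₂ hm₂ _ => ?_
      subst hm₂
      intro t ht
      rw [Finset.range_add_one, Finset.filter_insert]
      by_cases htc : c k = t
      · subst htc
        rw [if_pos rfl, Finset.card_insert_of_notMem (by simp)]
        simp [Mem.run, Instr.apply, hi, e10, e12, hc k hk, e4, hI _ ht]
      · rw [if_neg htc]
        have htc' : ¬ t = c k := fun h => htc h.symm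
        simp [Mem.run, Instr.apply, hi, e10, e12, hc k hk, hI _ ht, htc']
    · refine ⟨fun t ht => by rw [card_fibre_eq]; exact hm' t ht, fun j hj => ?_⟩
      rw [hU.arr 12 rfl]
      exact (hm₁ j hj).2
  intro m₂ hm₂ hU₂
  refine (Det.seq (Q := fun m' => ∀ z < n + 1, m'.arr 12 z ≠ 0 ↔ ∃ t < n, (fibre n c t).card = z)
    (B := n * (3 + 2) + 2) (B' := 1) ?_ ?_).mono_time (by omega)
  · refine Det.for (fun k m' => ∀ z < n + 1, m'.arr 12 z ≠ 0 ↔ ∃ t < k, (fibre n c t).card = z)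
      (L := n) (b := 3) (by rw [hU₂.reg 0 rfl, hU₁.reg 0 rfl, h0])
      (by rw [hU₂.reg 4 rfl, hU₁.reg 4 rfl, h4]) ?_ ?_
    · intro z hz
      simpa using hm₂.2 z hz
    · intro k hk m' hU hi hI
      have e4 : m'.reg 4 = 1 := by rw [hU.reg 4 rfl, hU₂.reg 4 rfl, hU₁.reg 4 rfl, h4]
      have e11 : m'.arr 11 = m₂.arr 11 := hU.arr 11 rfl
      refine (Det.block _ m').imp (by simp) fun _ _ m₃ hm₃ _ => ?_
      subst hm₃
      intro z hz
      have hex : (∃ t < k + 1, (fibre n c t).card = z) ↔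
          z = (fibre n c k).card ∨ ∃ t < k, (fibre n c t).card = z := by
        constructor
        · rintro ⟨t, ht, h⟩
          rcases Nat.lt_succ_iff_lt_or_eq.1 ht with h1 | rfl
          · exact Or.inr ⟨t, h1, h⟩
          · exact Or.inl h.symm
        · rintro (h | ⟨t, ht, h⟩)
          · exact ⟨k, by omega, h.symm⟩
          · exact ⟨t, by omega, h⟩
      rw [hex]
      by_cases hzk : z = (fibre n c k).card
      · simp [Mem.run, Instr.apply, hi, e11, hm₂.1 k hk, e4, hzk]
      · simpa [Mem.run, Instr.apply, hi, e11, hm₂.1 k hk, hzk] using hI z hz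
  intro m₃ hm₃ hU₃
  refine (Det.instr _ m₃).imp le_rfl fun _ _ m₄ hm₄ _ => ?_
  subst hm₄
  have e3 : m₃.reg 3 = 0 := by rw [hU₃.reg 3 rfl, hU₂.reg 3 rfl, hU₁.reg 3 rfl, h3]
  refine ⟨fun t ht => ?_, fun z hz => ?_⟩
  · rw [← hm₂.1 t ht, ← hU₃.arr 11 rfl]
    simp [Instr.apply, Mem.arr_setArr]
  · by_cases hz0 : z = 0
    · simp [Instr.apply, e3, hz0]
    · simpa [Instr.apply, e3, hz0] using hm₃ z hz

/-- Choose one of the highest component sizes. -/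
def pickSizeProg : Prog :=
  .block [.const 25 0] ;;
  .collect 21 28 25 22 21 13 (.block [.load 22 12 21]) ;;
  .block [.copy 24 25, .const 25 0] ;;
  .collect 21 24 25 22 23 14
    (.block [.add 20 21 4, .load 23 13 21, .const 22 1] ;;
      .ite (.paramLt 24 20) .skip (.ite (.eq 20 24) .skip (.instr (.const 22 0)))) ;;
  .draw 16 25 26 14

theorem Sim.pickSizeProg {s : ℝ} {n : ℕ} {m : Mem} {K : Finset ℕ} (h3 : m.reg 3 = 0)
    (h4 : m.reg 4 = 1) (h28 : m.reg 28 = n + 1) (hK : ∀ z, z ∈ K ↔ z < n + 1 ∧ m.arr 12 z ≠ 0)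
    (hne : (highest K s).Nonempty) :
    Sim s pickSizeProg m (PMF.uniformOfFinset (highest K s) hne) (fun z m' => m'.reg 26 = z)
      (n * 23 + 50) := by
  classical
  refine (Det.seq (Det.block _ m) (B' := n * 23 + 48) fun m₁ hm₁ hU₁ => ?_).mono_time
    (by simp; omega)
  set l := ((List.range (n + 1)).filter fun z => m.arr 12 z ≠ 0) with hl
  have hlsorted : l.Pairwise (· < ·) := List.pairwise_lt_range.filter _
  have hlK : ∀ z, z ∈ K ↔ z ∈ l := fun z => by rw [hK, hl]; simp
  have hllen : l.length ≤ n + 1 := (List.length_filter_le _ _).trans (by simp)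
  refine (Det.seq (Q := fun m' => m'.reg 25 = l.length ∧ Seg (m'.arr 13) 0 l)
    (B := (n + 1) * (2 + 6) + 2) (B' := n * 15 + 38) ?_ ?_).mono_time (by omega)
  · refine (Det.collect (s := s) (L := n + 1) (b := 2) (fun z => m.arr 12 z ≠ 0) (fun z => z)
      (by rw [hU₁.reg 28 rfl, h28]) (by rw [hU₁.reg 4 rfl, h4]) (by rw [hU₁.reg 3 rfl, h3])
      ?_).imp le_rfl ?_
    · intro k hk m' hU hi
      have e12 : m'.arr 12 = m.arr 12 := by rw [hU.arr 12 rfl, hU₁.arr 12 rfl]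
      refine (Det.block _ m').imp (by simp) fun _ _ m₂ hm₂ _ => ?_
      subst hm₂
      simp [Mem.run, Instr.apply, hi, e12]
    · rintro - - m' ⟨hm', -, hm''⟩ -
      have e25 : m₁.reg 25 = 0 := by subst hm₁; simp [Mem.run, Instr.apply]
      rw [List.map_id', e25] at hm' hm''
      rw [Nat.zero_add] at hm'
      exact ⟨hm', hm''⟩
  rintro m₂ ⟨hm₂, hm₂'⟩ hU₂
  refine (Det.seq (Det.block _ m₂) (B' := n * 15 + 35) fun m₃ hm₃ hU₃ => ?_).mono_time
    (by simp; omega)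
  set P : ℕ → Prop := fun j => s * (l.length : ℝ) < ((j + 1 : ℕ) : ℝ) ∨ j + 1 = l.length with hP
  set l' := (((List.range l.length).filter P).map fun j => m₂.arr 13 j) with hl'
  have e24 : m₃.reg 24 = l.length := by subst hm₃; simp [Mem.run, Instr.apply, hm₂]
  have e25 : m₃.reg 25 = 0 := by subst hm₃; simp [Mem.run, Instr.apply]
  have e4 : m₃.reg 4 = 1 := by rw [hU₃.reg 4 rfl, hU₂.reg 4 rfl, hU₁.reg 4 rfl, h4]
  have e3 : m₃.reg 3 = 0 := by rw [hU₃.reg 3 rfl, hU₂.reg 3 rfl, hU₁.reg 3 rfl, h3]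
  have e13 : m₃.arr 13 = m₂.arr 13 := hU₃.arr 13 rfl
  have hget : ∀ j (hj : j < l.length), m₂.arr 13 j = l[j] := fun j hj => by
    have := hm₂' j hj
    rwa [Nat.zero_add] at this
  refine (Det.seq (Q := fun m' => m'.reg 25 = l'.length ∧ Seg (m'.arr 14) 0 l')
    (B := l.length * (9 + 6) + 2) (B' := 2) ?_ ?_).mono_time (by omega)
  · refine (Det.collect (s := s) (L := l.length) (b := 9) P (fun j => m₂.arr 13 j) e24 e4 e3
      ?_).imp le_rfl ?_
    · intro k hk m' hU hi
      have f4 : m'.reg 4 = 1 := by rw [hU.reg 4 rfl, e4]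
      have f24 : m'.reg 24 = l.length := by rw [hU.reg 24 rfl, e24]
      have f13 : m'.arr 13 = m₂.arr 13 := by rw [hU.arr 13 rfl, e13]
      refine (Det.seq (Det.block _ m') (B' := 5) fun m₄ hm₄ _ => ?_)
      have g20 : m₄.reg 20 = k + 1 := by subst hm₄; simp [Mem.run, Instr.apply, hi, f4]
      have g22 : m₄.reg 22 = 1 := by subst hm₄; simp [Mem.run, Instr.apply]
      have g23 : m₄.reg 23 = m₂.arr 13 k := by subst hm₄; simp [Mem.run, Instr.apply, hi, f13]
      have g24 : m₄.reg 24 = l.length := by subst hm₄; simpa [Mem.run, Instr.apply] using f24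
      refine Sim.ite (B := 4) (fun ht => ?_) fun ht => ?_
      · simp only [Test.Holds, g20, g24] at ht
        refine (Sim.skip (a := ()) (Q := fun _ m' => m' = m₄) rfl).imp (by omega)
          fun _ _ m₅ hm₅ _ => ?_
        subst hm₅
        rw [g22, g23]
        exact ⟨⟨fun _ => Or.inl ht, fun _ => one_ne_zero⟩, fun _ => rfl⟩
      · simp only [Test.Holds, g20, g24] at ht
        refine Sim.ite (B := 3) (fun ht' => ?_) fun ht' => ?_
        · simp only [Test.Holds, g20, g24] at ht'
          refine (Sim.skip (a := ()) (Q := fun _ m' => m' = m₄) rfl).imp (by omega)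
            fun _ _ m₅ hm₅ _ => ?_
          subst hm₅
          rw [g22, g23]
          exact ⟨⟨fun _ => Or.inr ht', fun _ => one_ne_zero⟩, fun _ => rfl⟩
        · simp only [Test.Holds, g20, g24] at ht'
          refine (Det.instr _ m₄).imp (by omega) fun _ _ m₅ hm₅ _ => ?_
          subst hm₅
          have hnP : ¬ P k := fun h => h.elim ht ht'
          simp [Instr.apply, hnP]
    · rintro - - m' ⟨hm', -, hm''⟩ -
      rw [e25] at hm' hm''
      rw [Nat.zero_add] at hm'
      exact ⟨hm', hm''⟩
  rintro m₄ ⟨hm₄, hm₄'⟩ hU₄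
  refine Sim.draw hm₄ hm₄' ?_ ?_ hne
  · rw [hl', List.nodup_map_iff_inj_on (List.nodup_range.filter _)]
    intro i hi j hj hij
    have hi' : i < l.length := by simpa using (List.mem_filter.1 hi).1
    have hj' : j < l.length := by simpa using (List.mem_filter.1 hj).1
    rw [hget i hi', hget j hj'] at hij
    exact (hlsorted.nodup.getElem_inj_iff).1 hij
  · intro z
    rw [mem_highest_iff hlsorted hlK, hl', List.mem_map]
    constructor
    · rintro ⟨j, hj, rfl, h⟩
      exact ⟨j, by simpa [hP, hj] using h, hget j hj⟩
    · rintro ⟨j, hj, rfl⟩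
      rw [List.mem_filter, List.mem_range, decide_eq_true_eq] at hj
      exact ⟨j, hj.1, (hget j hj.1).symm, hj.2⟩

/-- Choose the top node of one of the components of the chosen size. -/
def pickTopProg : Prog :=
  .block [.const 25 0] ;;
  .collect 21 0 25 22 21 9
    (.block [.load 20 11 21, .const 22 0] ;; .ite (.eq 20 26) (.instr (.const 22 1)) .skip) ;;
  .draw 16 25 27 9

theorem Sim.pickTopProg {s : ℝ} {n z : ℕ} {m : Mem} (h0 : m.reg 0 = n) (h3 : m.reg 3 = 0)
    (h4 : m.reg 4 = 1) (h26 : m.reg 26 = z) {S : Finset ℕ}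
    (hS : ∀ t, t ∈ S ↔ t < n ∧ m.arr 11 t = z) (hne : S.Nonempty) :
    Sim s pickTopProg m (PMF.uniformOfFinset S hne) (fun t m' => m'.reg 27 = t)
      (n * 11 + 6) := by
  classical
  refine (Det.seq (Det.block _ m) (B' := n * 11 + 4) fun m₁ hm₁ hU₁ => ?_).mono_time
    (by simp; omega)
  set l := ((List.range n).filter fun t => m.arr 11 t = z) with hl
  refine (Det.seq (Q := fun m' => m'.reg 25 = l.length ∧ Seg (m'.arr 9) 0 l)
    (B := n * (5 + 6) + 2) (B' := 2) ?_ ?_)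
  · refine (Det.collect (s := s) (L := n) (b := 5) (fun t => m.arr 11 t = z) (fun z => z)
      (by rw [hU₁.reg 0 rfl, h0]) (by rw [hU₁.reg 4 rfl, h4]) (by rw [hU₁.reg 3 rfl, h3])
      ?_).imp le_rfl ?_
    · intro k hk m' hU hi
      have e11 : m'.arr 11 = m.arr 11 := by rw [hU.arr 11 rfl, hU₁.arr 11 rfl]
      have e26 : m'.reg 26 = z := by rw [hU.reg 26 rfl, hU₁.reg 26 rfl, h26]
      refine (Det.seq (Det.block _ m') (B' := 2) fun m₂ hm₂ _ => ?_)
      have g20 : m₂.reg 20 = m.arr 11 k := by subst hm₂; simp [Mem.run, Instr.apply, hi, e11]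
      have g22 : m₂.reg 22 = 0 := by subst hm₂; simp [Mem.run, Instr.apply]
      have g26 : m₂.reg 26 = z := by subst hm₂; simpa [Mem.run, Instr.apply] using e26
      have g21 : m₂.reg 21 = k := by subst hm₂; simpa [Mem.run, Instr.apply] using hi
      refine Sim.ite (B := 1) (fun ht => ?_) fun ht => ?_
      · simp only [Test.Holds, g20, g26] at ht
        refine (Det.instr _ m₂).imp (by omega) fun _ _ m₅ hm₅ _ => ?_
        subst hm₅
        simp [Instr.apply, ht, g21]
      · simp only [Test.Holds, g20, g26] at ht
        refine (Sim.skip (a := ()) (Q := fun _ m' => m' = m₂) rfl).imp (by omega)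
          fun _ _ m₅ hm₅ _ => ?_
        subst hm₅
        simp [g22, ht]
    · rintro - - m' ⟨hm', -, hm''⟩ -
      subst hm₁
      simpa [Mem.run, Instr.apply, ← hl] using And.intro hm' hm''
  rintro m₂ ⟨hm₂, hm₂'⟩ hU₂
  exact Sim.draw hm₂ hm₂' (List.nodup_range.filter _) (fun t => by rw [hS, hl]; simp) hne

/-! ### Generating the subtrees -/

/-- Append the nodes of the chosen component to array `3`. -/
def writeProg : Prog :=
  .block [.copy 25 13] ;;
  .collect 21 0 25 22 21 3
    (.block [.add 20 12 21, .load 20 10 20, .const 22 0] ;;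
      .ite (.eq 20 27) (.instr (.const 22 1)) .skip) ;;
  .block [.copy 13 25, .add 20 11 4, .store 2 20 13, .store 15 11 27, .store 16 11 12,
    .add 12 12 0]

/-- The nodes that `c` maps to `t`, in increasing order. -/
def fibreList (n : ℕ) (c : ℕ → ℕ) (t : ℕ) : List ℕ := (List.range n).filter fun x => c x = t

/-- What is stored for one subtree: started in memory `m`, the program ends in memory `m'`. -/
structure Written (n : ℕ) (c : ℕ → ℕ) (t : ℕ) (m m' : Mem) : Prop where
  next_base : m'.reg 12 = m.reg 12 + n
  next_ptr : m'.reg 13 = m.reg 13 + (fibreList n c t).length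
  comp : ∀ x < n, m'.arr 10 (m.reg 12 + x) = c x
  comp_old : ∀ j < m.reg 12, m'.arr 10 j = m.arr 10 j
  list : Seg (m'.arr 3) (m.reg 13) (fibreList n c t)
  list_old : ∀ j < m.reg 13, m'.arr 3 j = m.arr 3 j
  ptr : ∀ j, m'.arr 2 j = if j = m.reg 11 + 1 then m'.reg 13 else m.arr 2 j
  top : ∀ j, m'.arr 15 j = if j = m.reg 11 then t else m.arr 15 j
  base : ∀ j, m'.arr 16 j = if j = m.reg 11 then m.reg 12 else m.arr 16 j

theorem Det.writeProg {s : ℝ} {n t : ℕ} {m : Mem} {c : ℕ → ℕ} (h0 : m.reg 0 = n) (h3 : m.reg 3 = 0)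
    (h4 : m.reg 4 = 1) (h27 : m.reg 27 = t) (hc : ∀ x < n, m.arr 10 (m.reg 12 + x) = c x) :
    Det s writeProg m (Written n c t m) (n * 12 + 11) := by
  refine (Det.seq (Det.block _ m) (B' := n * 12 + 9) fun m₁ hm₁ hU₁ => ?_).mono_time
    (by simp; omega)
  have e25 : m₁.reg 25 = m.reg 13 := by subst hm₁; simp [Mem.run, Instr.apply]
  refine (Det.seq (Q := fun m' => m'.reg 25 = m.reg 13 + (fibreList n c t).length ∧
    (∀ j < m.reg 13, m'.arr 3 j = m.arr 3 j) ∧ Seg (m'.arr 3) (m.reg 13) (fibreList n c t))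
    (B := n * (6 + 6) + 2) (B' := 7) ?_ ?_)
  · refine (Det.collect (s := s) (L := n) (b := 6) (fun x => c x = t) (fun z => z)
      (by rw [hU₁.reg 0 rfl, h0]) (by rw [hU₁.reg 4 rfl, h4]) (by rw [hU₁.reg 3 rfl, h3])
      ?_).imp le_rfl ?_
    · intro k hk m' hU hi
      have e10 : m'.arr 10 = m.arr 10 := by rw [hU.arr 10 rfl, hU₁.arr 10 rfl]
      have e12 : m'.reg 12 = m.reg 12 := by rw [hU.reg 12 rfl, hU₁.reg 12 rfl]
      have e27 : m'.reg 27 = t := by rw [hU.reg 27 rfl, hU₁.reg 27 rfl, h27]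
      refine (Det.seq (Det.block _ m') (B' := 2) fun m₂ hm₂ _ => ?_)
      have g20 : m₂.reg 20 = c k := by
        subst hm₂; simp [Mem.run, Instr.apply, hi, e10, e12, hc k hk]
      have g22 : m₂.reg 22 = 0 := by subst hm₂; simp [Mem.run, Instr.apply]
      have g27 : m₂.reg 27 = t := by subst hm₂; simpa [Mem.run, Instr.apply] using e27
      have g21 : m₂.reg 21 = k := by subst hm₂; simpa [Mem.run, Instr.apply] using hi
      refine Sim.ite (B := 1) (fun ht => ?_) fun ht => ?_
      · simp only [Test.Holds, g20, g27] at ht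
        refine (Det.instr _ m₂).imp (by omega) fun _ _ m₅ hm₅ _ => ?_
        subst hm₅
        simp [Instr.apply, ht, g21]
      · simp only [Test.Holds, g20, g27] at ht
        refine (Sim.skip (a := ()) (Q := fun _ m' => m' = m₂) rfl).imp (by omega)
          fun _ _ m₅ hm₅ _ => ?_
        subst hm₅
        simp [g22, ht]
    · rintro - - m' ⟨hm', hold, hm''⟩ -
      rw [List.map_id', e25] at hm' hm''
      rw [e25] at hold
      exact ⟨hm', fun j hj => by rw [hold j hj, hU₁.arr 3 rfl], hm''⟩
  rintro m₂ ⟨hm₂, hold, hseg⟩ hU₂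
  have e0 : m₂.reg 0 = n := by rw [hU₂.reg 0 rfl, hU₁.reg 0 rfl, h0]
  have e4 : m₂.reg 4 = 1 := by rw [hU₂.reg 4 rfl, hU₁.reg 4 rfl, h4]
  have e27 : m₂.reg 27 = t := by rw [hU₂.reg 27 rfl, hU₁.reg 27 rfl, h27]
  have e11 : m₂.reg 11 = m.reg 11 := by rw [hU₂.reg 11 rfl, hU₁.reg 11 rfl]
  have e12 : m₂.reg 12 = m.reg 12 := by rw [hU₂.reg 12 rfl, hU₁.reg 12 rfl]
  have a2 : m₂.arr 2 = m.arr 2 := by rw [hU₂.arr 2 rfl, hU₁.arr 2 rfl]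
  have a10 : m₂.arr 10 = m.arr 10 := by rw [hU₂.arr 10 rfl, hU₁.arr 10 rfl]
  have a15 : m₂.arr 15 = m.arr 15 := by rw [hU₂.arr 15 rfl, hU₁.arr 15 rfl]
  have a16 : m₂.arr 16 = m.arr 16 := by rw [hU₂.arr 16 rfl, hU₁.arr 16 rfl]
  refine (Det.block _ m₂).imp (by simp) fun _ _ m₃ hm₃ hU₃ => ?_
  have b3 : m₃.arr 3 = m₂.arr 3 := hU₃.arr 3 rfl
  have b10 : m₃.arr 10 = m₂.arr 10 := hU₃.arr 10 rfl
  subst hm₃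
  constructor
  · simp [Mem.run, Instr.apply, e12, e0]
  · simp [Mem.run, Instr.apply, hm₂]
  · intro x hx
    rw [b10, a10, hc x hx]
  · intro j _
    rw [b10, a10]
  · rwa [b3]
  · intro j hj
    rw [b3, hold j hj]
  · intro j
    simp [Mem.run, Instr.apply, Mem.arr_setArr, e11, e4, a2]
  · intro j
    simp [Mem.run, Instr.apply, Mem.arr_setArr, e11, a15, e27]
  · intro j
    simp [Mem.run, Instr.apply, Mem.arr_setArr, e11, a16, e12]

/-- Generate one subtree. -/
def subtreeProg : Prog := cutProg ;; sizesProg ;; pickSizeProg ;; pickTopProg ;; writeProg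

theorem Sim.subtreeProg {s : ℝ} {n : ℕ} [NeZero n] {m : Mem} {a b : ℕ → ℕ} {ρ : ℕ}
    (ha : m.arr 0 = a) (hb : m.arr 1 = b) (hρ : m.reg 7 = ρ) (hT : TreeOrder n a b ρ)
    (T : LabelledTree n) (hE : IsEdgeList n a b T.1) (f : Set.Icc (0 : ℚ) 1)
    (h0 : m.reg 0 = n) (h3 : m.reg 3 = 0) (h4 : m.reg 4 = 1) (h5 : m.reg 5 = n - 1)
    (h6 : m.reg 6 = ⌊((n : ℚ) - 1) * f.1⌋₊) (h28 : m.reg 28 = n + 1) :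
    Sim s subtreeProg m (prunedSubtree T f s)
      (fun A m' => ∃ c t, CutMap n a b ρ c ∧ t < n ∧ c t = t ∧ A = fibre n c t ∧ Written n c t m m')
      (n * 80 + 86) := by
  classical
  have hedge : T.1.edgeFinset = (Finset.range (n - 1)).image (edgeAt n a b) := by
    ext e
    rw [SimpleGraph.mem_edgeFinset, hE.mem_edgeSet hT]
    simp
  have hcard : T.1.edgeFinset.card = n - 1 := by
    have := T.2.card_edgeFinset
    rw [Fintype.card_fin] at this
    omega
  have hn : 0 < n := Nat.pos_of_ne_zero (NeZero.ne n)
  have hd : m.reg 6 ≤ n - 1 := by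
    obtain ⟨D, hD⟩ := deletionSets_nonempty T f
    rw [deletionSets, Finset.mem_powersetCard] at hD
    have h1 := Finset.card_le_card hD.1
    have h2 := hD.2
    rw [← h6] at h2
    omega
  have hlaw : PMF.uniformOfFinset (deletionSets T f) (deletionSets_nonempty T f) =
      uniformSubset ((Finset.range (n - 1)).image (edgeAt n a b)) (m.reg 6) := by
    rw [uniformSubset_of_le (by rw [← hedge, hcard]; exact hd)]
    congr 1
    rw [deletionSets, ← h6, ← hedge]
  rw [prunedSubtree, hlaw]
  refine (Sim.seq (Sim.cutProg ha hb hρ hT h5 h4 hd) (B' := n * 64 + 79) ?_).mono_time (by omega)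
  rintro D - m₁ ⟨hc, hold₁⟩ hU₁
  set c : ℕ → ℕ := fun x => m₁.arr 10 (m.reg 12 + x) with hcdef
  set H := T.1.deleteEdges (D : Set (Sym2 (Fin n))) with hH
  have hclt := hc.cutMap.lt hT
  have i0 : m₁.reg 0 = n := by rw [hU₁.reg 0 rfl, h0]
  have i3 : m₁.reg 3 = 0 := by rw [hU₁.reg 3 rfl, h3]
  have i4 : m₁.reg 4 = 1 := by rw [hU₁.reg 4 rfl, h4]
  have i12 : m₁.reg 12 = m.reg 12 := hU₁.reg 12 rfl
  have i28 : m₁.reg 28 = n + 1 := by rw [hU₁.reg 28 rfl, h28]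
  refine (Det.seq (Det.sizesProg (c := c) i0 i3 i4 i28 (fun x hx => by rw [i12]))
    (B' := n * 46 + 67) ?_).mono_time (by omega)
  rintro m₂ ⟨hsize, hmark⟩ hU₂
  rw [PMF.bindOnSupport_eq_bind_of_forall (fun z => if h : (componentsOfSize H z).Nonempty then
    PMF.uniformOfFinset (componentsOfSize H z) h else PMF.pure ∅) fun z hz => by
      rw [dif_pos (componentsOfSize_nonempty ((PMF.mem_support_uniformOfFinset_iff _ z).1 hz))]]
  have hfle : ∀ t, (fibre n c t).card < n + 1 := fun t =>
    Nat.lt_succ_of_le ((Finset.card_le_univ _).trans (by simp))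
  refine (Sim.seq (Sim.pickSizeProg (n := n) (by rw [hU₂.reg 3 rfl, i3]) (by rw [hU₂.reg 4 rfl, i4])
    (by rw [hU₂.reg 28 rfl, i28]) (K := componentSizes H) (fun z => ?_) _) (B' := n * 23 + 17)
    ?_).mono_time (by omega)
  · rw [hc.mem_componentSizes hT hE]
    constructor
    · rintro ⟨hz, t, ht, rfl⟩
      exact ⟨hfle t, (hmark _ (hfle t)).2 ⟨hz, t, ht, rfl⟩⟩
    · rintro ⟨hz, h⟩
      exact (hmark z hz).1 h
  intro z hz m₃ hm₃ hU₃
  rw [PMF.mem_support_uniformOfFinset_iff] at hz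
  have hne := componentsOfSize_nonempty hz
  have hz0 : z ≠ 0 := ((hc.mem_componentSizes hT hE z).1 (Finset.mem_filter.1 hz).1).1
  rw [dif_pos hne]
  set S := (Finset.range n).filter fun t => (fibre n c t).card = z with hS
  have hSne : S.Nonempty := by
    obtain ⟨A, hA⟩ := hne
    obtain ⟨t, ht, h1, -⟩ := (hc.mem_componentsOfSize hT hE hz0 A).1 hA
    exact ⟨t, by simp [hS, ht, h1]⟩
  rw [← PMF.map_uniformOfFinset hSne hne (fibre n c) (fun t ht => ?_) (fun t ht t' _ h => ?_)
    (fun A hA => ?_)]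
  rotate_left
  · rw [hS, Finset.mem_filter, Finset.mem_range] at ht
    exact (hc.mem_componentsOfSize hT hE hz0 _).2 ⟨t, ht.1, ht.2, rfl⟩
  · rw [Finset.mem_coe, hS, Finset.mem_filter] at ht
    exact fibre_inj (Finset.card_pos.1 (by omega)) h
  · obtain ⟨t, ht, h1, rfl⟩ := (hc.mem_componentsOfSize hT hE hz0 A).1 hA
    exact ⟨t, by simp [hS, ht, h1], rfl⟩
  have k0 : m₃.reg 0 = n := by rw [hU₃.reg 0 rfl, hU₂.reg 0 rfl, i0]
  have k3 : m₃.reg 3 = 0 := by rw [hU₃.reg 3 rfl, hU₂.reg 3 rfl, i3]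
  have k4 : m₃.reg 4 = 1 := by rw [hU₃.reg 4 rfl, hU₂.reg 4 rfl, i4]
  have k11 : m₃.arr 11 = m₂.arr 11 := hU₃.arr 11 rfl
  refine (Sim.seq_det (R := fun t m' => ∃ c t', CutMap n a b ρ c ∧ t' < n ∧ c t' = t' ∧
    fibre n c t = fibre n c t' ∧ t = t' ∧ (∀ x < n, m₁.arr 10 (m.reg 12 + x) = c x) ∧
    Written n c t' m m')
    (Sim.pickTopProg k0 k3 k4 hm₃ (S := S) (fun t => ?_) hSne) (B' := n * 12 + 11) ?_).map
    (fibre n c) (R := fun A m' => ∃ c t, CutMap n a b ρ c ∧ t < n ∧ c t = t ∧ A = fibre n c t ∧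
      Written n c t m m') ?_ |>.mono_time (by omega)
  · rw [hS, Finset.mem_filter, Finset.mem_range, k11]
    exact and_congr_right fun ht => by rw [hsize t ht]
  · intro t ht m₄ hm₄ hU₄
    rw [PMF.mem_support_uniformOfFinset_iff, hS, Finset.mem_filter, Finset.mem_range] at ht
    have htt : c t = t := by
      obtain ⟨y, hy⟩ := Finset.card_pos.1 (show 0 < (fibre n c t).card by omega)
      rw [mem_fibre] at hy
      rw [← hy]
      exact hc.cutMap.idem hT y y.isLt
    have l12 : m₄.reg 12 = m.reg 12 := by
      rw [hU₄.reg 12 rfl, hU₃.reg 12 rfl, hU₂.reg 12 rfl, i12]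
    have l10 : m₄.arr 10 = m₁.arr 10 := by
      rw [hU₄.arr 10 rfl, hU₃.arr 10 rfl, hU₂.arr 10 rfl]
    have lreg : ∀ x, x = 11 ∨ x = 13 → m₄.reg x = m.reg x := by
      rintro x (rfl | rfl)
      · rw [hU₄.reg 11 rfl, hU₃.reg 11 rfl, hU₂.reg 11 rfl, hU₁.reg 11 rfl]
      · rw [hU₄.reg 13 rfl, hU₃.reg 13 rfl, hU₂.reg 13 rfl, hU₁.reg 13 rfl]
    have larr : ∀ x, x = 2 ∨ x = 3 ∨ x = 15 ∨ x = 16 → m₄.arr x = m.arr x := by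
      rintro x (rfl | rfl | rfl | rfl)
      · rw [hU₄.arr 2 rfl, hU₃.arr 2 rfl, hU₂.arr 2 rfl, hU₁.arr 2 rfl]
      · rw [hU₄.arr 3 rfl, hU₃.arr 3 rfl, hU₂.arr 3 rfl, hU₁.arr 3 rfl]
      · rw [hU₄.arr 15 rfl, hU₃.arr 15 rfl, hU₂.arr 15 rfl, hU₁.arr 15 rfl]
      · rw [hU₄.arr 16 rfl, hU₃.arr 16 rfl, hU₂.arr 16 rfl, hU₁.arr 16 rfl]
    refine (Det.writeProg (c := c) (by rw [hU₄.reg 0 rfl, k0]) (by rw [hU₄.reg 3 rfl, k3])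
      (by rw [hU₄.reg 4 rfl, k4]) hm₄ (fun x hx => by rw [l10, l12])).imp le_rfl
      fun _ _ m₅ hW _ => ⟨c, t, hc.cutMap, ht.1, htt, rfl, rfl, fun x _ => rfl, ?_⟩
    obtain ⟨w1, w2, w3, w4, w5, w6, w7, w8, w9⟩ := hW
    rw [l12] at w1 w3 w4 w9
    rw [lreg 13 (by simp)] at w2 w5 w6
    rw [lreg 11 (by simp)] at w7 w8 w9
    rw [larr 3 (by simp)] at w6
    rw [larr 2 (by simp)] at w7
    rw [larr 15 (by simp)] at w8
    rw [larr 16 (by simp)] at w9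
    exact ⟨w1, w2, w3, fun j hj => by rw [w4 j hj, l10, hold₁ j hj], w5, w6, w7, w8, w9⟩
  · rintro t - m₅ ⟨c', t', h1, h2, h3, -, rfl, h5, h6⟩ -
    refine ⟨c', t, h1, h2, h3, ?_, h6⟩
    ext x
    rw [mem_fibre, mem_fibre, ← h5 x x.isLt]

/-! ### Generating all subtrees -/

theorem storesLists_of_seg {n : ℕ} {m : Mem} {a b : ℕ} {F : Fin n → Set (Fin n)}
    (h : ∀ i : Fin n, ∃ l : List ℕ, l.Nodup ∧ (∀ x, x ∈ l ↔ x ∈ Fin.val '' F i) ∧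
      m.arr a (i.val + 1) = m.arr a i.val + l.length ∧ Seg (m.arr b) (m.arr a i.val) l) :
    StoresLists m a b F := by
  intro i
  obtain ⟨l, hnd, hmem, hlen, hseg⟩ := h i
  have hget : ∀ p ∈ Set.Ico (m.arr a i.val) (m.arr a (i.val + 1)), ∃ j, ∃ hj : j < l.length,
      p = m.arr a i.val + j ∧ m.arr b p = l[j] := by
    rintro p ⟨hp, hp'⟩
    refine ⟨p - m.arr a i.val, by omega, by omega, ?_⟩
    rw [← hseg]
    congr 1
    omega
  refine ⟨by omega, ?_, ?_⟩
  · intro p hp q hq hpq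
    obtain ⟨j, hj, rfl, h1⟩ := hget p hp
    obtain ⟨j', hj', rfl, h2⟩ := hget q hq
    rw [h1, h2] at hpq
    rw [(hnd.getElem_inj_iff).1 hpq]
  · ext x
    rw [← hmem]
    constructor
    · rintro ⟨p, hp, rfl⟩
      obtain ⟨j, hj, rfl, h1⟩ := hget p hp
      rw [h1]
      exact List.getElem_mem hj
    · intro hx
      obtain ⟨j, hj, rfl⟩ := List.getElem_of_mem hx
      exact ⟨m.arr a i.val + j, ⟨by omega, by omega⟩, hseg j hj⟩

/-- The `j`-th subtree has node set `A`, and is stored in memory `m`. -/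
def SubtreeAt (n : ℕ) (a b : ℕ → ℕ) (ρ : ℕ) (m : Mem) (j : ℕ) (A : Finset (Fin n)) : Prop :=
  ∃ c t, CutMap n a b ρ c ∧ t < n ∧ c t = t ∧ A = fibre n c t ∧
    (∀ x < n, m.arr 10 (j * n + x) = c x) ∧
    m.arr 2 (j + 1) = m.arr 2 j + (fibreList n c t).length ∧
    Seg (m.arr 3) (m.arr 2 j) (fibreList n c t) ∧ m.arr 15 j = t ∧ m.arr 16 j = j * n

theorem SubtreeAt.written {n : ℕ} {a b : ℕ → ℕ} {ρ : ℕ} {m m' : Mem} {j k t : ℕ} {c : ℕ → ℕ}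
    {A : Finset (Fin n)} (h : SubtreeAt n a b ρ m j A) (hW : Written n c t m m') (hj : j < k)
    (h11 : m.reg 11 = k) (h12 : m.reg 12 = k * n) (h13 : m.arr 2 (j + 1) ≤ m.reg 13) :
    SubtreeAt n a b ρ m' j A := by
  obtain ⟨c', t', h1, h2, h3, h4, h5, h6, h7, h8, h9⟩ := h
  refine ⟨c', t', h1, h2, h3, h4, fun x hx => ?_, ?_, fun i hi => ?_, ?_, ?_⟩
  · rw [hW.comp_old, h5 x hx]
    rw [h12]
    calc j * n + x < j * n + n := by omega
      _ = (j + 1) * n := by rw [Nat.succ_mul]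
      _ ≤ k * n := Nat.mul_le_mul_right n hj
  · rw [hW.ptr, hW.ptr, if_neg (by omega), if_neg (by omega), h6]
  · have e : m'.arr 2 j = m.arr 2 j := by rw [hW.ptr, if_neg (by omega)]
    rw [e, hW.list_old _ (by omega)]
    exact h7 i hi
  · rw [hW.top, if_neg (by omega), h8]
  · rw [hW.base, if_neg (by omega), h9]

theorem SubtreeAt.written_self {n : ℕ} {a b : ℕ → ℕ} {ρ : ℕ} {m m' : Mem} {k t : ℕ} {c : ℕ → ℕ}
    (hc : CutMap n a b ρ c) (ht : t < n) (hct : c t = t) (hW : Written n c t m m')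
    (h11 : m.reg 11 = k) (h12 : m.reg 12 = k * n) (h13 : m.reg 13 = m.arr 2 k) :
    SubtreeAt n a b ρ m' k (fibre n c t) := by
  have e : m'.arr 2 k = m.reg 13 := by rw [hW.ptr, if_neg (by omega), h13]
  refine ⟨c, t, hc, ht, hct, rfl, fun x hx => ?_, ?_, ?_, ?_, ?_⟩
  · rw [← h12, hW.comp x hx]
  · rw [e, ← hW.next_ptr, hW.ptr, if_pos (by omega)]
  · rw [e]; exact hW.list
  · rw [hW.top, if_pos h11.symm]
  · rw [hW.base, if_pos h11.symm, h12]

/-- Generate `n` subtrees. -/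
def subtreesProg : Prog :=
  .block [.const 12 0, .const 13 0, .store 2 3 3] ;; .for 11 0 subtreeProg

theorem Sim.subtreesProg {s : ℝ} {n : ℕ} [NeZero n] {m : Mem} {a b : ℕ → ℕ} {ρ : ℕ}
    (ha : m.arr 0 = a) (hb : m.arr 1 = b) (hρ : m.reg 7 = ρ) (hT : TreeOrder n a b ρ)
    (T : LabelledTree n) (hE : IsEdgeList n a b T.1) (f : Set.Icc (0 : ℚ) 1)
    (h0 : m.reg 0 = n) (h3 : m.reg 3 = 0) (h4 : m.reg 4 = 1) (h5 : m.reg 5 = n - 1)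
    (h6 : m.reg 6 = ⌊((n : ℚ) - 1) * f.1⌋₊) (h28 : m.reg 28 = n + 1) :
    Sim s subtreesProg m (prunedTree T f s)
      (fun F m' => ∀ j : Fin n, SubtreeAt n a b ρ m' j (F j)) (n * (n * 80 + 86 + 2) + 6) := by
  refine (Det.seq (Det.block _ m) (B' := n * (n * 80 + 86 + 2) + 2) fun m₁ hm₁ hU₁ => ?_).mono_time
    (by simp; omega)
  obtain ⟨W, hW1, hW2, hW3⟩ := exists_tail_kernel (A := fun k => Fin k → Finset (Fin n))
    (fun k => iidSamples (prunedSubtree T f s) k)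
    (fun k v => (prunedSubtree T f s).map fun A => Fin.snoc v A) (fun k => rfl) n
  have hlaw : prunedTree T f s = W 0 Fin.elim0 := by
    rw [prunedTree, ← hW3, iidSamples, PMF.pure_bind]
  rw [hlaw]
  refine Sim.for W (fun k v m' => m'.reg 12 = k * n ∧ m'.reg 13 = m'.arr 2 k ∧
    (∀ j ≤ k, m'.arr 2 j ≤ m'.reg 13) ∧ ∀ j : Fin k, SubtreeAt n a b ρ m' j (v j)) _
    (by rw [hU₁.reg 0 rfl, h0]) (by rw [hU₁.reg 4 rfl, h4]) (by decide) (by decide) rfl rfl rfl _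
    ?_ ?_ ?_
  · subst hm₁
    refine ⟨by simp [Mem.run, Instr.apply], by simp [Mem.run, Instr.apply, h3], fun j hj => ?_,
      fun j => j.elim0⟩
    obtain rfl : j = 0 := by omega
    simp [Mem.run, Instr.apply, h3]
  · rintro k hk v m' hU h11 ⟨i1, i2, i3, i4⟩
    refine ⟨_, hW2 k hk v, ?_⟩
    refine (Sim.subtreeProg (s := s) (m := m') (by rw [hU.arr 0 rfl, hU₁.arr 0 rfl, ha])
      (by rw [hU.arr 1 rfl, hU₁.arr 1 rfl, hb]) (by rw [hU.reg 7 rfl, hU₁.reg 7 rfl, hρ]) hT T hE f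
      (by rw [hU.reg 0 rfl, hU₁.reg 0 rfl, h0]) (by rw [hU.reg 3 rfl, hU₁.reg 3 rfl, h3])
      (by rw [hU.reg 4 rfl, hU₁.reg 4 rfl, h4]) (by rw [hU.reg 5 rfl, hU₁.reg 5 rfl, h5])
      (by rw [hU.reg 6 rfl, hU₁.reg 6 rfl, h6]) (by rw [hU.reg 28 rfl, hU₁.reg 28 rfl, h28])).map _
      ?_
    rintro A - m'' ⟨c, t, h1, h2, h3', rfl, hWr⟩ -
    have e : m''.arr 2 (k + 1) = m''.reg 13 := by rw [hWr.ptr, if_pos (by omega)]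
    refine ⟨?_, ?_, ?_, ?_⟩
    · simp [hWr.next_base, i1, Nat.succ_mul]
    · simp [e]
    · intro j hj
      simp only [Mem.reg_setReg, Mem.arr_setReg, hWr.ptr j, h11,
        if_neg (show (13 : ℕ) ≠ 11 by decide)]
      split_ifs with h
      · exact le_rfl
      · rw [hWr.next_ptr]
        have := i3 j (by omega)
        omega
    · intro j
      refine Fin.lastCases ?_ (fun j => ?_) j
      · rw [Fin.snoc_last, Fin.val_last]
        show SubtreeAt n a b ρ m'' _ _
        exact SubtreeAt.written_self h1 h2 h3' hWr h11 i1 i2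
      · rw [Fin.snoc_castSucc, Fin.val_castSucc]
        show SubtreeAt n a b ρ m'' _ _
        exact (i4 j).written hWr j.isLt h11 i1 (i3 _ j.isLt)
  · rintro v m' hU ⟨-, -, -, i4⟩
    exact ⟨v, hW1 v, i4⟩

/-! ### The intersection graph -/

/-- Append the vertices whose subtrees meet the `i`-th subtree to array `5`, for all `i`. -/
def graphProg : Prog :=
  .block [.const 13 0, .store 4 3 3] ;;
  .for 11 0 (
    .block [.load 27 15 11, .load 12 16 11, .copy 25 13] ;;
    .collect 21 0 25 22 21 5
      (.block [.load 17 15 21, .load 18 16 21, .add 19 12 17, .load 19 10 19, .add 20 18 27,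
        .load 20 10 20, .const 22 1] ;;
      .ite (.eq 21 11) (.instr (.const 22 0))
        (.ite (.eq 19 27) .skip (.ite (.eq 20 17) .skip (.instr (.const 22 0))))) ;;
    .block [.copy 13 25, .add 20 11 4, .store 4 20 13])

/-- The neighbours of `i`, computed from the maps `c j` to top nodes and from the top nodes `t j`
of the subtrees. -/
def nbrList (n : ℕ) (c : ℕ → ℕ → ℕ) (t : ℕ → ℕ) (i : ℕ) : List ℕ :=
  (List.range n).filter fun j => j ≠ i ∧ (c i (t j) = t i ∨ c j (t i) = t j)

theorem Det.graphProg {s : ℝ} {n : ℕ} {m : Mem} {c : ℕ → ℕ → ℕ} {t : ℕ → ℕ} (h0 : m.reg 0 = n)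
    (h3 : m.reg 3 = 0) (h4 : m.reg 4 = 1) (ht : m.arr 15 = t)
    (hc : ∀ i j, m.arr 10 (m.arr 16 i + j) = c i j) :
    Det s graphProg m (fun m' => ∀ j < n, m'.arr 4 (j + 1) = m'.arr 4 j + (nbrList n c t j).length ∧
      Seg (m'.arr 5) (m'.arr 4 j) (nbrList n c t j)) (n * (n * 19 + 10 + 2) + 5) := by
  refine (Det.seq (Det.block _ m) (B' := n * (n * 19 + 10 + 2) + 2) fun m₁ hm₁ hU₁ => ?_).mono_time
    (by simp; omega)
  refine (Det.for (fun k m' => m'.reg 13 = m'.arr 4 k ∧ (∀ j ≤ k, m'.arr 4 j ≤ m'.reg 13) ∧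
    ∀ j < k, m'.arr 4 (j + 1) = m'.arr 4 j + (nbrList n c t j).length ∧
      Seg (m'.arr 5) (m'.arr 4 j) (nbrList n c t j)) (L := n) (by rw [hU₁.reg 0 rfl, h0])
      (by rw [hU₁.reg 4 rfl, h4]) ?_ ?_).imp le_rfl fun _ _ m' h _ => h.2.2
  · subst hm₁
    refine ⟨by simp [Mem.run, Instr.apply, h3], fun j hj => ?_, by simp⟩
    obtain rfl : j = 0 := by omega
    simp [Mem.run, Instr.apply, h3]
  · rintro k hk m' hU h11 ⟨i1, i2, i3⟩
    have e0 : m'.reg 0 = n := by rw [hU.reg 0 rfl, hU₁.reg 0 rfl, h0]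
    have e3 : m'.reg 3 = 0 := by rw [hU.reg 3 rfl, hU₁.reg 3 rfl, h3]
    have e4 : m'.reg 4 = 1 := by rw [hU.reg 4 rfl, hU₁.reg 4 rfl, h4]
    have a10 : m'.arr 10 = m.arr 10 := by rw [hU.arr 10 rfl, hU₁.arr 10 rfl]
    have a15 : m'.arr 15 = t := by rw [hU.arr 15 rfl, hU₁.arr 15 rfl, ht]
    have a16 : m'.arr 16 = m.arr 16 := by rw [hU.arr 16 rfl, hU₁.arr 16 rfl]
    refine (Det.seq (Det.block _ m') (B' := n * 19 + 6) fun m₂ hm₂ hU₂ => ?_).mono_time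
      (by simp; omega)
    have r27 : m₂.reg 27 = t k := by subst hm₂; simp [Mem.run, Instr.apply, h11, a15]
    have r12 : m₂.reg 12 = m.arr 16 k := by subst hm₂; simp [Mem.run, Instr.apply, h11, a16]
    have r25 : m₂.reg 25 = m'.reg 13 := by subst hm₂; simp [Mem.run, Instr.apply]
    have r11 : m₂.reg 11 = k := by rw [hU₂.reg 11 rfl, h11]
    refine (Det.seq (Q := fun m₃ => m₃.reg 25 = m'.reg 13 + (nbrList n c t k).length ∧
      (∀ j < m'.reg 13, m₃.arr 5 j = m'.arr 5 j) ∧ Seg (m₃.arr 5) (m'.reg 13) (nbrList n c t k))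
      (B := n * (13 + 6) + 2) (B' := 4) ?_ ?_)
    · refine (Det.collect (s := s) (L := n) (b := 13)
        (fun j => j ≠ k ∧ (c k (t j) = t k ∨ c j (t k) = t j)) (fun z => z)
        (by rw [hU₂.reg 0 rfl, e0]) (by rw [hU₂.reg 4 rfl, e4]) (by rw [hU₂.reg 3 rfl, e3])
        ?_).imp le_rfl ?_
      · intro j hj m₃ hU₃ h21
        have b10 : m₃.arr 10 = m.arr 10 := by rw [hU₃.arr 10 rfl, hU₂.arr 10 rfl, a10]
        have b15 : m₃.arr 15 = t := by rw [hU₃.arr 15 rfl, hU₂.arr 15 rfl, a15]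
        have b16 : m₃.arr 16 = m.arr 16 := by rw [hU₃.arr 16 rfl, hU₂.arr 16 rfl, a16]
        have b12 : m₃.reg 12 = m.arr 16 k := by rw [hU₃.reg 12 rfl, r12]
        have b27 : m₃.reg 27 = t k := by rw [hU₃.reg 27 rfl, r27]
        have b11 : m₃.reg 11 = k := by rw [hU₃.reg 11 rfl, r11]
        refine (Det.seq (Det.block _ m₃) (B' := 5) fun m₄ hm₄ hU₄ => ?_)
        have g17 : m₄.reg 17 = t j := by subst hm₄; simp [Mem.run, Instr.apply, h21, b15]
        have g19 : m₄.reg 19 = c k (t j) := by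
          subst hm₄; simp [Mem.run, Instr.apply, h21, b15, b12, b10, hc]
        have g20 : m₄.reg 20 = c j (t k) := by
          subst hm₄; simp [Mem.run, Instr.apply, h21, b16, b27, b10, hc]
        have g22 : m₄.reg 22 = 1 := by subst hm₄; simp [Mem.run, Instr.apply]
        have g27 : m₄.reg 27 = t k := by rw [hU₄.reg 27 rfl, b27]
        have g21 : m₄.reg 21 = j := by rw [hU₄.reg 21 rfl, h21]
        have g11 : m₄.reg 11 = k := by rw [hU₄.reg 11 rfl, b11]
        refine Sim.ite (B := 4) (fun ht => ?_) fun ht => ?_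
        · simp only [Test.Holds, g21, g11] at ht
          refine (Det.instr _ m₄).imp (by omega) fun _ _ m₅ hm₅ _ => ?_
          subst hm₅
          simp [Instr.apply, ht]
        simp only [Test.Holds, g21, g11] at ht
        refine Sim.ite (B := 3) (fun ht₂ => ?_) fun ht₂ => ?_
        · simp only [Test.Holds, g19, g27] at ht₂
          refine (Sim.skip (a := ()) (Q := fun _ m' => m' = m₄) rfl).imp (by omega)
            fun _ _ m₅ hm₅ _ => ?_
          subst hm₅
          simp [g22, g21, ht, ht₂]
        simp only [Test.Holds, g19, g27] at ht₂
        refine Sim.ite (B := 2) (fun ht₃ => ?_) fun ht₃ => ?_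
        · simp only [Test.Holds, g20, g17] at ht₃
          refine (Sim.skip (a := ()) (Q := fun _ m' => m' = m₄) rfl).imp (by omega)
            fun _ _ m₅ hm₅ _ => ?_
          subst hm₅
          simp [g22, g21, ht, ht₃]
        · simp only [Test.Holds, g20, g17] at ht₃
          refine (Det.instr _ m₄).imp (by omega) fun _ _ m₅ hm₅ _ => ?_
          subst hm₅
          simp [Instr.apply, ht₂, ht₃]
      · rintro - - m₃ ⟨hm', hold, hm''⟩ -
        rw [List.map_id', r25] at hm' hm''
        rw [r25] at hold
        exact ⟨hm', fun j hj => by rw [hold j hj, hU₂.arr 5 rfl], hm''⟩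
    rintro m₃ ⟨hm₃, hold, hseg⟩ hU₃
    have f4 : m₃.reg 4 = 1 := by rw [hU₃.reg 4 rfl, hU₂.reg 4 rfl, e4]
    have f11 : m₃.reg 11 = k := by rw [hU₃.reg 11 rfl, r11]
    have b4 : m₃.arr 4 = m'.arr 4 := by rw [hU₃.arr 4 rfl, hU₂.arr 4 rfl]
    refine (Det.block _ m₃).imp (by simp) fun _ _ m₄ hm₄ hU₄ => ?_
    have c5 : m₄.arr 5 = m₃.arr 5 := hU₄.arr 5 rfl
    have c13 : m₄.reg 13 = m'.reg 13 + (nbrList n c t k).length := by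
      subst hm₄; simp [Mem.run, Instr.apply, hm₃]
    have c4 : ∀ j, m₄.arr 4 j = if j = k + 1 then m'.reg 13 + (nbrList n c t k).length
        else m'.arr 4 j := by
      intro j; subst hm₄; simp [Mem.run, Instr.apply, hm₃, f4, f11, b4]
    simp only [Mem.reg_setReg, Mem.arr_setReg, if_neg (show (13 : ℕ) ≠ 11 by decide), c13, c5]
    refine ⟨by rw [c4, if_pos rfl], fun j hj => ?_, fun j hj => ?_⟩
    · rw [c4]
      split_ifs with h
      · exact le_rfl
      · have := i2 j (by omega)
        omega
    · rcases Nat.lt_succ_iff_lt_or_eq.1 hj with h | rfl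
      · rw [c4, c4, if_neg (by omega), if_neg (by omega)]
        refine ⟨(i3 j h).1, fun i hi => ?_⟩
        have h1 := (i3 j h).1
        have h2 := i2 (j + 1) (by omega)
        rw [hold _ (by omega)]
        exact (i3 j h).2 i hi
      · rw [c4, c4, if_pos rfl, if_neg (by omega), ← i1]
        exact ⟨rfl, hseg⟩

/-- Generate the subtrees and their intersection graph. -/
def tailProg : Prog := subtreesProg ;; graphProg

theorem mem_image_val {n : ℕ} {S : Set (Fin n)} {x : ℕ} :
    x ∈ Fin.val '' S ↔ ∃ h : x < n, (⟨x, h⟩ : Fin n) ∈ S := by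
  constructor
  · rintro ⟨y, hy, rfl⟩
    exact ⟨y.isLt, hy⟩
  · rintro ⟨h, h'⟩
    exact ⟨_, h', rfl⟩

theorem Sim.tailProg {s : ℝ} {n : ℕ} [NeZero n] {m : Mem} {a b : ℕ → ℕ} {ρ : ℕ}
    (ha : m.arr 0 = a) (hb : m.arr 1 = b) (hρ : m.reg 7 = ρ) (hT : TreeOrder n a b ρ)
    (T : LabelledTree n) (hE : IsEdgeList n a b T.1) (f : Set.Icc (0 : ℚ) 1)
    (h0 : m.reg 0 = n) (h3 : m.reg 3 = 0) (h4 : m.reg 4 = 1) (h5 : m.reg 5 = n - 1)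
    (h6 : m.reg 6 = ⌊((n : ℚ) - 1) * f.1⌋₊) (h28 : m.reg 28 = n + 1) :
    Sim s tailProg m ((prunedTree T f s).map fun F => ⟨T.1, F, intersectionGraph F⟩)
      (fun r m' => StoresResult m' r) (n * (n * 99 + 100) + 11) := by
  refine (Sim.map (Sim.seq_det (R := fun F m' => StoresResult m' ⟨T.1, F, intersectionGraph F⟩)
    (Sim.subtreesProg ha hb hρ hT T hE f h0 h3 h4 h5 h6 h28)
    (B' := n * (n * 19 + 10 + 2) + 5) ?_) _ fun F _ m' h _ => h).mono_time (le_of_eq (by ring))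
  rintro F - m₁ hF hU₁
  choose c t hc ht hct hfib hrow hlen hseg htop hbase using hF
  refine (Det.graphProg (n := n) (c := fun i j => m₁.arr 10 (m₁.arr 16 i + j)) (t := m₁.arr 15)
    (by rw [hU₁.reg 0 rfl, h0]) (by rw [hU₁.reg 3 rfl, h3]) (by rw [hU₁.reg 4 rfl, h4]) rfl
    (fun _ _ => rfl)).imp le_rfl fun _ _ m₂ hm₂ hU₂ => ⟨?_, ?_, ?_⟩
  · intro u v
    rw [hE]
    simp only [hU₂.arr 0 rfl, hU₂.arr 1 rfl, hU₁.arr 0 rfl, hU₁.arr 1 rfl, ha, hb]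
  · refine storesLists_of_seg fun i => ⟨fibreList n (c i) (t i), List.nodup_range.filter _,
      fun x => ?_, ?_, ?_⟩
    · rw [mem_image_val]
      simp [fibreList, hfib, mem_fibre]
    · rw [hU₂.arr 2 rfl]; exact hlen i
    · rw [hU₂.arr 2 rfl, hU₂.arr 3 rfl]; exact hseg i
  · refine storesLists_of_seg fun i => ⟨_, List.nodup_range.filter _, fun x => ?_,
      (hm₂ i i.isLt).1, (hm₂ i i.isLt).2⟩
    rw [mem_image_val, List.mem_filter, List.mem_range, decide_eq_true_eq]
    have key : ∀ j : Fin n, (i ≠ j ∧ (F i ∩ F j).Nonempty) ↔ j.val ≠ i.val ∧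
        (c i (t j) = t i ∨ c j (t i) = t j) := by
      intro j
      rw [← (hc i).exists_common_iff (hc j) hT (ht i) (ht j) (hct i) (hct j), hfib i, hfib j]
      refine and_congr ?_ ?_
      · rw [Ne, Ne, Fin.ext_iff, eq_comm]
      · constructor
        · rintro ⟨x, hx⟩
          rw [Finset.mem_inter, mem_fibre, mem_fibre] at hx
          exact ⟨x, x.isLt, hx⟩
        · rintro ⟨x, hx, h⟩
          exact ⟨⟨x, hx⟩, by rw [Finset.mem_inter, mem_fibre, mem_fibre]; exact h⟩
    have hrow' : ∀ i j : Fin n, m₁.arr 10 (m₁.arr 16 i + m₁.arr 15 j) = c i (t j) := fun i j => by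
      rw [hbase, htop, hrow i _ (ht j)]
    rw [← exists_prop]
    refine exists_congr fun hx => ?_
    have := key ⟨x, hx⟩
    have e1 := hrow' i ⟨x, hx⟩
    have e2 := hrow' ⟨x, hx⟩ i
    simp only at e1 e2
    have e3 := htop ⟨x, hx⟩
    simp only at e3
    beta_reduce
    rw [e1, e2, htop i, e3]
    exact this.symm

/-! ### Initialisation -/

theorem floor_sub_one_mul {n : ℕ} (hn : 0 < n) (f : Set.Icc (0 : ℚ) 1) :
    ⌊((n : ℚ) - 1) * f.1⌋₊ = (n - 1) * f.1.num.toNat / f.1.den := by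
  have h0 : ((f.1.num.toNat : ℕ) : ℚ) = (f.1.num : ℚ) := by
    have : ((f.1.num.toNat : ℕ) : ℤ) = f.1.num := Int.toNat_of_nonneg (Rat.num_nonneg.2 f.2.1)
    exact_mod_cast this
  rw [← Nat.floor_div_eq_div (K := ℚ)]
  congr 1
  rw [Nat.cast_mul, h0, Nat.cast_sub hn, Nat.cast_one, mul_div_assoc, Rat.num_div_den]

/-- Compute the constants and the number of edges to delete. -/
def setupProg : Prog :=
  .block [.const 3 0, .const 4 1, .sub 5 0 4, .add 28 0 4, .const 8 0, .const 6 0] ;;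
  .for 21 5 (.block [.add 8 8 1]) ;;
  .while (.le 2 8) (.block [.sub 8 8 2, .add 6 6 4])

theorem Det.setupProg {s : ℝ} {n : ℕ} (hn : 0 < n) (f : Set.Icc (0 : ℚ) 1) :
    Det s setupProg (inputMem n f.1) (fun m' => m'.reg 0 = n ∧ m'.reg 3 = 0 ∧ m'.reg 4 = 1 ∧
      m'.reg 5 = n - 1 ∧ m'.reg 28 = n + 1 ∧ m'.reg 6 = ⌊((n : ℚ) - 1) * f.1⌋₊) (n * 8 + 10) := by
  set p := f.1.num.toNat with hp
  set q := f.1.den with hq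
  have hq0 : 0 < q := f.1.den_pos
  have hpq : p ≤ q := by
    have h1 : f.1.num ≤ f.1.den := by
      have := f.2.2
      rw [← Rat.num_div_den f.1, div_le_one (by exact_mod_cast hq0)] at this
      exact_mod_cast this
    omega
  refine (Det.seq (Det.block _ _) (B' := (n - 1) * (2 + 2) + 2 + ((n - 1) * (3 + 1) + 1))
    fun m₁ hm₁ hU₁ => ?_).mono_time (by simp; omega)
  have e5 : m₁.reg 5 = n - 1 := by subst hm₁; simp [Mem.run, Instr.apply, inputMem]
  have e4 : m₁.reg 4 = 1 := by subst hm₁; simp [Mem.run, Instr.apply]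
  have e1 : m₁.reg 1 = p := by subst hm₁; simp [Mem.run, Instr.apply, inputMem, hp]
  have e2 : m₁.reg 2 = q := by subst hm₁; simp [Mem.run, Instr.apply, inputMem, hq]
  refine Det.seq (Q := fun m' => m'.reg 8 = (n - 1) * p) ?_ ?_
  · refine Det.for (fun k m' => m'.reg 8 = k * p) e5 e4 ?_ ?_
    · subst hm₁; simp [Mem.run, Instr.apply]
    · intro k _ m' hU _ hI
      have f1 : m'.reg 1 = p := by rw [hU.reg 1 rfl, e1]
      refine (Det.block _ m').imp (by simp) fun _ _ m₂ hm₂ _ => ?_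
      subst hm₂
      simp [Mem.run, Instr.apply, hI, f1, Nat.succ_mul]
  intro m₂ hm₂ hU₂
  set L := (n - 1) * p / q with hL
  have hLn : L ≤ n - 1 := by
    rw [hL]
    exact Nat.div_le_of_le_mul (by rw [Nat.mul_comm q]; exact Nat.mul_le_mul_left _ hpq)
  have hloop := Sim.while_loop (s := s) (β := Unit) (A := fun _ => Unit) (t := .le 2 8)
    (p := .block [.sub 8 8 2, .add 6 6 4]) (b := 3) (L := L) (fun _ => PMF.pure)
    (fun k _ m' => m'.reg 8 = (n - 1) * p - k * q ∧ m'.reg 6 = k ∧ m'.reg 2 = q ∧ m'.reg 4 = 1)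
    (fun _ m' => m'.reg 6 = L) ?_ ?_ L 0 (by omega) () m₂ ?_
  · refine Sim.imp hloop (by gcongr) fun _ _ m₃ hm₃ hU₃ => ⟨?_, ?_, ?_, ?_, ?_, ?_⟩
    · rw [hU₃.reg 0 rfl, hU₂.reg 0 rfl, hU₁.reg 0 rfl]; rfl
    · rw [hU₃.reg 3 rfl, hU₂.reg 3 rfl]; subst hm₁; simp [Mem.run, Instr.apply]
    · rw [hU₃.reg 4 rfl, hU₂.reg 4 rfl, e4]
    · rw [hU₃.reg 5 rfl, hU₂.reg 5 rfl, e5]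
    · rw [hU₃.reg 28 rfl, hU₂.reg 28 rfl]; subst hm₁; simp [Mem.run, Instr.apply, inputMem]
    · rw [hm₃, floor_sub_one_mul hn]
  · rintro k hk - m' ⟨h1, h2, h3, h4⟩
    have hkq : (k + 1) * q ≤ (n - 1) * p :=
      (Nat.mul_le_mul_right q hk).trans (Nat.div_mul_le_self _ _)
    rw [Nat.succ_mul] at hkq
    refine ⟨by simp only [Test.Holds, h1, h3]; omega, PMF.pure (), by simp, ?_⟩
    refine (Det.block _ m').imp (by simp) fun _ _ m₃ hm₃ _ => ?_
    subst hm₃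
    refine ⟨?_, ?_, ?_, ?_⟩
    · simp [Mem.run, Instr.apply, h1, h3, Nat.succ_mul, Nat.sub_sub]
    · simp [Mem.run, Instr.apply, h2, h4]
    · simp [Mem.run, Instr.apply, h3]
    · simp [Mem.run, Instr.apply, h4]
  · rintro - m' ⟨h1, h2, h3, h4⟩
    refine ⟨?_, (), rfl, h2⟩
    simp only [Test.Holds, h1, h3]
    have h5 := Nat.div_add_mod ((n - 1) * p) q
    have h6 := Nat.mod_lt ((n - 1) * p) hq0
    rw [← hL, Nat.mul_comm] at h5
    omega
  · refine ⟨by simpa using hm₂, ?_, ?_, ?_⟩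
    · rw [hU₂.reg 6 rfl]; subst hm₁; simp [Mem.run, Instr.apply]
    · rw [hU₂.reg 2 rfl, e2]
    · rw [hU₂.reg 4 rfl, e4]

/-! ### Growing a tree by random attachment -/

theorem IsEdgeList.attach {k : ℕ} {a b a' b' : ℕ → ℕ} {T : LabelledTree (k + 1)}
    (h : IsEdgeList (k + 1) a b T.1) (x : Fin (k + 1)) (hb : ∀ j < k, b j = j + 1)
    (ha : ∀ j < k, a j ≤ j) (ha' : ∀ j, a' j = if j = k then x.val else a j)
    (hb' : ∀ j, b' j = if j = k then k + 1 else b j) :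
    IsEdgeList (k + 2) a' b' (T.attach x).1 := by
  intro u v
  have hsplit : (∃ j < k + 2 - 1, (a' j = u ∧ b' j = v) ∨ (a' j = v ∧ b' j = u)) ↔
      (∃ j < k, (a j = u ∧ b j = v) ∨ (a j = v ∧ b j = u)) ∨
      ((x.val = u ∧ k + 1 = v.val) ∨ (x.val = v ∧ k + 1 = u.val)) := by
    constructor
    · rintro ⟨j, hj, h1⟩
      by_cases hjk : j = k
      · subst hjk
        right
        simpa [ha', hb'] using h1
      · left
        refine ⟨j, by omega, ?_⟩
        simpa [ha', hb', hjk] using h1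
    · rintro (⟨j, hj, h1⟩ | h1)
      · refine ⟨j, by omega, ?_⟩
        simpa [ha', hb', hj.ne] using h1
      · refine ⟨k, by omega, ?_⟩
        simpa [ha', hb'] using h1
  rw [hsplit]
  show (T.1.map Fin.castSuccEmb ⊔ SimpleGraph.edge x.castSucc (Fin.last (k + 1))).Adj u v ↔ _
  rw [SimpleGraph.sup_adj, SimpleGraph.edge_adj]
  refine or_congr ?_ ?_
  · rw [SimpleGraph.map_adj]
    constructor
    · rintro ⟨u', v', h1, rfl, rfl⟩
      exact (h u' v').1 h1
    · rintro ⟨j, hj, h1⟩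
      have hlt : u.val < k + 1 ∧ v.val < k + 1 := by
        have := ha j hj
        have := hb j hj
        omega
      exact ⟨⟨u, hlt.1⟩, ⟨v, hlt.2⟩, (h _ _).2 ⟨j, hj, h1⟩, rfl, rfl⟩
  · have := x.isLt
    simp only [Fin.ext_iff, Fin.val_castSucc, Fin.val_last, Ne]
    omega

/-- Generate the host tree by random attachment. -/
def attachProg : Prog :=
  .block [.const 7 0] ;;
  .for 8 5 (
    .block [.add 9 8 4] ;;
    .rand 10 9 ;;
    .block [.store 0 8 10, .store 1 8 9])

theorem Sim.attachProg {s : ℝ} {n : ℕ} [NeZero n] {m : Mem} (h4 : m.reg 4 = 1)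
    (h5 : m.reg 5 = n - 1) :
    Sim s attachProg m (hostTree .attachment n) (fun T m' =>
      IsEdgeList n (m'.arr 0) (m'.arr 1) T.1 ∧ TreeOrder n (m'.arr 0) (m'.arr 1) (m'.reg 7))
      (n * 8 + 4) := by
  obtain ⟨N, rfl⟩ : ∃ N, n = N + 1 := Nat.exists_eq_succ_of_ne_zero (NeZero.ne n)
  rw [Nat.add_sub_cancel] at h5
  refine (Det.seq (Det.block _ m) (B' := N * (6 + 2) + 2) fun m₁ hm₁ hU₁ => ?_).mono_time
    (by simp; omega)
  have e7 : m₁.reg 7 = 0 := by subst hm₁; simp [Mem.run, Instr.apply]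
  obtain ⟨W, hW1, hW2, hW3⟩ := exists_tail_kernel (A := fun k => LabelledTree (k + 1))
    (fun k => attachmentTree (k + 1))
    (fun k T => (PMF.uniformOfFintype (Fin (k + 1))).map fun x => T.attach x) (fun k => rfl) N
  have hlaw : hostTree .attachment (N + 1) = W 0 (show LabelledTree 1 from ⟨⊥, SimpleGraph.IsTree.of_subsingleton⟩) := by
    show attachmentTree (N + 1) = _
    rw [← hW3]
    show (PMF.pure _).bind (W 0) = _
    rw [PMF.pure_bind]
  rw [hlaw]
  refine Sim.for W (fun k T m' => (∀ j < k, m'.arr 1 j = j + 1) ∧ (∀ j < k, m'.arr 0 j ≤ j) ∧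
    IsEdgeList (k + 1) (m'.arr 0) (m'.arr 1) T.1) _ (by rw [hU₁.reg 5 rfl, h5])
    (by rw [hU₁.reg 4 rfl, h4]) (by decide) (by decide) rfl rfl rfl _ ?_ ?_ ?_
  · exact ⟨by simp, by simp, fun u v => by simp⟩
  · rintro k hk T m' hU h8 ⟨i1, i2, i3⟩
    refine ⟨_, hW2 k hk T, ?_⟩
    have f4 : m'.reg 4 = 1 := by rw [hU.reg 4 rfl, hU₁.reg 4 rfl, h4]
    refine Det.seq (Det.block _ m') (B' := 4) fun m₂ hm₂ hU₂ => ?_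
    have f9 : m₂.reg 9 = k + 1 := by subst hm₂; simp [Mem.run, Instr.apply, h8, f4]
    have hne : (Finset.range (m₂.reg 9)).Nonempty := by
      rw [f9, Finset.nonempty_range_iff]; omega
    have hunif : PMF.uniformOfFintype (Fin (k + 1)) =
        (PMF.uniformOfFinset _ hne).map (Fin.ofNat (k + 1)) := by
      symm
      refine PMF.map_uniformOfFinset hne _ _ (by simp) (fun i hi j hj h => ?_) fun x _ => ?_
      · rw [Finset.coe_range, f9, Set.mem_Iio] at hi hj
        rw [← Fin.val_ofNat_of_lt hi, h, Fin.val_ofNat_of_lt hj]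
      · exact ⟨x, by rw [f9, Finset.mem_range]; exact x.isLt, Fin.ext (Fin.val_ofNat_of_lt x.isLt)⟩
    rw [hunif, PMF.map_comp]
    refine Sim.map (Sim.seq_det (Sim.rand hne) (R := fun v m'' => v < k + 1 ∧
      (∀ j, m''.arr 0 j = if j = k then v else m'.arr 0 j) ∧
      ∀ j, m''.arr 1 j = if j = k then k + 1 else m'.arr 1 j) (B' := 3)
      fun v hv m₃ hm₃ hU₃ => ?_) _ ?_
    · rw [PMF.mem_support_uniformOfFinset_iff, f9, Finset.mem_range] at hv
      have g10 : m₃.reg 10 = v := by subst hm₃; simp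
      have g9 : m₃.reg 9 = k + 1 := by subst hm₃; simpa using f9
      have g8 : m₃.reg 8 = k := by rw [hU₃.reg 8 rfl, hU₂.reg 8 rfl, h8]
      have b0 : m₃.arr 0 = m'.arr 0 := by rw [hU₃.arr 0 rfl, hU₂.arr 0 rfl]
      have b1 : m₃.arr 1 = m'.arr 1 := by rw [hU₃.arr 1 rfl, hU₂.arr 1 rfl]
      refine (Det.block _ m₃).imp (by simp) fun _ _ m₄ hm₄ _ => ?_
      subst hm₄
      refine ⟨hv, fun j => ?_, fun j => ?_⟩
      · simp [Mem.run, Instr.apply, Mem.arr_setArr, g8, g10, b0]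
      · simp [Mem.run, Instr.apply, Mem.arr_setArr, g8, g9, b1]
    · rintro v - m₄ ⟨hv, j0, j1⟩ -
      simp only [Mem.arr_setReg]
      refine ⟨fun j hj => ?_, fun j hj => ?_, ?_⟩
      · rw [j1]
        split_ifs with h
        · rw [h]
        · exact i1 j (by omega)
      · rw [j0]
        split_ifs with h
        · omega
        · exact i2 j (by omega)
      · exact i3.attach _ i1 i2 (fun j => by rw [j0, Fin.val_ofNat_of_lt hv]) j1
  · rintro T m' hU ⟨i1, i2, i3⟩
    refine ⟨T, hW1 T, i3, ?_⟩
    rw [hU.reg 7 rfl, e7]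
    refine ⟨Nat.succ_pos _, fun k hk => ?_, fun k hk => ?_, fun x hx => ?_, fun j hj k hk h => ?_,
      fun k hk => ?_, fun k hk => ?_⟩ <;> rw [Nat.add_sub_cancel] at *
    · have := i2 k hk
      omega
    · have := i1 k hk
      omega
    · rcases Nat.eq_zero_or_pos x with h | h
      · exact Or.inl h
      · exact Or.inr ⟨x - 1, by omega, by rw [i1 _ (by omega)]; omega⟩
    · rw [i1 j hj, i1 k hk] at h
      omega
    · rw [i1 k hk]; omega
    · have h1 := i2 k hk
      rcases Nat.eq_zero_or_pos (m'.arr 0 k) with h | h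
      · exact Or.inl h
      · exact Or.inr ⟨m'.arr 0 k - 1, by omega, by rw [i1 _ (by omega)]; omega⟩

/-! ### Topologically sorted lists of the nodes of a rooted forest -/

theorem Seg.append {f : ℕ → ℕ} {c : ℕ} {l l' : List ℕ} (h : Seg f c l)
    (h' : Seg f (c + l.length) l') : Seg f c (l ++ l') := by
  intro i hi
  by_cases hil : i < l.length
  · rw [List.getElem_append_left hil]
    exact h i hil
  · rw [List.getElem_append_right (by omega), ← h' _ (by
      rw [List.length_append] at hi
      omega)]
    congr 1
    omega

theorem Seg.map_range {f : ℕ → ℕ} {l : List ℕ} (h : Seg f 0 l) :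
    (List.range l.length).map f = l := by
  refine List.ext_getElem (by simp) fun i hi _ => ?_
  rw [List.length_map, List.length_range] at hi
  rw [List.getElem_map, List.getElem_range, ← h i hi, Nat.zero_add]

/-- The list `o` contains every node once, and parents come before their children. -/
structure ParentsFirst {n : ℕ} (F : Fin n → Option (Fin n)) (o : List (Fin n)) : Prop where
  nodup : o.Nodup
  mem : ∀ x, x ∈ o
  order : o.Pairwise fun x y => F x ≠ some y

theorem ParentsFirst.length_eq {n : ℕ} {F : Fin n → Option (Fin n)} {o : List (Fin n)}
    (h : ParentsFirst F o) : o.length = n := by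
  rw [← List.toFinset_card_of_nodup h.nodup, (Finset.eq_univ_iff_forall (s := o.toFinset)).2
    fun x => List.mem_toFinset.2 (h.mem x), Finset.card_univ, Fintype.card_fin]

/-- `rt` maps every node to the root of its tree. -/
structure RootMap {n : ℕ} (F : Fin n → Option (Fin n)) (rt : ℕ → ℕ) : Prop where
  root : ∀ x, F x = none → rt x.val = x.val
  child : ∀ x y, F x = some y → rt x.val = rt y.val

section

variable {n : ℕ} {F : Fin n → Option (Fin n)} {rt : ℕ → ℕ} {o : List (Fin n)}

theorem RootMap.eq_of_anc (h : RootMap F rt) {x y : Fin n} (hxy : Anc F x y) :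
    rt x.val = rt y.val := by
  induction hxy with
  | refl => rfl
  | tail _ hyz ih => exact ih.trans (h.child _ _ hyz)

theorem RootMap.anc_iff (h : RootMap F rt) (hF : IsForest F) {v r : Fin n} (hr : F r = none) :
    Anc F v r ↔ rt v.val = r.val := by
  refine ⟨fun h' => (h.eq_of_anc h').trans (h.root r hr), fun h' => ?_⟩
  obtain ⟨r', h1, h2⟩ := hF.exists_root v
  rw [h.eq_of_anc h1, h.root r' h2] at h'
  rwa [← Fin.ext h']

theorem RootMap.root_iff (h : RootMap F rt) (hF : IsForest F) {r : Fin n} :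
    F r = none ↔ rt r.val = r.val := by
  refine ⟨h.root r, fun h' => ?_⟩
  obtain ⟨r', h1, h2⟩ := hF.exists_root r
  rw [h.eq_of_anc h1, h.root r' h2] at h'
  rwa [← Fin.ext h']

theorem RootMap.mem_otherRoots_iff (h : RootMap F rt) (hF : IsForest F) {v r : Fin n} :
    r ∈ otherRoots F v ↔ rt r.val = r.val ∧ r.val ≠ rt v.val := by
  rw [mem_otherRoots, ← h.root_iff hF]
  refine and_congr_right fun hr => ?_
  rw [h.anc_iff hF hr, eq_comm]

theorem RootMap.update (h : RootMap F rt) {v r : Fin n} (hr : F r = none) (hv : rt v.val ≠ r.val)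
    {rt' : ℕ → ℕ} (hrt : ∀ x < n, rt' x = if rt x = r.val then rt v.val else rt x) :
    RootMap (Function.update F r (some v)) rt' := by
  constructor
  · intro x hx
    by_cases hxr : x = r
    · subst hxr; simp at hx
    · rw [Function.update_of_ne hxr] at hx
      rw [hrt x x.isLt, h.root x hx, if_neg fun h' => hxr (Fin.ext h')]
  · intro x y hxy
    rw [hrt x x.isLt, hrt y y.isLt]
    by_cases hxr : x = r
    · subst hxr
      rw [Function.update_self, Option.some_inj] at hxy
      subst hxy
      rw [if_pos (h.root x hr), if_neg hv]
    · rw [Function.update_of_ne hxr] at hxy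
      rw [h.child x y hxy]

/-- Joining `r` to `v` and moving the tree of `r` to the end of the list. -/
theorem ParentsFirst.update (ho : ParentsFirst F o) (h : RootMap F rt) {v r : Fin n}
    (hr : F r = none) (hv : rt v.val ≠ r.val) :
    ParentsFirst (Function.update F r (some v))
      (o.filter (fun x => rt x.val ≠ r.val) ++ o.filter (fun x => rt x.val = r.val)) := by
  refine ⟨?_, fun x => ?_, ?_⟩
  · rw [List.nodup_append]
    refine ⟨ho.nodup.filter _, ho.nodup.filter _, fun x hx y hy hxy => ?_⟩
    subst hxy
    rw [List.mem_filter, decide_eq_true_eq] at hx hy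
    exact hx.2 hy.2
  · have := ho.mem x
    simp only [List.mem_append, List.mem_filter, decide_eq_true_eq, this, true_and]
    exact (em _).symm
  · rw [List.pairwise_append]
    refine ⟨?_, ?_, fun x hx y hy hxy => ?_⟩
    · refine (ho.order.filter _).imp_of_mem fun {x y} hx _ hxy => ?_
      rw [List.mem_filter, decide_eq_true_eq] at hx
      rwa [Function.update_of_ne]
      rintro rfl
      exact hx.2 (h.root x hr)
    · refine (ho.order.filter _).imp_of_mem fun {x y} _ hy hxy => ?_
      rw [List.mem_filter, decide_eq_true_eq] at hy
      by_cases hxr : x = r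
      · subst hxr
        rw [Function.update_self, Ne, Option.some_inj]
        rintro rfl
        exact hv hy.2
      · rwa [Function.update_of_ne hxr]
    · rw [List.mem_filter, decide_eq_true_eq] at hx hy
      rw [Function.update_of_ne] at hxy
      · exact hx.2 ((h.child x y hxy).trans hy.2)
      · rintro rfl
        exact hx.2 (h.root x hr)

/-- The edges of a tree, sorted by a list of the nodes. -/
theorem ParentsFirst.treeOrder (ho : ParentsFirst F o) (hF : IsForest F)
    (hc : (nonroots F).card + 1 = n) {a b : ℕ → ℕ} {ρ : ℕ} (hρ : ∀ h : 0 < o.length, ρ = o[0])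
    (hb : ∀ k (h : k + 1 < o.length), b k = o[k + 1])
    (ha : ∀ k (h : k + 1 < o.length) y, F o[k + 1] = some y → a k = y) :
    TreeOrder n a b ρ ∧ IsEdgeList n a b (parentGraph F) := by
  have hlen := ho.length_eq
  have hpos : 0 < o.length := by omega
  obtain ⟨r, hr, hr'⟩ := exists_unique_root (F := F) (by simpa using hc)
  have hlt : ∀ i j (hi : i < o.length) (hj : j < o.length), F o[i] = some o[j] → j < i := by
    intro i j hi hj h
    rcases lt_trichotomy i j with h1 | rfl | h1
    · exact absurd h (List.pairwise_iff_getElem.1 ho.order i j hi hj h1)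
    · obtain ⟨g, hg⟩ := hF
      exact absurd (hg _ _ h) (lt_irrefl _)
    · exact h1
  have h0 : F o[0] = none := by
    cases hF0 : F o[0] with
    | none => rfl
    | some y =>
      obtain ⟨j, hj, rfl⟩ := List.getElem_of_mem (ho.mem y)
      exact absurd (hlt 0 j hpos hj hF0) (Nat.not_lt_zero _)
  have hinj : ∀ i j (hi : i < o.length) (hj : j < o.length), (o[i]).val = (o[j]).val → i = j :=
    fun i j hi hj h => (ho.nodup.getElem_inj_iff).1 (Fin.ext h)
  have hpar : ∀ k (h : k + 1 < o.length), ∃ j, ∃ hj : j < o.length, F o[k + 1] = some o[j] ∧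
      j < k + 1 := by
    intro k h
    cases hFk : F o[k + 1] with
    | none =>
      have h1 : o[k + 1] = o[0] := by rw [hr' _ hFk, hr' _ h0]
      have := hinj (k + 1) 0 h hpos (by rw [h1])
      omega
    | some y =>
      obtain ⟨j, hj, rfl⟩ := List.getElem_of_mem (ho.mem y)
      exact ⟨j, hj, rfl, hlt _ _ h hj hFk⟩
  refine ⟨⟨?_, fun k hk => ?_, fun k hk => ?_, fun x hx => ?_, fun i hi j hj h => ?_,
    fun k hk h => ?_, fun k hk => ?_⟩, fun u v => ?_⟩
  · rw [hρ hpos]; exact Fin.isLt _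
  · obtain ⟨j, hj, h1, -⟩ := hpar k (by omega)
    rw [ha k (by omega) _ h1]; exact Fin.isLt _
  · rw [hb k (by omega)]; exact Fin.isLt _
  · obtain ⟨j, hj, h1⟩ := List.getElem_of_mem (ho.mem ⟨x, hx⟩)
    rcases Nat.eq_zero_or_pos j with rfl | hj0
    · left; rw [hρ hpos, h1]
    · obtain ⟨k, rfl⟩ := Nat.exists_eq_succ_of_ne_zero hj0.ne'
      right; exact ⟨k, by omega, by rw [hb k hj, h1]⟩
  · rw [hb i (by omega), hb j (by omega)] at h
    have := hinj _ _ _ _ h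
    omega
  · rw [hb k (by omega), hρ hpos] at h
    have := hinj _ _ _ _ h
    omega
  · obtain ⟨j, hj, h1, h2⟩ := hpar k (by omega)
    rw [ha k (by omega) _ h1, hρ hpos]
    rcases Nat.eq_zero_or_pos j with rfl | hj0
    · exact Or.inl rfl
    · obtain ⟨i, rfl⟩ := Nat.exists_eq_succ_of_ne_zero hj0.ne'
      exact Or.inr ⟨i, by omega, hb i hj⟩
  · rw [hF.parentGraph_adj]
    have key : ∀ u v : Fin n, F u = some v ↔ ∃ k < n - 1, a k = v ∧ b k = u := by
      intro u v
      constructor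
      · intro h
        obtain ⟨j, hj, rfl⟩ := List.getElem_of_mem (ho.mem u)
        rcases Nat.eq_zero_or_pos j with rfl | hj0
        · rw [h0] at h; cases h
        · obtain ⟨k, rfl⟩ := Nat.exists_eq_succ_of_ne_zero hj0.ne'
          exact ⟨k, by omega, ha k hj v h, hb k hj⟩
      · rintro ⟨k, hk, h1, h2⟩
        obtain ⟨j, hj, h3, -⟩ := hpar k (by omega)
        rw [hb k (by omega)] at h2
        rw [ha k (by omega) _ h3] at h1
        rw [← Fin.ext h1, ← Fin.ext h2, h3]
    rw [key, key, ← exists_or]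
    refine exists_congr fun k => ?_
    rw [← and_or_left, or_comm]

end

/-! ### Generating a uniformly random tree -/

/-- The rooted forest `F` is stored: array `6` holds a list of the nodes, parents first, array `7`
the roots of the trees of the nodes, and array `8` the parents of the non-roots. -/
structure StoresForest {n : ℕ} (F : Fin n → Option (Fin n)) (m : Mem) : Prop where
  forest : IsForest F
  roots : RootMap F (m.arr 7)
  parents : ∀ x y, F x = some y → m.arr 8 x.val = y.val
  nodes : ∃ o, ParentsFirst F o ∧ Seg (m.arr 6) 0 (o.map Fin.val)

/-- Join the root in register `26` to the node in register `9`, which is in the tree with the root in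
register `10`. -/
def mergeProg : Prog :=
  .block [.store 8 26 9, .const 25 0] ;;
  .collect 21 0 25 22 23 9 (.block [.load 23 6 21, .load 20 7 23, .const 22 1] ;;
    .ite (.eq 20 26) (.instr (.const 22 0)) .skip) ;;
  .collect 21 0 25 22 23 9 (.block [.load 23 6 21, .load 20 7 23, .const 22 1] ;;
    .ite (.eq 20 26) .skip (.instr (.const 22 0))) ;;
  .for 21 0 (.block [.load 20 9 21, .store 6 21 20]) ;;
  .for 21 0 (.block [.load 20 7 21] ;; .ite (.eq 20 26) (.block [.store 7 21 10]) .skip)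

theorem Seg.filter_map_range {n : ℕ} {f : ℕ → ℕ} {o : List (Fin n)}
    (h : Seg f 0 (o.map Fin.val)) (hlen : o.length = n) (P : ℕ → Prop) [DecidablePred P] :
    ((List.range n).filter fun i => P (f i)).map f = (o.filter fun x => P x.val).map Fin.val := by
  have h1 := h.map_range
  rw [List.length_map, hlen] at h1
  have h2 := congrArg (List.filter fun x => decide (P x)) h1
  rw [List.filter_map, List.filter_map] at h2
  exact h2

theorem Det.mergeProg {s : ℝ} {n : ℕ} {m : Mem} {F : Fin n → Option (Fin n)} {v r : Fin n}
    (hS : StoresForest F m) (h0 : m.reg 0 = n) (h3 : m.reg 3 = 0) (h4 : m.reg 4 = 1)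
    (h9 : m.reg 9 = v) (h10 : m.reg 10 = m.arr 7 v) (h26 : m.reg 26 = r) (hr : F r = none)
    (hv : m.arr 7 v ≠ r) :
    Det s mergeProg m (StoresForest (Function.update F r (some v))) (n * 36 + 11) := by
  obtain ⟨hF, hrt, hpar, o, ho, hseg⟩ := hS
  have hlen := ho.length_eq
  set rt := m.arr 7 with hrtdef
  set o₁ := o.filter fun x => rt x.val ≠ r.val with ho₁
  set o₂ := o.filter fun x => rt x.val = r.val with ho₂
  have ho' : ParentsFirst (Function.update F r (some v)) (o₁ ++ o₂) := ho.update hrt hr hv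
  refine (Det.seq (Det.block _ m) (B' := n * 36 + 8) fun m₁ hm₁ hU₁ => ?_).mono_time
    (by simp; omega)
  have e25 : m₁.reg 25 = 0 := by subst hm₁; simp [Mem.run, Instr.apply]
  have e8 : ∀ x, m₁.arr 8 x = if x = r.val then v.val else m.arr 8 x := by
    intro x; subst hm₁; simp [Mem.run, Instr.apply, h26, h9]
  refine (Det.seq (Q := fun m' => m'.reg 25 = (o₁.map Fin.val).length ∧
    Seg (m'.arr 9) 0 (o₁.map Fin.val)) (B := n * (6 + 6) + 2) (B' := n * 24 + 6) ?_ ?_).mono_time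
    (by omega)
  · refine (Det.collect (s := s) (L := n) (b := 6) (fun i => rt (m.arr 6 i) ≠ r.val)
      (fun i => m.arr 6 i) (by rw [hU₁.reg 0 rfl, h0]) (by rw [hU₁.reg 4 rfl, h4])
      (by rw [hU₁.reg 3 rfl, h3]) ?_).imp le_rfl ?_
    · intro k hk m' hU hi
      have a6 : m'.arr 6 = m.arr 6 := by rw [hU.arr 6 rfl, hU₁.arr 6 rfl]
      have a7 : m'.arr 7 = rt := by rw [hU.arr 7 rfl, hU₁.arr 7 rfl]
      have f26 : m'.reg 26 = r := by rw [hU.reg 26 rfl, hU₁.reg 26 rfl, h26]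
      refine (Det.seq (Det.block _ m') (B' := 2) fun m₂ hm₂ hU₂ => ?_)
      have g20 : m₂.reg 20 = rt (m.arr 6 k) := by
        subst hm₂; simp [Mem.run, Instr.apply, hi, a6, a7]
      have g22 : m₂.reg 22 = 1 := by subst hm₂; simp [Mem.run, Instr.apply]
      have g23 : m₂.reg 23 = m.arr 6 k := by subst hm₂; simp [Mem.run, Instr.apply, hi, a6]
      have g26 : m₂.reg 26 = r := by rw [hU₂.reg 26 rfl, f26]
      refine Sim.ite (B := 1) (fun ht => ?_) fun ht => ?_
      · simp only [Test.Holds, g20, g26] at ht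
        refine (Det.instr _ m₂).imp (by omega) fun _ _ m₅ hm₅ _ => ?_
        subst hm₅
        simp [Instr.apply, ht]
      · simp only [Test.Holds, g20, g26] at ht
        refine (Sim.skip (a := ()) (Q := fun _ m' => m' = m₂) rfl).imp (by omega)
          fun _ _ m₅ hm₅ _ => ?_
        subst hm₅
        simp [g22, g23, ht]
    · rintro - - m' ⟨hm', -, hm''⟩ -
      rw [hseg.filter_map_range hlen (fun x => rt x ≠ r.val), e25] at hm' hm''
      rw [Nat.zero_add] at hm'
      exact ⟨hm', hm''⟩
  rintro m₂ ⟨hm₂, hseg₂⟩ hU₂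
  refine (Det.seq (Q := fun m' => Seg (m'.arr 9) 0 ((o₁ ++ o₂).map Fin.val))
    (B := n * (6 + 6) + 2) (B' := n * 12 + 4) ?_ ?_).mono_time (by omega)
  · refine (Det.collect (s := s) (L := n) (b := 6) (fun i => rt (m.arr 6 i) = r.val)
      (fun i => m.arr 6 i) (by rw [hU₂.reg 0 rfl, hU₁.reg 0 rfl, h0])
      (by rw [hU₂.reg 4 rfl, hU₁.reg 4 rfl, h4]) (by rw [hU₂.reg 3 rfl, hU₁.reg 3 rfl, h3])
      ?_).imp le_rfl ?_
    · intro k hk m' hU hi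
      have a6 : m'.arr 6 = m.arr 6 := by rw [hU.arr 6 rfl, hU₂.arr 6 rfl, hU₁.arr 6 rfl]
      have a7 : m'.arr 7 = rt := by rw [hU.arr 7 rfl, hU₂.arr 7 rfl, hU₁.arr 7 rfl]
      have f26 : m'.reg 26 = r := by rw [hU.reg 26 rfl, hU₂.reg 26 rfl, hU₁.reg 26 rfl, h26]
      refine (Det.seq (Det.block _ m') (B' := 2) fun m₃ hm₃ hU₃ => ?_)
      have g20 : m₃.reg 20 = rt (m.arr 6 k) := by
        subst hm₃; simp [Mem.run, Instr.apply, hi, a6, a7]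
      have g22 : m₃.reg 22 = 1 := by subst hm₃; simp [Mem.run, Instr.apply]
      have g23 : m₃.reg 23 = m.arr 6 k := by subst hm₃; simp [Mem.run, Instr.apply, hi, a6]
      have g26 : m₃.reg 26 = r := by rw [hU₃.reg 26 rfl, f26]
      refine Sim.ite (B := 1) (fun ht => ?_) fun ht => ?_
      · simp only [Test.Holds, g20, g26] at ht
        refine (Sim.skip (a := ()) (Q := fun _ m' => m' = m₃) rfl).imp (by omega)
          fun _ _ m₅ hm₅ _ => ?_
        subst hm₅
        simp [g22, g23, ht]
      · simp only [Test.Holds, g20, g26] at ht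
        refine (Det.instr _ m₃).imp (by omega) fun _ _ m₅ hm₅ _ => ?_
        subst hm₅
        simp [Instr.apply, ht]
    · rintro - - m' ⟨-, hold, hm'⟩ -
      rw [hseg.filter_map_range hlen (fun x => rt x = r.val), hm₂] at hm'
      rw [List.map_append]
      refine Seg.append (fun i hi => ?_) (by rw [Nat.zero_add]; exact hm')
      rw [hold _ (by omega)]
      exact hseg₂ i hi
  intro m₃ hseg₃ hU₃
  have hlen' : ((o₁ ++ o₂).map Fin.val).length = n := by rw [List.length_map, ho'.length_eq]
  refine (Det.seq (Q := fun m' => Seg (m'.arr 6) 0 ((o₁ ++ o₂).map Fin.val))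
    (B := n * (3 + 2) + 2) (B' := n * (5 + 2) + 2) ?_ ?_).mono_time (by omega)
  · refine (Det.for (fun k m' => ∀ i < k, m'.arr 6 i = m₃.arr 9 i) (L := n)
      (by rw [hU₃.reg 0 rfl, hU₂.reg 0 rfl, hU₁.reg 0 rfl, h0])
      (by rw [hU₃.reg 4 rfl, hU₂.reg 4 rfl, hU₁.reg 4 rfl, h4]) (by simp) ?_).imp le_rfl ?_
    · intro k hk m' hU hi hI
      have a9 : m'.arr 9 = m₃.arr 9 := hU.arr 9 rfl
      refine (Det.block _ m').imp (by simp) fun _ _ m₄ hm₄ _ => ?_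
      subst hm₄
      intro j hj
      rcases Nat.lt_succ_iff_lt_or_eq.1 hj with h | rfl
      · simp [Mem.run, Instr.apply, hi, h.ne, hI j h]
      · simp [Mem.run, Instr.apply, hi, a9]
    · intro _ _ m' hm' _ i hi
      rw [hm' _ (by omega)]
      exact hseg₃ i hi
  intro m₄ hseg₄ hU₄
  have b7 : m₄.arr 7 = rt := by rw [hU₄.arr 7 rfl, hU₃.arr 7 rfl, hU₂.arr 7 rfl, hU₁.arr 7 rfl]
  refine (Det.for (fun k m' => ∀ i, m'.arr 7 i = if i < k ∧ rt i = r.val then rt v else rt i)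
    (L := n) (b := 5) (by rw [hU₄.reg 0 rfl, hU₃.reg 0 rfl, hU₂.reg 0 rfl, hU₁.reg 0 rfl, h0])
    (by rw [hU₄.reg 4 rfl, hU₃.reg 4 rfl, hU₂.reg 4 rfl, hU₁.reg 4 rfl, h4])
    (by simp [b7]) ?_).imp le_rfl ?_
  · intro k hk m' hU hi hI
    have f26 : m'.reg 26 = r := by
      rw [hU.reg 26 rfl, hU₄.reg 26 rfl, hU₃.reg 26 rfl, hU₂.reg 26 rfl, hU₁.reg 26 rfl, h26]
    have f10 : m'.reg 10 = rt v := by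
      rw [hU.reg 10 rfl, hU₄.reg 10 rfl, hU₃.reg 10 rfl, hU₂.reg 10 rfl, hU₁.reg 10 rfl, h10]
    refine (Det.seq (Det.block _ m') (B' := 3) fun m₅ hm₅ hU₅ => ?_)
    have g20 : m₅.reg 20 = rt k := by subst hm₅; simp [Mem.run, Instr.apply, hi, hI]
    have g21 : m₅.reg 21 = k := by rw [hU₅.reg 21 rfl, hi]
    have g26 : m₅.reg 26 = r := by rw [hU₅.reg 26 rfl, f26]
    have g10 : m₅.reg 10 = rt v := by rw [hU₅.reg 10 rfl, f10]
    have c7 : m₅.arr 7 = m'.arr 7 := hU₅.arr 7 rfl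
    refine Sim.ite (B := 2) (fun ht => ?_) fun ht => ?_
    · simp only [Test.Holds, g20, g26] at ht
      refine (Det.block _ m₅).imp (by simp) fun _ _ m₆ hm₆ _ => ?_
      subst hm₆
      intro i
      by_cases hik : i = k
      · subst hik
        simp [Mem.run, Instr.apply, g21, g10, ht]
      · have : i < k + 1 ↔ i < k := by omega
        simp [Mem.run, Instr.apply, g21, hik, c7, hI, this]
    · simp only [Test.Holds, g20, g26] at ht
      refine (Sim.skip (a := ()) (Q := fun _ m' => m' = m₅) rfl).imp (by omega)
        fun _ _ m₆ hm₆ _ => ?_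
      subst hm₆
      intro i
      simp only [Mem.arr_setReg, c7, hI]
      by_cases hik : i = k
      · subst hik
        simp [ht]
      · have : i < k + 1 ↔ i < k := by omega
        simp only [this]
  · intro _ _ m₅ hm₅ hU₅
    have d8 : m₅.arr 8 = m₁.arr 8 := by
      rw [hU₅.arr 8 rfl, hU₄.arr 8 rfl, hU₃.arr 8 rfl, hU₂.arr 8 rfl]
    refine ⟨hF.update hr ?_, ?_, ?_, _, ho', ?_⟩
    · rwa [hrt.anc_iff hF hr]
    · refine hrt.update hr hv fun x hx => ?_
      rw [hm₅]
      simp only [hx, true_and]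
    · intro x y hxy
      rw [d8, e8]
      by_cases hxr : x = r
      · subst hxr
        rw [Function.update_self, Option.some_inj] at hxy
        rw [if_pos rfl, hxy]
      · rw [Function.update_of_ne hxr] at hxy
        rw [if_neg fun h => hxr (Fin.ext h), hpar x y hxy]
    · rwa [hU₅.arr 6 rfl]

/-- One step of growing a random forest. -/
def forestStepProg : Prog :=
  .rand 9 0 ;;
  .block [.load 10 7 9, .const 25 0] ;;
  .collect 21 0 25 22 21 9 (.block [.load 20 7 21, .const 22 0] ;;
    .ite (.eq 20 21) (.ite (.eq 20 10) .skip (.instr (.const 22 1))) .skip) ;;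
  .draw 16 25 26 9 ;;
  mergeProg

theorem uniform_fin_eq_map {n : ℕ} [NeZero n] {S : Finset ℕ} {S' : Finset (Fin n)}
    (hS : S.Nonempty) (hS' : S'.Nonempty) (h : ∀ x : Fin n, x ∈ S' ↔ x.val ∈ S)
    (hlt : ∀ x ∈ S, x < n) :
    PMF.uniformOfFinset S' hS' = (PMF.uniformOfFinset S hS).map (Fin.ofNat n) := by
  refine (PMF.map_uniformOfFinset hS hS' _ (fun x hx => ?_) (fun x hx y hy hxy => ?_)
    fun x hx => ⟨x, (h x).1 hx, Fin.ext (Fin.val_ofNat_of_lt x.isLt)⟩).symm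
  · rwa [h, Fin.val_ofNat_of_lt (hlt x hx)]
  · rw [← Fin.val_ofNat_of_lt (hlt x hx), hxy, Fin.val_ofNat_of_lt (hlt y hy)]

theorem Sim.forestStepProg {s : ℝ} {n : ℕ} [NeZero n] {m : Mem} {F : Fin n → Option (Fin n)}
    (hS : StoresForest F m) (hk : (nonroots F).card + 1 < n) (h0 : m.reg 0 = n) (h3 : m.reg 3 = 0)
    (h4 : m.reg 4 = 1) :
    Sim s forestStepProg m (forestStep F)
      (fun F' m' => StoresForest F' m' ∧ (nonroots F').card = (nonroots F).card + 1)
      (n * 48 + 19) := by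
  have hn : (Finset.range (m.reg 0)).Nonempty := by
    rw [h0, Finset.nonempty_range_iff]; exact NeZero.ne n
  have hF := hS.forest
  rw [forestStep, uniform_fin_eq_map hn Finset.univ_nonempty (by simp [h0]) (by simp [h0])]
  refine (Sim.seq ((Sim.rand hn).map (Fin.ofNat n) (R := fun v m' => m' = m.setReg 9 v.val) ?_)
    (B' := n * 48 + 18) ?_).mono_time (by omega)
  · rintro x hx m' rfl -
    rw [PMF.mem_support_uniformOfFinset_iff, Finset.mem_range, h0] at hx
    rw [Fin.val_ofNat_of_lt hx]
  intro v _ m₁ hm₁ hU₁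
  have h9 : m₁.reg 9 = v := by subst hm₁; simp
  have hne : (otherRoots F v).Nonempty := by
    rw [← Finset.card_pos, card_otherRoots hF, Fintype.card_fin]
    omega
  rw [dif_pos hne]
  set S := (Finset.range n).filter fun x => m.arr 7 x = x ∧ x ≠ m.arr 7 v with hSdef
  have hmem : ∀ x : Fin n, x ∈ otherRoots F v ↔ x.val ∈ S := fun x => by
    rw [hS.roots.mem_otherRoots_iff hF, hSdef, Finset.mem_filter, Finset.mem_range]
    simp only [x.isLt, true_and]
  have hSlt : ∀ x ∈ S, x < n := fun x hx => by
    rw [hSdef, Finset.mem_filter, Finset.mem_range] at hx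
    exact hx.1
  have hSne : S.Nonempty := by
    obtain ⟨x, hx⟩ := hne
    exact ⟨x, (hmem x).1 hx⟩
  rw [uniform_fin_eq_map hSne hne hmem hSlt, PMF.map_comp]
  refine (Det.seq (Det.block _ m₁) (B' := n * 48 + 15) fun m₂ hm₂ hU₂ => ?_).mono_time
    (by simp; omega)
  have e10 : m₂.reg 10 = m.arr 7 v := by
    have := hU₁.arr 7 rfl
    subst hm₂; simp [Mem.run, Instr.apply, h9, this]
  have e25 : m₂.reg 25 = 0 := by subst hm₂; simp [Mem.run, Instr.apply]
  set l := (List.range n).filter fun x => m.arr 7 x = x ∧ x ≠ m.arr 7 v with hl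
  refine (Det.seq (Q := fun m' => m'.reg 25 = l.length ∧ Seg (m'.arr 9) 0 l)
    (B := n * (6 + 6) + 2) (B' := n * 36 + 13) ?_ ?_).mono_time (by omega)
  · refine (Det.collect (s := s) (L := n) (b := 6) (fun x => m.arr 7 x = x ∧ x ≠ m.arr 7 v)
      (fun x => x) (by rw [hU₂.reg 0 rfl, hU₁.reg 0 rfl, h0])
      (by rw [hU₂.reg 4 rfl, hU₁.reg 4 rfl, h4]) (by rw [hU₂.reg 3 rfl, hU₁.reg 3 rfl, h3])
      ?_).imp le_rfl ?_
    · intro k hk m' hU hi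
      have a7 : m'.arr 7 = m.arr 7 := by rw [hU.arr 7 rfl, hU₂.arr 7 rfl, hU₁.arr 7 rfl]
      have f10 : m'.reg 10 = m.arr 7 v := by rw [hU.reg 10 rfl, e10]
      refine (Det.seq (Det.block _ m') (B' := 3) fun m₃ hm₃ hU₃ => ?_)
      have g20 : m₃.reg 20 = m.arr 7 k := by subst hm₃; simp [Mem.run, Instr.apply, hi, a7]
      have g22 : m₃.reg 22 = 0 := by subst hm₃; simp [Mem.run, Instr.apply]
      have g21 : m₃.reg 21 = k := by rw [hU₃.reg 21 rfl, hi]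
      have g10 : m₃.reg 10 = m.arr 7 v := by rw [hU₃.reg 10 rfl, f10]
      refine Sim.ite (B := 2) (fun ht => ?_) fun ht => ?_
      · simp only [Test.Holds, g20, g21] at ht
        refine Sim.ite (B := 1) (fun ht' => ?_) fun ht' => ?_
        · simp only [Test.Holds, g20, g10, ht] at ht'
          refine (Sim.skip (a := ()) (Q := fun _ m' => m' = m₃) rfl).imp (by omega)
            fun _ _ m₅ hm₅ _ => ?_
          subst hm₅
          simp [g22, g21, ← ht']
        · simp only [Test.Holds, g20, g10, ht] at ht'
          refine (Det.instr _ m₃).imp (by omega) fun _ _ m₅ hm₅ _ => ?_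
          subst hm₅
          simp [Instr.apply, ht, ht', g21]
      · simp only [Test.Holds, g20, g21] at ht
        refine (Sim.skip (a := ()) (Q := fun _ m' => m' = m₃) rfl).imp (by omega)
          fun _ _ m₅ hm₅ _ => ?_
        subst hm₅
        simp [g22, ht]
    · rintro - - m' ⟨hm', -, hm''⟩ -
      rw [List.map_id', e25] at hm' hm''
      rw [Nat.zero_add] at hm'
      exact ⟨hm', hm''⟩
  rintro m₃ ⟨hm₃, hseg₃⟩ hU₃
  refine Sim.mono_time (B := 2 + (n * 36 + 11)) ?_ (by omega)
  refine Sim.map (R := fun F' m' => StoresForest F' m' ∧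
    (nonroots F').card = (nonroots F).card + 1) (Sim.seq_det (R := fun x m' => StoresForest
    (Function.update F (Fin.ofNat n x) (some v)) m' ∧
      (nonroots (Function.update F (Fin.ofNat n x) (some v))).card = (nonroots F).card + 1)
    (Sim.draw hm₃ hseg₃ (List.nodup_range.filter _)
      (S := S) (fun x => by rw [hSdef, hl]; simp) hSne) (B' := n * 36 + 11) ?_) _
    fun _ _ _ h _ => h
  intro x hx m₄ hm₄ hU₄
  rw [PMF.mem_support_uniformOfFinset_iff] at hx
  have hval := Fin.val_ofNat_of_lt (hSlt x hx)
  set r := Fin.ofNat n x with hr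
  have hro : r ∈ otherRoots F v := by rw [hmem, hval]; exact hx
  have hrn := (mem_otherRoots.1 hro).1
  have hrv := ((hS.roots.mem_otherRoots_iff hF).1 hro).2
  have a6 : m₄.arr 6 = m.arr 6 := by
    rw [hU₄.arr 6 rfl, hU₃.arr 6 rfl, hU₂.arr 6 rfl, hU₁.arr 6 rfl]
  have a7 : m₄.arr 7 = m.arr 7 := by
    rw [hU₄.arr 7 rfl, hU₃.arr 7 rfl, hU₂.arr 7 rfl, hU₁.arr 7 rfl]
  have a8 : m₄.arr 8 = m.arr 8 := by
    rw [hU₄.arr 8 rfl, hU₃.arr 8 rfl, hU₂.arr 8 rfl, hU₁.arr 8 rfl]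
  refine (Det.mergeProg (v := v) (r := r) (m := m₄) ⟨hF, a7 ▸ hS.roots, a8 ▸ hS.parents,
    a6 ▸ hS.nodes⟩ ?_ ?_ ?_ ?_ ?_ ?_ hrn ?_).imp le_rfl
    fun _ _ m₅ h _ => ⟨h, card_nonroots_update hrn⟩
  · rw [hU₄.reg 0 rfl, hU₃.reg 0 rfl, hU₂.reg 0 rfl, hU₁.reg 0 rfl, h0]
  · rw [hU₄.reg 3 rfl, hU₃.reg 3 rfl, hU₂.reg 3 rfl, hU₁.reg 3 rfl, h3]
  · rw [hU₄.reg 4 rfl, hU₃.reg 4 rfl, hU₂.reg 4 rfl, hU₁.reg 4 rfl, h4]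
  · rw [hU₄.reg 9 rfl, hU₃.reg 9 rfl, hU₂.reg 9 rfl, h9]
  · rw [hU₄.reg 10 rfl, hU₃.reg 10 rfl, e10, a7]
  · rw [hm₄, hval]
  · rw [a7]; exact hrv.symm

/-- Generate a uniformly random host tree. -/
def uniformProg : Prog :=
  .for 21 0 (.block [.store 6 21 21, .store 7 21 21]) ;;
  .for 8 5 forestStepProg ;;
  .instr (.load 7 6 3) ;;
  .for 21 5 (.block [.add 20 21 4, .load 20 6 20, .load 19 8 20, .store 0 21 19, .store 1 21 20])

theorem Sim.uniformProg {s : ℝ} {n : ℕ} [NeZero n] {m : Mem} (h0 : m.reg 0 = n) (h3 : m.reg 3 = 0)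
    (h4 : m.reg 4 = 1) (h5 : m.reg 5 = n - 1) :
    Sim s uniformProg m (hostTree .uniform n) (fun T m' =>
      IsEdgeList n (m'.arr 0) (m'.arr 1) T.1 ∧ TreeOrder n (m'.arr 0) (m'.arr 1) (m'.reg 7))
      (n * (n * 48 + 34) + 7) := by
  classical
  have hn : 0 < n := Nat.pos_of_ne_zero (NeZero.ne n)
  refine (Det.seq (Q := StoresForest (n := n) fun _ => none) (B := n * (3 + 2) + 2)
    (B' := (n - 1) * (n * 48 + 19 + 2) + 2 + (1 + ((n - 1) * (6 + 2) + 2))) ?_ ?_).mono_time ?_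
  · refine (Det.for (fun k m' => ∀ i < k, m'.arr 6 i = i ∧ m'.arr 7 i = i) h0 h4 (by simp) ?_).imp
      le_rfl ?_
    · intro k hk m' hU hi hI
      refine (Det.block _ m').imp (by simp) fun _ _ m₂ hm₂ _ => ?_
      subst hm₂
      intro j hj
      rcases Nat.lt_succ_iff_lt_or_eq.1 hj with h | rfl
      · simp [Mem.run, Instr.apply, Mem.arr_setArr, hi, h.ne, hI j h]
      · simp [Mem.run, Instr.apply, Mem.arr_setArr, hi]
    · intro _ _ m' hm' _
      refine ⟨⟨fun _ => 0, by simp⟩, ⟨fun x _ => (hm' x x.isLt).2, by simp⟩, by simp,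
        List.finRange n, ⟨List.nodup_finRange n, List.mem_finRange, ?_⟩, fun i hi => ?_⟩
      · exact List.pairwise_of_forall (by simp)
      · rw [List.length_map, List.length_finRange] at hi
        rw [Nat.zero_add, (hm' i hi).1]
        simp
  · intro m₁ hm₁ hU₁
    obtain ⟨W, hW1, hW2, hW3⟩ := exists_tail_kernel (A := fun _ => Fin n → Option (Fin n))
      (fun k => randomForest (Fin n) k) (fun _ F => forestStep F) (fun k => rfl) (n - 1)
    have hlaw : hostTree .uniform n = (W 0 fun _ => none).map (forestTree n) := by
      have h1 : W 0 (fun _ => none) = randomForest (Fin n) (n - 1) := by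
        rw [← hW3, randomForest, PMF.pure_bind]
      rw [h1, map_forestTree_randomForest]
      rfl
    rw [hlaw]
    refine Sim.map (Sim.seq_det (R := fun F m' => IsForest F ∧ (nonroots F).card + 1 = n ∧
      IsEdgeList n (m'.arr 0) (m'.arr 1) (parentGraph F) ∧
      TreeOrder n (m'.arr 0) (m'.arr 1) (m'.reg 7)) (B := (n - 1) * (n * 48 + 19 + 2) + 2)
      (B' := 1 + ((n - 1) * (6 + 2) + 2)) (Q := fun F m' => StoresForest F m' ∧
        (nonroots F).card = n - 1) ?_ ?_) _ ?_
    · refine Sim.for W (fun k F m' => StoresForest F m' ∧ (nonroots F).card = k) _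
        (by rw [hU₁.reg 5 rfl, h5]) (by rw [hU₁.reg 4 rfl, h4]) (by decide) (by decide) rfl rfl rfl _
        ?_ ?_ ?_
      · exact ⟨⟨hm₁.forest, hm₁.roots, hm₁.parents, hm₁.nodes⟩, by simp [nonroots]⟩
      · rintro k hk F m' hU - ⟨i1, i2⟩
        refine ⟨_, hW2 k hk F, ?_⟩
        refine (Sim.forestStepProg i1 (by omega) (by rw [hU.reg 0 rfl, hU₁.reg 0 rfl, h0])
          (by rw [hU.reg 3 rfl, hU₁.reg 3 rfl, h3])
          (by rw [hU.reg 4 rfl, hU₁.reg 4 rfl, h4])).imp le_rfl ?_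
        rintro F' - m'' ⟨j1, j2⟩ -
        exact ⟨⟨j1.forest, j1.roots, j1.parents, j1.nodes⟩, by rw [j2, i2]⟩
      · rintro F m' - h
        exact ⟨F, hW1 F, h⟩
    · rintro F - m₂ ⟨hS, hc⟩ hU₂
      obtain ⟨hF, -, hpar, o, ho, hseg⟩ := hS
      have hlen := ho.length_eq
      have hget : ∀ i (hi : i < o.length), m₂.arr 6 i = o[i] := fun i hi => by
        have := hseg i (by simpa using hi)
        rwa [Nat.zero_add, List.getElem_map] at this
      refine Det.seq (Det.instr _ m₂) fun m₃ hm₃ hU₃ => ?_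
      have e7 : m₃.reg 7 = m₂.arr 6 0 := by
        have : m₂.reg 3 = 0 := by rw [hU₂.reg 3 rfl, hU₁.reg 3 rfl, h3]
        subst hm₃; simp [Instr.apply, this]
      have a6 : m₃.arr 6 = m₂.arr 6 := hU₃.arr 6 rfl
      have a8 : m₃.arr 8 = m₂.arr 8 := hU₃.arr 8 rfl
      refine (Det.for (fun k m' => ∀ i < k, m'.arr 1 i = m₂.arr 6 (i + 1) ∧
        m'.arr 0 i = m₂.arr 8 (m₂.arr 6 (i + 1))) (L := n - 1) (b := 6)
        (by rw [hU₃.reg 5 rfl, hU₂.reg 5 rfl, hU₁.reg 5 rfl, h5])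
        (by rw [hU₃.reg 4 rfl, hU₂.reg 4 rfl, hU₁.reg 4 rfl, h4]) (by simp) ?_).imp le_rfl ?_
      · intro k hk m' hU hi hI
        have b6 : m'.arr 6 = m₂.arr 6 := by rw [hU.arr 6 rfl, a6]
        have b8 : m'.arr 8 = m₂.arr 8 := by rw [hU.arr 8 rfl, a8]
        have f4 : m'.reg 4 = 1 := by
          rw [hU.reg 4 rfl, hU₃.reg 4 rfl, hU₂.reg 4 rfl, hU₁.reg 4 rfl, h4]
        refine (Det.block _ m').imp (by simp) fun _ _ m₄ hm₄ _ => ?_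
        subst hm₄
        intro j hj
        rcases Nat.lt_succ_iff_lt_or_eq.1 hj with h | rfl
        · simp [Mem.run, Instr.apply, Mem.arr_setArr, hi, h.ne, hI j h]
        · simp [Mem.run, Instr.apply, Mem.arr_setArr, hi, f4, b6, b8]
      · intro _ _ m₄ hm₄ hU₄
        have := ho.treeOrder hF (by omega) (a := m₄.arr 0) (b := m₄.arr 1) (ρ := m₄.reg 7)
          (fun h => by rw [hU₄.reg 7 rfl, e7, hget 0 h])
          (fun k h => by rw [(hm₄ k (by omega)).1, hget _ h])
          (fun k h y hy => by rw [(hm₄ k (by omega)).2, hget _ h, hpar _ _ hy])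
        exact ⟨hF, by omega, this.2, this.1⟩
    · rintro F - m' ⟨hF, hc, h1, h2⟩ -
      refine ⟨?_, h2⟩
      rw [forestTree, dif_pos (hF.isTree (by simpa using hc))]
      exact h1
  · obtain ⟨N, rfl⟩ : ∃ N, n = N + 1 := Nat.exists_eq_succ_of_ne_zero hn.ne'
    rw [Nat.add_sub_cancel]
    nlinarith

/-! ### The whole algorithm -/

theorem StoresLists.unique {n : ℕ} {m : Mem} {a b : ℕ} {F F' : Fin n → Set (Fin n)}
    (h : StoresLists m a b F) (h' : StoresLists m a b F') : F = F' := by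
  funext i
  exact Set.image_injective.2 Fin.val_injective ((h i).2.2.symm.trans (h' i).2.2)

theorem StoresResult.unique {n : ℕ} {m : Mem} {r r' : GenResult n} (h : StoresResult m r)
    (h' : StoresResult m r') : r = r' := by
  refine GenResult.ext ?_ ?_ ?_
  · ext u v
    rw [h.1 u v, h'.1 u v]
  · funext i
    exact Finset.coe_injective (congrFun (h.2.1.unique h'.2.1) i)
  · ext u v
    have := congrFun (h.2.2.unique h'.2.2) u
    rw [← SimpleGraph.mem_neighborSet, ← SimpleGraph.mem_neighborSet, this]

/-- Generate the host tree. -/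
def hostTreeProg : HostTreeMethod → Prog
  | .uniform => uniformProg
  | .attachment => attachProg

theorem Sim.hostTreeProg_hostTree {s : ℝ} {n : ℕ} [NeZero n] {m : Mem} (M : HostTreeMethod) (h0 : m.reg 0 = n)
    (h3 : m.reg 3 = 0) (h4 : m.reg 4 = 1) (h5 : m.reg 5 = n - 1) :
    Sim s (hostTreeProg M) m (hostTree M n) (fun T m' =>
      (IsEdgeList n (m'.arr 0) (m'.arr 1) T.1 ∧ TreeOrder n (m'.arr 0) (m'.arr 1) (m'.reg 7)) ∧
      ∀ x ∈ [0, 3, 4, 5, 6, 28], m'.reg x = m.reg x) (n * (n * 48 + 34) + 7) := by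
  cases M with
  | uniform =>
    refine (Sim.uniformProg h0 h3 h4 h5).imp le_rfl fun T _ m' h hU => ⟨h, fun x hx => hU.reg x ?_⟩
    fin_cases hx <;> rfl
  | attachment =>
    refine (Sim.attachProg h4 h5).imp (by nlinarith) fun T _ m' h hU => ⟨h, fun x hx => hU.reg x ?_⟩
    fin_cases hx <;> rfl

theorem Sim.chordalGen {s : ℝ} {n : ℕ} [NeZero n] (M : HostTreeMethod) (f : Set.Icc (0 : ℚ) 1) :
    Sim s (setupProg ;; hostTreeProg M ;; _root_.tailProg) (inputMem n f.1) (chordalGenPruned M n f s)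
      (fun r m' => StoresResult m' r) (n * (n * 147 + 142) + 28) := by
  refine (Det.seq (Det.setupProg (Nat.pos_of_ne_zero (NeZero.ne n)) f)
    (B' := n * (n * 48 + 34) + 7 + (n * (n * 99 + 100) + 11)) ?_).mono_time (le_of_eq (by ring))
  rintro m₁ ⟨h0, h3, h4, h5, h28, h6⟩ -
  refine Sim.seq (Sim.hostTreeProg_hostTree M h0 h3 h4 h5) ?_
  rintro T - m₂ ⟨⟨hE, hT⟩, hreg⟩ -
  exact Sim.tailProg rfl rfl rfl hT T hE f (by rw [hreg 0 (by simp), h0])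
    (by rw [hreg 3 (by simp), h3]) (by rw [hreg 4 (by simp), h4]) (by rw [hreg 5 (by simp), h5])
    (by rw [hreg 6 (by simp), h6]) (by rw [hreg 28 (by simp), h28])

theorem corollary11 (M : HostTreeMethod) :
    ∃ (P : Prog) (C : ℕ), ∀ (n : ℕ) [NeZero n] (f : Set.Icc (0 : ℚ) 1) (s : Set.Icc (0 : ℝ) 1),
      ∃ μ : PMF (Mem × ℕ),
        Exec s.1 P (inputMem n f.1) μ ∧
        (∀ r : GenResult n,
          μ.toOuterMeasure {a | StoresResult a.1 r} = chordalGenPruned M n f s.1 r) ∧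
        (∀ a ∈ μ.support, ∃ r : GenResult n,
          StoresResult a.1 r ∧ a.2 ≤ C * (n ^ 2 + r.totalSize)) := by
  refine ⟨setupProg ;; hostTreeProg M ;; tailProg, 317, fun n _ f s => ?_⟩
  obtain ⟨γ, h1, h2, h3⟩ := Sim.chordalGen (s := s.1) (n := n) M f
  refine ⟨γ.map Prod.snd, h2, fun r => ?_, fun a ha => ?_⟩
  · rw [← h1, ← PMF.toOuterMeasure_apply_singleton, PMF.toOuterMeasure_map_apply,
      PMF.toOuterMeasure_map_apply]
    refine PMF.toOuterMeasure_apply_eq_of_inter_support_eq _ ?_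
    ext x
    simp only [Set.mem_inter_iff, Set.mem_preimage, Set.mem_ofPred_eq, Set.mem_singleton_iff]
    refine and_congr_left fun hx => ⟨fun h => (h3 x hx).1.unique h, ?_⟩
    rintro rfl
    exact (h3 x hx).1
  · rw [PMF.support_map] at ha
    obtain ⟨x, hx, rfl⟩ := ha
    refine ⟨x.1, (h3 x hx).1, (h3 x hx).2.trans ?_⟩
    have hn : 1 ≤ n := Nat.one_le_iff_ne_zero.2 (NeZero.ne n)
    nlinarith [Nat.zero_le x.1.totalSize]
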